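/- Let $\sigma_{AB}$ be the round metric of the unit sphere $S^2\subset\mathbb R^3$, with Levi-Civita connection $\nabla$, Laplacian $\Delta$ and volume form $\epsilon_{AB}$ (indices are raised with $\sigma$, and integrals over $S^2$ are with respect to the area of $\sigma$), and let $\tilde X^k$, $k=1,2,3$, be the restrictions to $S^2$ of the coordinate functions of $\mathbb R^3$. For smooth functions $f,g$ on $S^2$ put $$[f,g]_1=\epsilon^{AB}\nabla_Af\,\nabla_Bg,\qquad [f,g]_2=\tfrac12\big((\Delta f)g-(\Delta g)f\big).$$ Let $I\subset\mathbb R$ be a non-degenerate interval, and consider, in Bondi-Sachs coordinates $(u,r,x)$ with $u\in I$, $x\in S^2$ and $r$ large, a solution of the vacuum Einstein equations $$g=-UV\,du^2-2U\,du\,dr+r^2h_{AB}(dx^A+W^Adu)(dx^B+W^Bdu),\qquad \det h=\det\sigma,$$ whose coefficients have, as $r\to\infty$, smooth expansions in inverse integral powers of $r$ of the form $$U=1-\frac{|C|^2}{16r^2}+O(r^{-3}),\qquad V=1-\frac{2m}{r}+O(r^{-2}),\qquad h_{AB}=\sigma_{AB}+\frac{C_{AB}}{r}+\frac{|C|^2}{4r^2}\sigma_{AB}+O(r^{-3}),$$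 $$W^A=\frac{1}{2r^2}\nabla_BC^{AB}+\frac1{r^3}\Big(\tfrac23N^A-\tfrac1{16}\nabla^A|C|^2-\tfrac12C^{AB}\nabla^DC_{BD}\Big)+O(r^{-4}).$$ Here the mass aspect $m$, the angular momentum aspect $N_A$ and the shear $C_{AB}$ (a symmetric traceless tensor) are smooth fields on $S^2$ depending smoothly on $u$. Let $N_{AB}=\partial_uC_{AB}$ be the news, and let $$\tilde J^k=\int_{S^2}\epsilon^{AB}\nabla_B\tilde X^k\Big[N_A-\tfrac14C_A{}^{D}\nabla^EC_{DE}\Big],$$ $$\tilde C^k=\int_{S^2}\nabla^A\tilde X^k\Big[N_A-u\nabla_Am-\tfrac14C_A{}^{D}\nabla^EC_{DE}-\tfrac1{16}\nabla_A(C_{DE}C^{DE})\Big]$$ be the classical angular momentum and center of mass. Suppose that, for each $u\in I$, $c,\underline c,n,\underline n$ are smooth functions on $S^2$ that are potentials of the shear and the news, that is, $$C_{AB}=\nabla_A\nabla_Bc-\tfrac12\sigma_{AB}\Delta c+\tfrac12\big(\epsilon_A{}^{E}\nabla_E\nabla_B\underline c+\epsilon_B{}^{E}\nabla_E\nabla_A\underline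 c\big),$$ $$N_{AB}=\nabla_A\nabla_Bn-\tfrac12\sigma_{AB}\Delta n+\tfrac12\big(\epsilon_A{}^{E}\nabla_E\nabla_B\underline n+\epsilon_B{}^{E}\nabla_E\nabla_A\underline n\big).$$ Then, for $k=1,2,3$ and every $u\in I$, $$\partial_u\tilde J^k=\frac18\int_{S^2}\tilde X^k\Big([c,\Delta(\Delta+2)n]_1+[\underline c,\Delta(\Delta+2)\underline n]_1\Big),$$ $$\partial_u\tilde C^k=\frac18\int_{S^2}\tilde X^k\Big(u\big[((\Delta+2)n)^2+((\Delta+2)\underline n)^2-4\epsilon^{AB}\nabla_An\,\nabla_B(\Delta+2)\underline n\big]+[(\Delta+2)c,(\Delta+2)n]_2+[(\Delta+2)\underline c,(\Delta+2)\underline n]_2\Big).$$ (At an endpoint of $I$ that belongs to $I$, $\partial_u$ is the one-sided derivative.) -/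

import Mathlib

open MeasureTheory
open scoped Manifold ContDiff

noncomputable section

/-! ### Tensor calculus on the round unit sphere

A tensor field on the sphere is given by its components in the ambient `ℝ³`, the tangential ones
being those that vanish when contracted with the position vector. Indices are raised with the
Euclidean metric, so their position is immaterial. -/

/-- Euclidean three-space. -/
abbrev E3 : Type := EuclideanSpace ℝ (Fin 3)

/-- The unit sphere `S²` in `ℝ³`. -/
abbrev S2 : Type := Metric.sphere (0 : E3) 1

open Classical in
/-- The radial projection `y ↦ y / |y|` onto the sphere (with a junk value at the origin). -/
def toS2 (y : E3) : S2 :=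
  if hy : y = 0 then ⟨EuclideanSpace.single 0 1, by simp⟩
  else ⟨‖y‖⁻¹ • y, by simp [norm_smul, inv_mul_cancel₀ (norm_ne_zero_iff.mpr hy)]⟩

/-- The area measure of the round unit sphere. -/
def area : Measure S2 := (volume : Measure E3).toSphere

/-- Ambient components of the gradient `∇_a f` of a function on the sphere: the derivatives of the
extension of `f` that is constant along rays. -/
def grad (f : S2 → ℝ) (x : S2) (a : Fin 3) : ℝ :=
  fderiv ℝ (fun y : E3 => f (toS2 y)) (x : E3) (EuclideanSpace.single a 1)

/-- Ambient components of the round metric `σ_{ab}`, that is, of the tangential projection. -/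
def sigma (x : S2) (a b : Fin 3) : ℝ := (if a = b then 1 else 0) - x.1 a * x.1 b

/-- The sign of the permutation `(i, j, k)` of `(0, 1, 2)`, and `0` if an index is repeated. -/
def leviCivita (i j k : Fin 3) : ℝ :=
  (((j : ℕ) : ℝ) - ((i : ℕ) : ℝ)) * (((k : ℕ) : ℝ) - ((i : ℕ) : ℝ)) *
    (((k : ℕ) : ℝ) - ((j : ℕ) : ℝ)) / 2

/-- The volume form `ε_{ab}` of the sphere, for the orientation given by the outer normal. -/
def eps (x : S2) (a b : Fin 3) : ℝ := ∑ c, leviCivita a b c * x.1 c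

/-- Covariant derivative `∇_a η_b` of a tangential one-form: the tangential part of the
ambient derivative. -/
def nabla1 (η : S2 → Fin 3 → ℝ) (x : S2) (a b : Fin 3) : ℝ :=
  ∑ c, grad (fun y => η y c) x a * sigma x c b

/-- Covariant derivative `∇_a T_{bc}` of a tangential 2-tensor. -/
def nabla2 (T : S2 → Fin 3 → Fin 3 → ℝ) (x : S2) (a b c : Fin 3) : ℝ :=
  ∑ d, ∑ e, grad (fun y => T y d e) x a * sigma x d b * sigma x e c

/-- The Hessian `∇_a ∇_b f`. -/
def hess (f : S2 → ℝ) : S2 → Fin 3 → Fin 3 → ℝ := nabla1 (grad f)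

/-- The Laplacian `Δ f`. -/
def lap (f : S2 → ℝ) (x : S2) : ℝ := ∑ a, hess f x a a

/-- The operator `Δ + 2`. -/
def lap2 (f : S2 → ℝ) (x : S2) : ℝ := lap f x + 2 * f x

/-- The divergence `∇^b T_{ba}` of a 2-tensor. -/
def div2 (T : S2 → Fin 3 → Fin 3 → ℝ) (x : S2) (a : Fin 3) : ℝ := ∑ b, nabla2 T x b b a

/-- The square norm `T_{ab} T^{ab}`. -/
def normSq2 (T : S2 → Fin 3 → Fin 3 → ℝ) (x : S2) : ℝ := ∑ a, ∑ b, T x a b ^ 2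

/-- The bracket `[f, g]₁ = ε^{ab} ∇_a f ∇_b g`, the Poisson bracket of the sphere. -/
def bracket1 (f g : S2 → ℝ) (x : S2) : ℝ := ∑ a, ∑ b, eps x a b * grad f x a * grad g x b

/-- The bracket `[f, g]₂ = ½ ((Δ f) g - (Δ g) f)`. -/
def bracket2 (f g : S2 → ℝ) (x : S2) : ℝ := (lap f x * g x - lap g x * f x) / 2

/-- The coordinate function `X̃ᵏ` on the sphere. -/
def coordX (k : Fin 3) (x : S2) : ℝ := x.1 k

/-- The symmetric traceless 2-tensor
`∇_a∇_b f - ½ σ_{ab} Δf + ½ (ε_a^e ∇_e∇_b g + ε_b^e ∇_e∇_a g)` with potentials `(f, g)`. -/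
def tensorOfPotentials (f g : S2 → ℝ) (x : S2) (a b : Fin 3) : ℝ :=
  hess f x a b - sigma x a b * lap f x / 2 +
    ((∑ e, eps x a e * hess g x e b) + ∑ e, eps x b e * hess g x e a) / 2

/-- The 1-form with components `η` is tangential at `x`. -/
def IsTangent1 (x : S2) (η : Fin 3 → ℝ) : Prop := ∑ a, x.1 a * η a = 0

/-- The 2-tensor with components `T` is symmetric and tangential at `x`. -/
def IsSymTangent2 (x : S2) (T : Fin 3 → Fin 3 → ℝ) : Prop :=
  (∀ a b, T a b = T b a) ∧ ∀ a, ∑ b, T a b * x.1 b = 0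

/-! ### Ricci curvature in a coordinate system -/

/-- Partial derivative `∂_μ f` at `z`. -/
def pderiv4 (f : (Fin 4 → ℝ) → ℝ) (z : Fin 4 → ℝ) (μ : Fin 4) : ℝ :=
  fderiv ℝ f z (Pi.single μ 1)

/-- Christoffel symbols `Γ^l_{μν}` of a metric on (an open subset of) `ℝ⁴`. -/
def christoffel (g : (Fin 4 → ℝ) → Matrix (Fin 4) (Fin 4) ℝ) (z : Fin 4 → ℝ)
    (l μ ν : Fin 4) : ℝ :=
  ∑ κ, (g z)⁻¹ l κ * (pderiv4 (fun w => g w κ ν) z μ + pderiv4 (fun w => g w κ μ) z ν -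
    pderiv4 (fun w => g w μ ν) z κ) / 2

/-- The Ricci tensor `R_{μν} = ∂_l Γ^l_{μν} - ∂_ν Γ^l_{lμ} + Γ^l_{lκ} Γ^κ_{μν} - Γ^l_{νκ} Γ^κ_{lμ}`. -/
def ricci (g : (Fin 4 → ℝ) → Matrix (Fin 4) (Fin 4) ℝ) (z : Fin 4 → ℝ) (μ ν : Fin 4) : ℝ :=
  (∑ l, (pderiv4 (fun w => christoffel g w l μ ν) z l -
      pderiv4 (fun w => christoffel g w l l μ) z ν)) +
    ∑ l, ∑ κ, (christoffel g z l l κ * christoffel g z κ μ ν -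
      christoffel g z l ν κ * christoffel g z κ l μ)

/-! ### Bondi-Sachs coordinates and null infinity -/

/-- The metric coefficients of a Bondi-Sachs coordinate system, as functions of the retarded time
`u`, the radial coordinate `r` and the point `x` of the sphere: functions `U, V`, a vector field `W`
and a 2-tensor field `h` on the sphere. -/
structure BondiSachs where
  U : ℝ → ℝ → S2 → ℝ
  V : ℝ → ℝ → S2 → ℝ
  W : ℝ → ℝ → S2 → Fin 3 → ℝ
  h : ℝ → ℝ → S2 → Fin 3 → Fin 3 → ℝ

/-- The space part `y ∈ ℝ³` of the point `z = (u, y)` of `ℝ⁴`. -/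
def spacePart (z : Fin 4 → ℝ) : E3 := WithLp.toLp 2 fun i => z i.succ

/-- The metric
`g = -U V du² - 2 U du dr + r² h_{AB} (dx^A + W^A du) (dx^B + W^B du)`
written in the coordinates `(u, y)`, `y = r x ∈ ℝ³`, which cover all `(u, r, x)` with `r > 0`.
With `dr = x_i dy^i` and `dx_i = σ_{ij} dy^j / r` its components are
`g_{uu} = -U V + r² h(W, W)`, `g_{u i} = -U x_i + r h_{ij} W^j` and `g_{ij} = h_{ij}`. -/
def BondiSachs.metric (B : BondiSachs) (z : Fin 4 → ℝ) : Matrix (Fin 4) (Fin 4) ℝ :=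
  let u := z 0
  let r := ‖spacePart z‖
  let x := toS2 (spacePart z)
  let hW : Fin 3 → ℝ := fun i => ∑ j, B.h u r x i j * B.W u r x j
  let mixed : Fin 3 → ℝ := fun i => -(B.U u r x) * x.1 i + r * hW i
  Matrix.of (Fin.cons
    (Fin.cons (-(B.U u r x * B.V u r x) + r ^ 2 * ∑ i, hW i * B.W u r x i) mixed)
    (fun i => Fin.cons (mixed i) (B.h u r x i)))

/-- The mass aspect `m`, the angular momentum aspect `N_A` and the shear tensor `C_{AB}`, as fields
on the sphere that depend on the retarded time. -/
structure ScriData where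
  m : ℝ → S2 → ℝ
  N : ℝ → S2 → Fin 3 → ℝ
  C : ℝ → S2 → Fin 3 → Fin 3 → ℝ

/-- The news tensor `N_{AB} = ∂_u C_{AB}`; the retarded time ranges over `I`. -/
def ScriData.news (D : ScriData) (I : Set ℝ) (u : ℝ) (x : S2) (a b : Fin 3) : ℝ :=
  derivWithin (fun v => D.C v x a b) I u

/-- `f` is smooth on `I × S²`. -/
def SmoothOnScri (I : Set ℝ) (f : ℝ → S2 → ℝ) : Prop :=
  ContMDiffOn (𝓘(ℝ, ℝ).prod (𝓡 2)) 𝓘(ℝ, ℝ) ∞ (fun p : ℝ × S2 => f p.1 p.2)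
    {p | p.1 ∈ I}

/-- `f`, a function of `u`, `ρ = 1 / r` and the point of the sphere, is smooth
on the region `r > R u` and up to null infinity `ρ = 0`. -/
def SmoothUpToScri (I : Set ℝ) (R : ℝ → ℝ) (f : ℝ → ℝ → S2 → ℝ) : Prop :=
  ContMDiffOn ((𝓘(ℝ, ℝ).prod 𝓘(ℝ, ℝ)).prod (𝓡 2)) 𝓘(ℝ, ℝ) ∞
    (fun p : (ℝ × ℝ) × S2 => f p.1.1 p.1.2 p.2)
    {p | p.1.1 ∈ I ∧ 0 ≤ p.1.2 ∧ p.1.2 * R p.1.1 < 1}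

/-- The Bondi-Sachs metric `B`, on the region `u ∈ I`, `r > R u`, is a solution of the vacuum
Einstein equations that satisfies the Bondi-Sachs gauge condition and has, in inverse integral
powers of `r`, the expansion
* `U = 1 - |C|² / (16 r²) + O(r⁻³)`,
* `V = 1 - 2 m / r + O(r⁻²)`,
* `W^A = ∇_B C^{AB} / (2 r²)
    + (2/3 N^A - 1/16 ∇^A |C|² - 1/2 C^{AB} ∇^D C_{BD}) / r³ + O(r⁻⁴)`,
* `h_{AB} = σ_{AB} + C_{AB} / r + |C|² σ_{AB} / (4 r²) + O(r⁻³)`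

at null infinity, so that `D` consists of its mass aspect, angular momentum aspect and shear. Each
remainder is the indicated power of `1 / r` times a smooth function of `(u, 1 / r, x)` up to
`1 / r = 0`, which says that the expansion continues to all orders and may be differentiated. -/
structure IsVacuumBondiSachs (I : Set ℝ) (R : ℝ → ℝ) (B : BondiSachs) (D : ScriData) : Prop where
  R_pos : ∀ u ∈ I, 0 < R u
  R_cont : ContinuousOn R I
  smooth_m : SmoothOnScri I D.m
  smooth_N : ∀ a, SmoothOnScri I (fun u x => D.N u x a)
  smooth_C : ∀ a b, SmoothOnScri I (fun u x => D.C u x a b)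
  tangent_N : ∀ u ∈ I, ∀ x, IsTangent1 x (D.N u x)
  tangent_C : ∀ u ∈ I, ∀ x, IsSymTangent2 x (D.C u x)
  traceless_C : ∀ u ∈ I, ∀ x, ∑ a, D.C u x a a = 0
  tangent_W : ∀ u ∈ I, ∀ r, R u < r → ∀ x, IsTangent1 x (B.W u r x)
  tangent_h : ∀ u ∈ I, ∀ r, R u < r → ∀ x, IsSymTangent2 x (B.h u r x)
  U_pos : ∀ u ∈ I, ∀ r, R u < r → ∀ x, 0 < B.U u r x
  /-- The gauge condition `det h = det σ` (the normal direction is filled up by `x ⊗ x`). -/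
  det_h : ∀ u ∈ I, ∀ r, R u < r → ∀ x,
    (Matrix.of fun a b : Fin 3 => B.h u r x a b + x.1 a * x.1 b).det = 1
  expansion_U : ∃ f : ℝ → ℝ → S2 → ℝ, SmoothUpToScri I R f ∧
    ∀ u ∈ I, ∀ r, R u < r → ∀ x,
      B.U u r x = 1 - normSq2 (D.C u) x / (16 * r ^ 2) + f u r⁻¹ x / r ^ 3
  expansion_V : ∃ f : ℝ → ℝ → S2 → ℝ, SmoothUpToScri I R f ∧
    ∀ u ∈ I, ∀ r, R u < r → ∀ x,
      B.V u r x = 1 - 2 * D.m u x / r + f u r⁻¹ x / r ^ 2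
  expansion_W : ∀ a, ∃ f : ℝ → ℝ → S2 → ℝ, SmoothUpToScri I R f ∧
    ∀ u ∈ I, ∀ r, R u < r → ∀ x,
      B.W u r x a = div2 (D.C u) x a / (2 * r ^ 2) +
        (2 / 3 * D.N u x a - 1 / 16 * grad (normSq2 (D.C u)) x a -
          1 / 2 * ∑ b, D.C u x a b * div2 (D.C u) x b) / r ^ 3 + f u r⁻¹ x / r ^ 4
  expansion_h : ∀ a b, ∃ f : ℝ → ℝ → S2 → ℝ, SmoothUpToScri I R f ∧
    ∀ u ∈ I, ∀ r, R u < r → ∀ x,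
      B.h u r x a b = sigma x a b + D.C u x a b / r +
        normSq2 (D.C u) x * sigma x a b / (4 * r ^ 2) + f u r⁻¹ x / r ^ 3
  /-- The vacuum Einstein equations. -/
  vacuum : ∀ z : Fin 4 → ℝ, z 0 ∈ interior I → R (z 0) < ‖spacePart z‖ →
    ∀ μ ν, ricci B.metric z μ ν = 0

/-- The classical angular momentum
`J̃ᵏ = ∫ ε^{AB} ∇_B X̃ᵏ (N_A - ¼ C_A^D ∇^B C_{DB})`. -/
def classicalJ (D : ScriData) (k : Fin 3) (u : ℝ) : ℝ :=
  ∫ x, ∑ a, ∑ b, eps x a b * grad (coordX k) x b *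
    (D.N u x a - 1 / 4 * ∑ d, D.C u x a d * div2 (D.C u) x d) ∂area

/-- The classical center of mass
`C̃ᵏ = ∫ ∇^A X̃ᵏ (N_A - u ∇_A m - ¼ C_A^D ∇^B C_{DB} - 1/16 ∇_A (C_{DE} C^{DE}))`. -/
def classicalC (D : ScriData) (k : Fin 3) (u : ℝ) : ℝ :=
  ∫ x, ∑ a, grad (coordX k) x a *
    (D.N u x a - u * grad (D.m u) x a - 1 / 4 * ∑ d, D.C u x a d * div2 (D.C u) x d -
      1 / 16 * grad (normSq2 (D.C u)) x a) ∂area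

end

noncomputable section

/-! ### The ring of smooth fields on the sphere depending on parameters -/

/-! The charges pair $N_A$ and $m$ with the rotation fields $Y^A=\epsilon^{AB}\nabla_B\tilde X^k$
and the conformal fields $\nabla^A\tilde X^k$, so everything follows from the evolution of the two
aspects. That evolution is the leading coefficient of the vacuum equations at null infinity. The
$uu$ component gives $8\partial_um=2\nabla^A\nabla^BN_{AB}-|N|^2$ (`dFst_mass`). The $uA$ component
gives $4\partial_uN_A=4\nabla_Am+2\nabla_A(C\cdot
N)+C_A{}^B\nabla^DN_{BD}+N_A{}^B\nabla^DC_{BD}-N^{BD}\nabla_AC_{BD}-2\nabla^B(C_{BD}N^D{}_A)+\nabla^B(\nabla_Av_B-\nabla_Bv_A)$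
with $v_B=\nabla^DC_{DB}$ (`dFst_momentum`). The quadratic corrections in the charges remove the two
terms $C\,\mathrm{div}N+N\,\mathrm{div}C$; what remains is `flux`.

Angular momentum: gradients integrate to zero against the divergence-free field $Y$, the curl term
integrates to zero, and the rest is $-\int N\cdot\mathcal L_YC$. Since $Y$ is Killing, $\mathcal
L_YC$ has the potentials $Yc$ and $Y\underline c$ (`rot_pot`). The integral of a product of two
tensors with potentials decouples into its electric and magnetic parts (`integral_dot_pot`), and
$\int\tilde X^k[f,g]_1=-\int g\,Yf$ (`integral_x_poisson`).

Center of mass: the identity $2\nabla\tilde X^k\cdot\nabla f=\Delta(\tilde X^kf)-\tilde X^k\Delta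
f+2\tilde X^kf$, applied to ambient components, reduces the terms without explicit $u$ to
$\int\tilde X^k(N\cdot\Delta C-C\cdot\Delta N)$. The Laplacian passes to the potentials
(`IsSTT.dot_lap_pot`), the products are evaluated by `integral_x_dot_pot`, and the mixed
electric-magnetic terms cancel. In the term with factor $u$, which comes from $\partial_um$, the
double divergence drops because the Hessian of $\tilde X^k$ is pure trace, leaving $\int\tilde
X^k|N|^2$.

The calculations are algebraic. Smooth fields depending on parameters form a commutative ring with
derivations (`ParamDomain.smooth`), and tensors are represented by ambient components in that ring.
`SphereCalculus` and `ScriCalculus` record the few identities that are needed. Near null infinity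
$\rho=1/r$ is one of the parameters, and asymptotic statements become identities in the quotient by
$\rho^4$. The vacuum equations are available for interior $u$ only; the evolution equations reach
the endpoints of $I$ by continuity. -/

lemma toS2_coe {y : E3} (hy : y ≠ 0) : (toS2 y : E3) = ‖y‖⁻¹ • y := by
  simp [toS2, hy]

@[simp] lemma toS2_self (x : S2) : toS2 (x : E3) = x := by
  have hx : ‖(x : E3)‖ = 1 := by simp
  have h0 : (x : E3) ≠ 0 := by
    intro h; simp [h] at hx
  ext1
  rw [toS2_coe h0, hx]; simp

lemma S2.coe_ne_zero (x : S2) : (x : E3) ≠ 0 := by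
  have hx : ‖(x : E3)‖ = 1 := by simp
  intro h; simp [h] at hx

lemma toS2_smul {t : ℝ} (ht : 0 < t) (y : E3) : toS2 (t • y) = toS2 y := by
  by_cases hy : y = 0
  · simp [hy]
  ext1
  rw [toS2_coe hy, toS2_coe (by simp [hy, ht.ne']), norm_smul, smul_smul, Real.norm_of_nonneg ht.le]
  congr 1
  field_simp

lemma S2.sum_sq (x : S2) : ∑ a, x.1 a * x.1 a = 1 := by
  have h : ‖(x : E3)‖ = 1 := by simp
  rw [EuclideanSpace.norm_eq, Real.sqrt_eq_one] at h
  simpa [sq] using h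

/-- A convex set of parameters with interior points. -/
structure ParamDomain where
  carrier : Set (ℝ × ℝ)
  convex : Convex ℝ carrier
  nonempty_interior : (interior carrier).Nonempty

namespace ParamDomain

variable (P : ParamDomain)

/-- Parameters times punctured Euclidean space. -/
def cone : Set ((ℝ × ℝ) × E3) := P.carrier ×ˢ {0}ᶜ

open Classical in
/-- The extension of a field that is constant along rays. -/
def ext (f : P.carrier × S2 → ℝ) (q : (ℝ × ℝ) × E3) : ℝ :=
  if h : q.1 ∈ P.carrier then f (⟨q.1, h⟩, toS2 q.2) else 0

variable {P}

lemma ext_apply (f : P.carrier × S2 → ℝ) {q : (ℝ × ℝ) × E3} (h : q.1 ∈ P.carrier) :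
    P.ext f q = f (⟨q.1, h⟩, toS2 q.2) := by
  simp [ext, h]

lemma ext_pair (f : P.carrier × S2 → ℝ) {p : ℝ × ℝ} (h : p ∈ P.carrier) (y : E3) :
    P.ext f (p, y) = f (⟨p, h⟩, toS2 y) := by
  simp [ext, h]

lemma ext_coe (f : P.carrier × S2 → ℝ) (p : P.carrier) (x : S2) :
    P.ext f (p.1, x.1) = f (p, x) := by
  simp [ext]

lemma ext_smul (f : P.carrier × S2 → ℝ) (p : ℝ × ℝ) (y : E3) {t : ℝ} (ht : 0 < t) :
    P.ext f (p, t • y) = P.ext f (p, y) := by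
  simp [ext, toS2_smul ht]

lemma mem_cone {p : ℝ × ℝ} {y : E3} : (p, y) ∈ P.cone ↔ p ∈ P.carrier ∧ y ≠ 0 := by
  simp [cone]

lemma coe_mem_cone (p : P.carrier) (x : S2) : (p.1, x.1) ∈ P.cone :=
  mem_cone.2 ⟨p.2, x.coe_ne_zero⟩

variable (P) in
lemma uniqueDiffOn_carrier : UniqueDiffOn ℝ P.carrier :=
  uniqueDiffOn_convex P.convex P.nonempty_interior

variable (P) in
lemma uniqueDiffOn_cone : UniqueDiffOn ℝ P.cone :=
  P.uniqueDiffOn_carrier.prod isOpen_compl_singleton.uniqueDiffOn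

variable (P) in
-- Every parameter is a limit of interior ones. This gives symmetry of second derivatives at
-- boundary parameters and lets identities pass from the interior to the boundary.
lemma carrier_subset : P.carrier ⊆ closure (interior P.carrier) := by
  rw [P.convex.closure_interior_eq_closure_of_nonempty_interior P.nonempty_interior]
  exact subset_closure

variable (P) in
lemma cone_subset : P.cone ⊆ closure (interior P.cone) := by
  rw [cone, interior_prod_eq, closure_prod_eq, isOpen_compl_singleton.interior_eq]
  exact Set.prod_mono P.carrier_subset subset_closure

variable (P) in
/-- The ring of smooth fields. -/
def smooth : Subalgebra ℝ (P.carrier × S2 → ℝ) where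
  carrier := {f | ContDiffOn ℝ ∞ (P.ext f) P.cone}
  mul_mem' {f g} hf hg := by
    refine (ContDiffOn.mul hf hg).congr fun q hq => ?_
    simp [ext_apply _ hq.1]
  add_mem' {f g} hf hg := by
    refine (ContDiffOn.add hf hg).congr fun q hq => ?_
    simp [ext_apply _ hq.1]
  algebraMap_mem' r := by
    refine (contDiffOn_const (c := r)).congr fun q hq => ?_
    simp [ext_apply _ hq.1]

lemma contDiffOn_ext (f : P.smooth) : ContDiffOn ℝ ∞ (P.ext f) P.cone := f.2

/-- Constructor for smooth fields. -/
lemma mem_smooth {f : P.carrier × S2 → ℝ} (F : (ℝ × ℝ) × E3 → ℝ) (hF : ContDiffOn ℝ ∞ F P.cone)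
    (h : ∀ (p : P.carrier) (y : E3), y ≠ 0 → f (p, toS2 y) = F (p.1, y)) : f ∈ P.smooth := by
  refine ContDiffOn.congr hF fun q hq => ?_
  rw [ext_apply _ hq.1, h _ _ hq.2]

/-- The extension is invariant under the dilations `y ↦ t • y`; this is the derivative of that
invariance. -/
lemma fderivWithin_ext_smul (f : P.smooth) {p : ℝ × ℝ} (hp : p ∈ P.carrier) {y : E3} (hy : y ≠ 0)
    {t : ℝ} (ht : 0 < t) (v : (ℝ × ℝ) × E3) :
    fderivWithin ℝ (P.ext f) P.cone (p, y) v =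
      fderivWithin ℝ (P.ext f) P.cone (p, t • y) (v.1, t • v.2) := by
  let e : ((ℝ × ℝ) × E3) ≃L[ℝ] ((ℝ × ℝ) × E3) :=
    (ContinuousLinearEquiv.refl ℝ (ℝ × ℝ)).prodCongr
      (ContinuousLinearEquiv.smulLeft (R₁ := ℝ) (Units.mk0 t ht.ne'))
  have he : ∀ q, e q = (q.1, t • q.2) := fun q => rfl
  have h1 : P.ext f ∘ e = P.ext f := by
    ext q
    simp only [Function.comp, he]
    exact ext_smul _ _ _ ht
  have h2 : e ⁻¹' P.cone = P.cone := by
    ext q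
    simp [he, cone, ht.ne']
  have := e.comp_right_fderivWithin (f := P.ext f) (s := P.cone) (x := (p, y))
    (by rw [h2]; exact P.uniqueDiffOn_cone _ (mem_cone.2 ⟨hp, hy⟩))
  rw [h1, h2] at this
  rw [this]
  simp [he]

lemma fderivWithin_ext_radial (f : P.smooth) (p : P.carrier) (x : S2) :
    fderivWithin ℝ (P.ext f) P.cone (p.1, x.1) (0, x.1) = 0 := by
  have hF := ((contDiffOn_ext f).differentiableOn (by simp) _ (coe_mem_cone p x)).hasFDerivWithinAt
  have hc : HasDerivWithinAt (fun t : ℝ => (p.1, t • x.1)) ((0 : ℝ × ℝ), (1 : ℝ) • x.1)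
      (Set.Ioi 0) 1 :=
    (hasDerivWithinAt_const _ _ _).prodMk ((hasDerivWithinAt_id (1 : ℝ) _).smul_const x.1)
  have hF' : HasFDerivWithinAt (P.ext f) (fderivWithin ℝ (P.ext f) P.cone (p.1, x.1)) P.cone
      ((fun t : ℝ => (p.1, t • x.1)) 1) := by simpa using hF
  have := hF'.comp_hasDerivWithinAt (1 : ℝ) hc
    (fun t ht => mem_cone.2 ⟨p.2, smul_ne_zero (ne_of_gt ht) x.coe_ne_zero⟩)
  have h0 : HasDerivWithinAt (P.ext f ∘ fun t : ℝ => (p.1, t • x.1)) 0 (Set.Ioi 0) 1 := by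
    refine (hasDerivWithinAt_const (1 : ℝ) (Set.Ioi 0) (P.ext f (p.1, x.1))).congr_of_mem
      (fun t ht => ?_) (by simp)
    simp only [Function.comp]
    exact ext_smul _ _ _ ht
  have hu : UniqueDiffWithinAt ℝ (Set.Ioi (0 : ℝ)) 1 := isOpen_Ioi.uniqueDiffWithinAt (by simp)
  have := this.derivWithin hu
  rw [h0.derivWithin hu] at this
  simpa using this.symm

/-- The function underlying the derivative of a field in a constant direction. -/
def derivFun (v : (ℝ × ℝ) × E3) (f : P.smooth) (q : P.carrier × S2) : ℝ :=
  fderivWithin ℝ (P.ext f) P.cone (q.1.1, q.2.1) v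

/-- The derivative of a function that is constant along rays is homogeneous of degree `-1`. The
factor `‖y‖` on the spatial direction restores degree zero, so derivatives of fields are again
fields. -/
lemma derivFun_toS2 (v : (ℝ × ℝ) × E3) (f : P.smooth) (p : P.carrier) {y : E3} (hy : y ≠ 0) :
    derivFun v f (p, toS2 y) = fderivWithin ℝ (P.ext f) P.cone (p.1, y) (v.1, ‖y‖ • v.2) := by
  have hy' : 0 < ‖y‖ := norm_pos_iff.2 hy
  rw [fderivWithin_ext_smul f p.2 hy (inv_pos.2 hy'), derivFun, toS2_coe hy]
  simp [smul_smul, inv_mul_cancel₀ hy'.ne']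

lemma contDiffOn_fderivWithin_ext (f : P.smooth) :
    ContDiffOn ℝ ∞ (fderivWithin ℝ (P.ext f) P.cone) P.cone :=
  (contDiffOn_ext f).fderivWithin P.uniqueDiffOn_cone (by simp)

lemma contDiffOn_norm : ContDiffOn ℝ ∞ (fun q : (ℝ × ℝ) × E3 => ‖q.2‖) P.cone :=
  fun q hq => ((contDiffAt_norm ℝ hq.2).comp q contDiffAt_snd).contDiffWithinAt

lemma derivFun_mem (v : (ℝ × ℝ) × E3) (f : P.smooth) : derivFun v f ∈ P.smooth :=
  mem_smooth (fun q => fderivWithin ℝ (P.ext f) P.cone q (v.1, ‖q.2‖ • v.2))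
    ((contDiffOn_fderivWithin_ext f).clm_apply
      (contDiffOn_const.prodMk (contDiffOn_norm.smul contDiffOn_const)))
    fun p _ hy => derivFun_toS2 v f p hy

lemma hasFDerivWithinAt_ext (f : P.smooth) (p : P.carrier) (x : S2) :
    HasFDerivWithinAt (P.ext f) (fderivWithin ℝ (P.ext f) P.cone (p.1, x.1)) P.cone (p.1, x.1) :=
  ((contDiffOn_ext f).differentiableOn (by simp) _ (coe_mem_cone p x)).hasFDerivWithinAt

/-- The derivative of smooth fields in a constant direction. -/
def deriv (v : (ℝ × ℝ) × E3) : Derivation ℝ P.smooth P.smooth :=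
  Derivation.mk' 
    { toFun := fun f => ⟨derivFun v f, derivFun_mem v f⟩
      map_add' := fun f g => by
        ext ⟨p, x⟩
        have h := ((hasFDerivWithinAt_ext f p x).add (hasFDerivWithinAt_ext g p x)).congr
          (f₁ := P.ext (f + g : P.smooth)) (fun q hq => by simp [ext_apply _ hq.1])
          (by simp [ext_coe])
        simp only [derivFun, h.fderivWithin (P.uniqueDiffOn_cone _ (coe_mem_cone p x))]
        rfl
      map_smul' := fun r f => by
        ext ⟨p, x⟩
        have h := ((hasFDerivWithinAt_ext f p x).const_smul r).congr
          (f₁ := P.ext (r • f : P.smooth)) (fun q hq => by simp [ext_apply _ hq.1])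
          (by simp [ext_coe])
        simp only [derivFun, h.fderivWithin (P.uniqueDiffOn_cone _ (coe_mem_cone p x))]
        rfl }
    fun f g => by
      ext ⟨p, x⟩
      have h := ((hasFDerivWithinAt_ext f p x).mul (hasFDerivWithinAt_ext g p x)).congr
        (f₁ := P.ext (f * g : P.smooth)) (fun q hq => by simp [ext_apply _ hq.1])
        (by simp [ext_coe])
      simp only [LinearMap.coe_mk, AddHom.coe_mk, derivFun,
        h.fderivWithin (P.uniqueDiffOn_cone _ (coe_mem_cone p x))]
      simp [ext_coe, derivFun]

lemma deriv_apply (v : (ℝ × ℝ) × E3) (f : P.smooth) (p : P.carrier) (x : S2) :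
    (deriv v f).1 (p, x) = fderivWithin ℝ (P.ext f) P.cone (p.1, x.1) v := rfl

lemma ext_deriv (v : (ℝ × ℝ) × E3) (f : P.smooth) {q : (ℝ × ℝ) × E3} (hq : q ∈ P.cone) :
    P.ext (deriv v f : P.smooth) q = fderivWithin ℝ (P.ext f) P.cone q (v.1, ‖q.2‖ • v.2) := by
  rw [ext_apply _ hq.1]
  exact derivFun_toS2 v f ⟨q.1, hq.1⟩ hq.2

end ParamDomain

/-! ### Commutators of the derivatives, coordinate fields and pullbacks -/

namespace ParamDomain
variable {P : ParamDomain}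

lemma hasFDerivAt_norm_coe (x : S2) :
    HasFDerivAt (fun y : E3 => ‖y‖) (innerSL ℝ x.1) x.1 := by
  have h := (hasStrictFDerivAt_norm_sq (F := E3) x.1).hasFDerivAt.sqrt (by simp)
  have hx : ‖(x : E3)‖ = 1 := by simp
  simp only [Real.sqrt_sq (norm_nonneg _)] at h
  refine h.congr_fderiv ?_
  ext v
  simp

lemma hasFDerivAt_norm_snd (p : P.carrier) (x : S2) :
    HasFDerivAt (fun q : (ℝ × ℝ) × E3 => ‖q.2‖)
      ((innerSL ℝ x.1).comp (ContinuousLinearMap.snd ℝ (ℝ × ℝ) E3)) (p.1, x.1) :=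
  HasFDerivAt.comp (g := fun y : E3 => ‖y‖) (p.1, x.1) (hasFDerivAt_norm_coe x) hasFDerivAt_snd

/-- By `ext_deriv`, the first derivative carries the factor `‖y‖` on its spatial direction. The
additional term is the derivative of that factor, since the differential of the norm at `x` is the
inner product with `x`. -/
lemma deriv_deriv_apply (v w : (ℝ × ℝ) × E3) (f : P.smooth) (p : P.carrier) (x : S2) :
    (deriv v (deriv w f)).1 (p, x) =
      fderivWithin ℝ (fderivWithin ℝ (P.ext f) P.cone) P.cone (p.1, x.1) v w +
        inner ℝ x.1 v.2 * (deriv (0, w.2) f).1 (p, x) := by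
  have hx : ‖(x : E3)‖ = 1 := by simp
  have h1 : HasFDerivWithinAt (fderivWithin ℝ (P.ext f) P.cone)
      (fderivWithin ℝ (fderivWithin ℝ (P.ext f) P.cone) P.cone (p.1, x.1)) P.cone (p.1, x.1) :=
    ((contDiffOn_fderivWithin_ext f).differentiableOn (by simp) _
      (coe_mem_cone p x)).hasFDerivWithinAt
  have h2 : HasFDerivWithinAt (fun q : (ℝ × ℝ) × E3 => (w.1, ‖q.2‖ • w.2)) _ P.cone (p.1, x.1) :=
    (hasFDerivWithinAt_const w.1 _ _).prodMk
      ((hasFDerivAt_norm_snd p x).hasFDerivWithinAt.smul_const w.2)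
  have h3 := (h1.clm_apply h2).congr (f₁ := P.ext (deriv w f : P.smooth))
    (fun q hq => ext_deriv w f hq) (ext_deriv w f (coe_mem_cone p x))
  rw [deriv_apply, h3.fderivWithin (P.uniqueDiffOn_cone _ (coe_mem_cone p x)), deriv_apply]
  have : ((0 : ℝ × ℝ), inner ℝ x.1 v.2 • w.2) = inner ℝ x.1 v.2 • ((0 : ℝ × ℝ), w.2) := by simp
  simp [this, hx, add_comm, -Prod.smul_mk]

/-- Second derivatives are symmetric, so only the terms produced by the homogeneity factor `‖y‖`
survive. -/
lemma deriv_comm_apply (v w : (ℝ × ℝ) × E3) (f : P.smooth) (p : P.carrier) (x : S2) :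
    (deriv v (deriv w f)).1 (p, x) - (deriv w (deriv v f)).1 (p, x) =
      inner ℝ x.1 v.2 * (deriv (0, w.2) f).1 (p, x) -
        inner ℝ x.1 w.2 * (deriv (0, v.2) f).1 (p, x) := by
  have h := ContDiffWithinAt.isSymmSndFDerivWithinAt (n := ∞)
    ((contDiffOn_ext f) _ (coe_mem_cone p x))
    (by rw [minSmoothness_of_isRCLikeNormedField]; exact WithTop.coe_le_coe.2 le_top) P.uniqueDiffOn_cone
    (P.cone_subset (coe_mem_cone p x)) (coe_mem_cone p x) v w
  rw [deriv_deriv_apply, deriv_deriv_apply, h]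
  ring

/-- Components of the gradient along the sphere. -/
def d (a : Fin 3) : Derivation ℝ P.smooth P.smooth := deriv (0, EuclideanSpace.single a 1)

/-- The derivative with respect to the first parameter. -/
def dFst : Derivation ℝ P.smooth P.smooth := deriv ((1, 0), 0)

/-- The derivative with respect to the second parameter. -/
def dSnd : Derivation ℝ P.smooth P.smooth := deriv ((0, 1), 0)

lemma smooth_ext {f g : P.smooth} (h : ∀ p x, f.1 (p, x) = g.1 (p, x)) : f = g := by
  ext ⟨p, x⟩
  exact h p x

/-- The coordinate functions of the ambient space. -/
def coord (a : Fin 3) : P.smooth :=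
  ⟨fun q => q.2.1 a, mem_smooth (fun q => ‖q.2‖⁻¹ * q.2 a)
    ((contDiffOn_norm.inv fun q hq => norm_ne_zero_iff.2 hq.2).mul
      (by fun_prop)) fun p y hy => by simp [toS2_coe hy]⟩

@[simp] lemma coord_apply (a : Fin 3) (p : P.carrier) (x : S2) :
    (coord a : P.smooth).1 (p, x) = x.1 a := rfl

/-- The first parameter. -/
def fstParam : P.smooth :=
  ⟨fun q => q.1.1.1, mem_smooth (fun q => q.1.1) (by fun_prop) fun p y hy => rfl⟩

/-- The second parameter. -/
def sndParam : P.smooth :=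
  ⟨fun q => q.1.1.2, mem_smooth (fun q => q.1.2) (by fun_prop) fun p y hy => rfl⟩

lemma deriv_apply_of_hasFDerivAt {f : P.smooth} {p : P.carrier} {x : S2}
    {F : (ℝ × ℝ) × E3 → ℝ} {F' : (ℝ × ℝ) × E3 →L[ℝ] ℝ}
    (h : ∀ q ∈ P.cone, P.ext f q = F q) (hF : HasFDerivAt F F' (p.1, x.1))
    (v : (ℝ × ℝ) × E3) : (deriv v f).1 (p, x) = F' v := by
  rw [deriv_apply, (hF.hasFDerivWithinAt.congr h (h _ (coe_mem_cone p x))).fderivWithin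
    (P.uniqueDiffOn_cone _ (coe_mem_cone p x))]

lemma deriv_coord (v : (ℝ × ℝ) × E3) (a : Fin 3) (p : P.carrier) (x : S2) :
    (deriv v (coord a : P.smooth)).1 (p, x) = v.2 a - x.1 a * inner ℝ x.1 v.2 := by
  have hx : ‖(x : E3)‖ = 1 := by simp
  have h1 := HasDerivAt.comp_hasFDerivAt (f := fun q : (ℝ × ℝ) × E3 => ‖q.2‖) (p.1, x.1)
    (hasDerivAt_inv (x := ‖(x : E3)‖) (by simp)) (hasFDerivAt_norm_snd p x)
  have h2 : HasFDerivAt (fun q : (ℝ × ℝ) × E3 => q.2 a)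
      ((EuclideanSpace.proj a).comp (ContinuousLinearMap.snd ℝ (ℝ × ℝ) E3)) (p.1, x.1) :=
    ContinuousLinearMap.hasFDerivAt
      ((EuclideanSpace.proj a : E3 →L[ℝ] ℝ).comp (ContinuousLinearMap.snd ℝ (ℝ × ℝ) E3))
  rw [deriv_apply_of_hasFDerivAt (fun q hq => ?_) (h1.mul h2)]
  · simp [hx]; ring
  · rw [ext_apply _ hq.1]
    simp [coord, toS2_coe hq.2]

lemma inner_single (x : E3) (a : Fin 3) : inner ℝ x (EuclideanSpace.single a (1 : ℝ)) = x a := by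
  simp [EuclideanSpace.inner_single_right]

lemma d_coord (a b : Fin 3) :
    d a (coord b : P.smooth) = (if a = b then 1 else 0) - coord a * coord b := by
  refine smooth_ext fun p x => ?_
  rw [d, deriv_coord, inner_single]
  by_cases h : a = b
  · simp [h]
  · simp [h, Ne.symm h, mul_comm]

lemma dFst_coord (b : Fin 3) : dFst (coord b : P.smooth) = 0 := by
  refine smooth_ext fun p x => ?_
  rw [dFst, deriv_coord]
  simp

lemma dSnd_coord (b : Fin 3) : dSnd (coord b : P.smooth) = 0 := by
  refine smooth_ext fun p x => ?_
  rw [dSnd, deriv_coord]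
  simp

lemma deriv_fstParam (v : (ℝ × ℝ) × E3) (p : P.carrier) (x : S2) :
    (deriv v (fstParam : P.smooth)).1 (p, x) = v.1.1 := by
  have h : HasFDerivAt (fun q : (ℝ × ℝ) × E3 => q.1.1)
      ((ContinuousLinearMap.fst ℝ ℝ ℝ).comp (ContinuousLinearMap.fst ℝ (ℝ × ℝ) E3)) (p.1, x.1) :=
    ContinuousLinearMap.hasFDerivAt
      ((ContinuousLinearMap.fst ℝ ℝ ℝ).comp (ContinuousLinearMap.fst ℝ (ℝ × ℝ) E3))
  rw [deriv_apply_of_hasFDerivAt (fun q hq => ?_) h]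
  · rfl
  · rw [ext_apply _ hq.1]; rfl

lemma deriv_sndParam (v : (ℝ × ℝ) × E3) (p : P.carrier) (x : S2) :
    (deriv v (sndParam : P.smooth)).1 (p, x) = v.1.2 := by
  have h : HasFDerivAt (fun q : (ℝ × ℝ) × E3 => q.1.2)
      ((ContinuousLinearMap.snd ℝ ℝ ℝ).comp (ContinuousLinearMap.fst ℝ (ℝ × ℝ) E3)) (p.1, x.1) :=
    ContinuousLinearMap.hasFDerivAt
      ((ContinuousLinearMap.snd ℝ ℝ ℝ).comp (ContinuousLinearMap.fst ℝ (ℝ × ℝ) E3))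
  rw [deriv_apply_of_hasFDerivAt (fun q hq => ?_) h]
  · rfl
  · rw [ext_apply _ hq.1]; rfl

lemma dFst_fstParam : dFst (fstParam : P.smooth) = 1 :=
  smooth_ext fun p x => by rw [dFst, deriv_fstParam]; simp

lemma dSnd_sndParam : dSnd (sndParam : P.smooth) = 1 :=
  smooth_ext fun p x => by rw [dSnd, deriv_sndParam]; simp

lemma d_sndParam (a : Fin 3) : d a (sndParam : P.smooth) = 0 :=
  smooth_ext fun p x => by rw [d, deriv_sndParam]; simp

lemma dFst_sndParam : dFst (sndParam : P.smooth) = 0 :=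
  smooth_ext fun p x => by rw [dFst, deriv_sndParam]; simp

lemma sum_coord_sq : ∑ a, (coord a : P.smooth) * coord a = 1 :=
  smooth_ext fun p x => by simpa using x.sum_sq

lemma sum_coord_d (f : P.smooth) : ∑ a, coord a * d a f = 0 := by
  refine smooth_ext fun p x => ?_
  have h : (x : E3) = ∑ a, x.1 a • EuclideanSpace.single a (1 : ℝ) := by
    ext i; simp [Fin.sum_univ_three]; fin_cases i <;> simp
  have := fderivWithin_ext_radial f p x
  have h2 : ((0 : ℝ × ℝ), x.1) =
      ∑ a, x.1 a • ((0 : ℝ × ℝ), EuclideanSpace.single a (1 : ℝ)) := by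
    conv_lhs => rw [h]
    simp [Fin.sum_univ_three]
  rw [h2, map_sum] at this
  simpa [d, deriv_apply, -Prod.smul_mk] using this

lemma d_comm (a b : Fin 3) (f : P.smooth) :
    d a (d b f) = d b (d a f) + coord a * d b f - coord b * d a f := by
  refine smooth_ext fun p x => ?_
  have h := deriv_comm_apply (0, EuclideanSpace.single a 1) (0, EuclideanSpace.single b 1) f p x
  simp only [inner_single] at h
  have : (d a (d b f)).1 (p, x) - (d b (d a f)).1 (p, x) =
    x.1 a * (d b f).1 (p, x) - x.1 b * (d a f).1 (p, x) := h
  simp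
  linarith

lemma deriv_zero (f : P.smooth) : deriv 0 f = 0 := smooth_ext fun p x => by
  simp [deriv_apply]

lemma dFst_d (a : Fin 3) (f : P.smooth) : dFst (d a f) = d a (dFst f) := by
  refine smooth_ext fun p x => ?_
  have h := deriv_comm_apply ((1, 0), 0) (0, EuclideanSpace.single a 1) f p x
  have h0 : deriv ((0 : ℝ × ℝ), (0 : E3)) f = 0 := deriv_zero f
  simp [h0] at h
  exact sub_eq_zero.1 h

lemma dFst_dSnd (f : P.smooth) : dFst (dSnd f) = dSnd (dFst f) := by
  refine smooth_ext fun p x => ?_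
  have h := deriv_comm_apply ((1, 0), 0) ((0, 1), 0) f p x
  simp at h
  exact sub_eq_zero.1 h

/-- The gradient of a slice of a field. -/
lemma grad_slice (f : P.smooth) (p : P.carrier) (x : S2) (a : Fin 3) :
    grad (fun y => f.1 (p, y)) x a = (d a f).1 (p, x) := by
  have hc : HasFDerivWithinAt (fun y : E3 => (p.1, y))
      ((0 : E3 →L[ℝ] ℝ × ℝ).prod (ContinuousLinearMap.id ℝ E3)) {0}ᶜ x.1 :=
    (hasFDerivWithinAt_const p.1 x.1 _).prodMk (hasFDerivWithinAt_id x.1 _)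
  have h := (hasFDerivWithinAt_ext f p x).comp x.1 hc fun y hy => mem_cone.2 ⟨p.2, hy⟩
  have h' := h.hasFDerivAt (isOpen_compl_singleton.mem_nhds x.coe_ne_zero)
  have h2 : (P.ext f ∘ fun y : E3 => (p.1, y)) = fun y => f.1 (p, toS2 y) := by
    ext y; simp [ext_pair _ p.2]
  rw [h2] at h'
  rw [grad, h'.fderiv, d, deriv_apply]
  simp

/-- The derivative of a field along a curve of parameters. -/
lemma hasDerivWithinAt_param (f : P.smooth) (x : S2) {γ : ℝ → ℝ × ℝ} {γ' : ℝ × ℝ} {I : Set ℝ}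
    {u : ℝ} (hγ : ∀ s ∈ I, γ s ∈ P.carrier) (hu : u ∈ I) (h : HasDerivWithinAt γ γ' I u) :
    HasDerivWithinAt (fun s => P.ext f (γ s, x.1))
      ((deriv (γ', 0) f).1 (⟨γ u, hγ u hu⟩, x)) I u := by
  have hc : HasDerivWithinAt (fun s => (γ s, x.1)) (γ', (0 : E3)) I u :=
    h.prodMk (hasDerivWithinAt_const _ _ _)
  exact (hasFDerivWithinAt_ext f ⟨γ u, hγ u hu⟩ x).comp_hasDerivWithinAt u hc
    fun s hs => mem_cone.2 ⟨hγ s hs, x.coe_ne_zero⟩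

variable {Q : ParamDomain}

/-- Pullback of fields along an affine map of parameters. -/
def pull (L : ℝ × ℝ →L[ℝ] ℝ × ℝ) (b : ℝ × ℝ) (h : ∀ p ∈ Q.carrier, L p + b ∈ P.carrier)
    (f : P.smooth) : Q.smooth :=
  ⟨fun q => f.1 (⟨L q.1.1 + b, h _ q.1.2⟩, q.2), by
    refine mem_smooth (fun q => P.ext f (L q.1 + b, q.2)) ?_ fun p y hy => ?_
    · refine (contDiffOn_ext f).comp (ContDiff.contDiffOn (by fun_prop)) fun q hq =>
        mem_cone.2 ⟨h _ hq.1, hq.2⟩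
    · simp [ext_pair _ (h _ p.2)]⟩

lemma pull_apply (L : ℝ × ℝ →L[ℝ] ℝ × ℝ) (b : ℝ × ℝ)
    (h : ∀ p ∈ Q.carrier, L p + b ∈ P.carrier) (f : P.smooth) (p : Q.carrier) (x : S2) :
    (pull L b h f).1 (p, x) = f.1 (⟨L p.1 + b, h _ p.2⟩, x) := rfl

lemma deriv_pull (L : ℝ × ℝ →L[ℝ] ℝ × ℝ) (b : ℝ × ℝ)
    (h : ∀ p ∈ Q.carrier, L p + b ∈ P.carrier) (f : P.smooth) (v : (ℝ × ℝ) × E3) :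
    deriv v (pull L b h f) = pull L b h (deriv (L v.1, v.2) f) := by
  refine smooth_ext fun p x => ?_
  have hc : HasFDerivWithinAt (fun q : (ℝ × ℝ) × E3 => (L q.1 + b, q.2))
      ((L.comp (ContinuousLinearMap.fst ℝ (ℝ × ℝ) E3)).prod (ContinuousLinearMap.snd ℝ (ℝ × ℝ) E3))
      Q.cone (p.1, x.1) :=
    ((L.hasFDerivWithinAt.comp _ hasFDerivWithinAt_fst (Set.mapsTo_univ _ _)).add_const b).prodMk
      hasFDerivWithinAt_snd
  have h1 := (hasFDerivWithinAt_ext f ⟨L p.1 + b, h _ p.2⟩ x).comp (p.1, x.1) hc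
    fun q hq => mem_cone.2 ⟨h _ hq.1, hq.2⟩
  have h2 := h1.congr (f₁ := Q.ext (pull L b h f : Q.smooth)) (fun q hq => by
    simp [ext_apply _ hq.1, ext_pair _ (h _ hq.1), pull_apply]) (by
    simp [ext_coe, ext_pair _ (h _ p.2), pull_apply])
  rw [deriv_apply, h2.fderivWithin (Q.uniqueDiffOn_cone _ (coe_mem_cone p x)), pull_apply,
    deriv_apply]
  simp

end ParamDomain

/-! ### Integration over the sphere -/

instance : IsFiniteMeasure area := by unfold area; infer_instance

/-- Polar coordinates for a product of a radial and an angular function. They transport facts about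
Lebesgue measure on `E3` to `area`. -/
lemma polar_integral (α : ℝ → ℝ) (β : S2 → ℝ) :
    ∫ y : E3, α ‖y‖ * β (toS2 y) = (∫ r in Set.Ioi (0 : ℝ), r ^ 2 * α r) * ∫ x, β x ∂area := by
  have hdim : Module.finrank ℝ E3 = 3 := by simp
  calc
    ∫ y : E3, α ‖y‖ * β (toS2 y)
        = ∫ y : ({(0)}ᶜ : Set E3), α ‖y.1‖ * β (toS2 y.1) ∂(volume.comap Subtype.val) := by
      rw [integral_subtype_comap (measurableSet_singleton _).compl
        fun y : E3 ↦ α ‖y‖ * β (toS2 y), restrict_compl_singleton]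
    _ = ∫ x : S2 × Set.Ioi (0 : ℝ), β x.1 * α x.2
          ∂(volume : Measure E3).toSphere.prod (.volumeIoiPow (Module.finrank ℝ E3 - 1)) := by
      rw [← (volume : Measure E3).measurePreserving_homeomorphUnitSphereProd.integral_comp
        (Homeomorph.measurableEmbedding _)]
      refine integral_congr_ae (.of_forall fun y => ?_)
      have : (homeomorphUnitSphereProd E3 y).1 = toS2 y.1 := by
        ext1
        rw [toS2_coe y.2]
        simp
      simp [this, mul_comm]
    _ = (∫ x, β x ∂area) *
          ∫ x : Set.Ioi (0 : ℝ), α x ∂.volumeIoiPow (Module.finrank ℝ E3 - 1) :=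
      integral_prod_mul β (fun x : Set.Ioi (0 : ℝ) => α x)
    _ = _ := by
      rw [mul_comm, hdim]
      congr 1
      simp only [Measure.volumeIoiPow, ENNReal.ofReal]
      rw [integral_withDensity_eq_integral_smul,
        integral_subtype_comap measurableSet_Ioi fun a ↦ Real.toNNReal (a ^ (3 - 1)) • α a,
        setIntegral_congr_fun measurableSet_Ioi fun x hx ↦ ?_]
      · rw [NNReal.smul_def, Real.coe_toNNReal _ (pow_nonneg hx.out.le _), smul_eq_mul]
      · exact (measurable_subtype_coe.pow_const _).real_toNNReal

/-- A smooth function on the line with support in `[1, 3]`. -/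
def radialBump : ContDiffBump (2 : ℝ) := ⟨1 / 2, 1, by norm_num, by norm_num⟩

lemma tsupport_radialBump : tsupport radialBump ⊆ Set.Icc 1 3 := by
  rw [radialBump.tsupport_eq, Real.closedBall_eq_Icc]
  simp only [radialBump]
  norm_num

/-- The cutoff vanishes near the origin, the only point where a function constant along rays is
singular. -/
lemma contDiff_radial_mul {ψ : ℝ → ℝ} (hψ : ContDiff ℝ ∞ ψ) (hs : tsupport ψ ⊆ Set.Icc 1 3)
    {F : E3 → ℝ} (hF : ContDiffOn ℝ ∞ F {0}ᶜ) :
    ContDiff ℝ ∞ (fun y => ψ ‖y‖ * F y) ∧ HasCompactSupport (fun y => ψ ‖y‖ * F y) := by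
  have hz : ∀ r : ℝ, r ∉ Set.Icc (1 : ℝ) 3 → ψ r = 0 := fun r hr =>
    image_eq_zero_of_notMem_tsupport fun h => hr (hs h)
  constructor
  · rw [contDiff_iff_contDiffAt]
    intro y
    by_cases hy : y = 0
    · subst hy
      refine (contDiffAt_const (c := (0 : ℝ))).congr_of_eventuallyEq ?_
      filter_upwards [Metric.ball_mem_nhds (0 : E3) one_pos] with y hy
      rw [mem_ball_zero_iff] at hy
      rw [hz _ fun h => absurd h.1 (not_le.2 hy), zero_mul]
    · exact (hψ.contDiffAt.comp y (contDiffAt_norm ℝ hy)).mul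
        (hF.contDiffAt (isOpen_compl_singleton.mem_nhds hy))
  · refine HasCompactSupport.intro (isCompact_closedBall (0 : E3) 3) fun y hy => ?_
    rw [mem_closedBall_zero_iff] at hy
    rw [hz _ fun h => hy h.2, zero_mul]

/-- Integration by parts against the constant function `1`. -/
lemma integral_fderiv_eq_zero {G : E3 → ℝ} (hG : ContDiff ℝ ∞ G) (hc : HasCompactSupport G)
    (v : E3) : ∫ y, fderiv ℝ G y v = 0 := by
  have h := integral_mul_fderiv_eq_neg_fderiv_mul_of_integrable (μ := (volume : Measure E3))
    (f := fun _ : E3 => (1 : ℝ)) (g := G) (v := v) (by simp) (by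
      simp only [one_mul]
      exact ((hG.continuous_fderiv (by simp)).clm_apply continuous_const).integrable_of_hasCompactSupport
        ((hc.fderiv ℝ).comp_left (g := fun L : E3 →L[ℝ] ℝ => L v) rfl)) (by
      simpa using hG.continuous.integrable_of_hasCompactSupport hc)
    (by simp) (fun y _ => (hG.differentiable (by simp)) y)
  simpa using h

namespace ParamDomain
variable {P : ParamDomain}

lemma contDiffOn_slice (f : P.smooth) (p : P.carrier) :
    ContDiffOn ℝ ∞ (fun y : E3 => P.ext f (p.1, y)) {0}ᶜ :=
  (contDiffOn_ext f).comp (ContDiff.contDiffOn (by fun_prop)) fun _ hy => mem_cone.2 ⟨p.2, hy⟩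

lemma fderiv_slice (f : P.smooth) (p : P.carrier) {y : E3} (hy : y ≠ 0) (a : Fin 3) :
    fderiv ℝ (fun y : E3 => P.ext f (p.1, y)) y (EuclideanSpace.single a 1) =
      ‖y‖⁻¹ * (d a f).1 (p, toS2 y) := by
  have hy' : 0 < ‖y‖ := norm_pos_iff.2 hy
  have hc : HasFDerivWithinAt (fun y : E3 => (p.1, y))
      ((0 : E3 →L[ℝ] ℝ × ℝ).prod (ContinuousLinearMap.id ℝ E3)) {0}ᶜ y :=
    (hasFDerivWithinAt_const p.1 y _).prodMk (hasFDerivWithinAt_id y _)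
  have h1 : HasFDerivWithinAt (P.ext f) (fderivWithin ℝ (P.ext f) P.cone (p.1, y)) P.cone
      (p.1, y) := ((contDiffOn_ext f).differentiableOn (by simp) _
      (mem_cone.2 ⟨p.2, hy⟩)).hasFDerivWithinAt
  have h := h1.comp y hc fun y hy => mem_cone.2 ⟨p.2, hy⟩
  have h' := h.hasFDerivAt (isOpen_compl_singleton.mem_nhds hy)
  have h2 : (d a f).1 (p, toS2 y) = fderivWithin ℝ (P.ext f) P.cone (p.1, y)
      (0, ‖y‖ • EuclideanSpace.single a 1) := derivFun_toS2 _ f p hy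
  have h3 : ((0 : ℝ × ℝ), ‖y‖ • EuclideanSpace.single a (1 : ℝ)) =
    ‖y‖ • ((0 : ℝ × ℝ), EuclideanSpace.single a (1 : ℝ)) := by simp
  change fderiv ℝ (P.ext f ∘ fun y : E3 => (p.1, y)) y _ = _
  rw [h'.fderiv, h2, h3, map_smul, smul_eq_mul, ← mul_assoc, inv_mul_cancel₀ hy'.ne']
  simp

/-- The divergence theorem on the sphere. -/
lemma integral_d (f : P.smooth) (p : P.carrier) (a : Fin 3) :
    ∫ x, (d a f).1 (p, x) ∂area = 2 * ∫ x, x.1 a * f.1 (p, x) ∂area := by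
  let ψ : ℝ → ℝ := radialBump
  have hψ : ContDiff ℝ ∞ ψ := radialBump.contDiff
  have hs : tsupport ψ ⊆ Set.Icc 1 3 := tsupport_radialBump
  have hψ' : ContDiff ℝ ∞ (_root_.deriv ψ) := (contDiff_infty_iff_deriv.1 hψ).2
  have hs' : tsupport (_root_.deriv ψ) ⊆ Set.Icc 1 3 :=
    (closure_minimal (support_deriv_subset (f := ψ)) (isClosed_tsupport ψ)).trans hs
  have hz : ∀ r : ℝ, r ∉ Set.Icc (1 : ℝ) 3 → ψ r = 0 := fun r hr =>
    image_eq_zero_of_notMem_tsupport fun h => hr (hs h)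
  have hz' : ∀ r : ℝ, r ∉ Set.Icc (1 : ℝ) 3 → _root_.deriv ψ r = 0 := fun r hr =>
    image_eq_zero_of_notMem_tsupport fun h => hr (hs' h)
  have hcs : HasCompactSupport ψ := HasCompactSupport.intro isCompact_Icc hz
  have hcs' : HasCompactSupport (_root_.deriv ψ) := HasCompactSupport.intro isCompact_Icc hz'
  have hψi : ContDiff ℝ ∞ (fun r => ψ r * r⁻¹) := by
    rw [contDiff_iff_contDiffAt]
    intro r
    by_cases hr : r = 0
    · subst hr
      refine (contDiffAt_const (c := (0 : ℝ))).congr_of_eventuallyEq ?_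
      filter_upwards [Iio_mem_nhds (zero_lt_one' ℝ)] with r hr
      rw [hz _ fun h => absurd h.1 (not_le.2 hr), zero_mul]
    · exact hψ.contDiffAt.mul (contDiffAt_inv ℝ hr)
  have hsi : tsupport (fun r => ψ r * r⁻¹) ⊆ Set.Icc 1 3 :=
    (closure_mono (Function.support_mul_subset_left ψ fun r => r⁻¹)).trans hs
  -- The sphere inherits its divergence theorem from `E3`: the function `ψ(‖y‖) f(y/‖y‖)` has
  -- compact support, so its partial derivative integrates to zero, and polar coordinates separate
  -- the radial factor.
  obtain ⟨hG, hGc⟩ := contDiff_radial_mul hψ hs (contDiffOn_slice f p)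
  have h0 := integral_fderiv_eq_zero hG hGc (EuclideanSpace.single a 1)
  have h1 : ∀ y : E3, fderiv ℝ (fun y => ψ ‖y‖ * P.ext f (p.1, y)) y (EuclideanSpace.single a 1) =
      _root_.deriv ψ ‖y‖ * (coord a * f : P.smooth).1 (p, toS2 y) +
        ψ ‖y‖ * ‖y‖⁻¹ * (d a f).1 (p, toS2 y) := by
    intro y
    by_cases hy : y = 0
    · subst hy
      rw [norm_zero, hz _ (by simp), hz' _ (by simp)]
      have : (fun y => ψ ‖y‖ * P.ext f (p.1, y)) =ᶠ[nhds 0] fun _ => 0 := by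
        filter_upwards [Metric.ball_mem_nhds (0 : E3) one_pos] with y hy
        rw [mem_ball_zero_iff] at hy
        rw [hz _ fun h => absurd h.1 (not_le.2 hy), zero_mul]
      rw [this.fderiv_eq]
      simp
    · have hy' : 0 < ‖y‖ := norm_pos_iff.2 hy
      have hn : HasFDerivAt (fun y : E3 => ‖y‖) (‖y‖⁻¹ • innerSL ℝ y) y := by
        have h := (hasStrictFDerivAt_norm_sq (F := E3) y).hasFDerivAt.sqrt (by simp [hy])
        simp only [Real.sqrt_sq (norm_nonneg _)] at h
        refine h.congr_fderiv ?_
        ext v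
        simp
        field_simp
      have hd := ((hψ.differentiable (by simp) ‖y‖).hasDerivAt.comp_hasFDerivAt y hn).mul
        (((contDiffOn_slice f p).differentiableOn (by simp)).differentiableAt
          (isOpen_compl_singleton.mem_nhds hy)).hasFDerivAt
      have hd' := hd.fderiv
      change fderiv ℝ (fun y => ψ ‖y‖ * P.ext f (p.1, y)) y = _ at hd'
      rw [hd']
      simp only [add_apply, smul_apply, smul_eq_mul,
        fderiv_slice f p hy, innerSL_apply_apply, inner_single]
      have h2 : (coord a * f : P.smooth).1 (p, toS2 y) = ‖y‖⁻¹ * y a * P.ext f (p.1, y) := by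
        rw [ext_pair _ p.2]
        simp [toS2_coe hy]
      rw [h2]
      simp only [Function.comp]
      ring
  have hint1 : Integrable
      (fun y : E3 => _root_.deriv ψ ‖y‖ * (coord a * f : P.smooth).1 (p, toS2 y)) := by
    obtain ⟨h, hc⟩ := contDiff_radial_mul hψ' hs' (contDiffOn_slice (coord a * f) p)
    simp only [ext_pair _ p.2] at h hc
    exact h.continuous.integrable_of_hasCompactSupport hc
  have hint2 : Integrable (fun y : E3 => ψ ‖y‖ * ‖y‖⁻¹ * (d a f).1 (p, toS2 y)) := by
    obtain ⟨h, hc⟩ := contDiff_radial_mul hψi hsi (contDiffOn_slice (d a f) p)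
    simp only [ext_pair _ p.2] at h hc
    exact h.continuous.integrable_of_hasCompactSupport hc
  simp only [h1] at h0
  rw [integral_add hint1 hint2,
    polar_integral (_root_.deriv ψ) fun x => (coord a * f : P.smooth).1 (p, x),
    polar_integral (fun r => ψ r * r⁻¹) fun x => (d a f).1 (p, x)] at h0
  have hi1 : Integrable (fun r : ℝ => r ^ 2 * _root_.deriv ψ r) :=
    Continuous.integrable_of_hasCompactSupport
      ((continuous_pow 2).mul hψ'.continuous) hcs'.mul_left
  have hi2 : Integrable (fun r : ℝ => r * ψ r) :=
    Continuous.integrable_of_hasCompactSupport (continuous_id.mul hψ.continuous) hcs.mul_left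
  -- Radial integration by parts of `r ^ 2 * ψ'`; the factor `2` of the statement comes from here.
  have e1 : ∫ r in Set.Ioi (0 : ℝ), r ^ 2 * _root_.deriv ψ r = -(2 * ∫ r : ℝ, r * ψ r) := by
    rw [setIntegral_eq_integral_of_forall_compl_eq_zero fun r hr => by
      rw [hz' _ fun h => hr (lt_of_lt_of_le one_pos h.1), mul_zero]]
    have hd : ∀ r, HasDerivAt (fun r => r ^ 2 * ψ r) (2 * (r * ψ r) + r ^ 2 * _root_.deriv ψ r) r :=
      fun r => by
        have := (hasDerivAt_pow 2 r).mul (hψ.differentiable (by simp) r).hasDerivAt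
        refine this.congr_deriv ?_
        simp [mul_assoc]
    have := integral_eq_zero_of_hasDerivAt_of_integrable hd ((hi2.const_mul 2).add hi1)
      (Continuous.integrable_of_hasCompactSupport ((continuous_pow 2).mul hψ.continuous)
        hcs.mul_left)
    rw [integral_add (hi2.const_mul 2) hi1, integral_const_mul] at this
    linarith
  have e2 : ∫ r in Set.Ioi (0 : ℝ), r ^ 2 * (ψ r * r⁻¹) = ∫ r : ℝ, r * ψ r := by
    rw [← setIntegral_eq_integral_of_forall_compl_eq_zero (s := Set.Ioi (0 : ℝ))
      (f := fun r => r * ψ r) fun r hr => by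
      rw [hz _ fun h => hr (lt_of_lt_of_le one_pos h.1), mul_zero]]
    refine setIntegral_congr_fun measurableSet_Ioi fun r hr => ?_
    have : r ≠ 0 := ne_of_gt hr
    field_simp
  have hpos : 0 < ∫ r : ℝ, r * ψ r := by
    refine Continuous.integral_pos_of_hasCompactSupport_nonneg_nonzero
      (continuous_id.mul hψ.continuous) hcs.mul_left (fun r => ?_) (x := 2) ?_
    · by_cases hr : r ∈ Set.Icc (1 : ℝ) 3
      · exact mul_nonneg (by linarith [hr.1]) radialBump.nonneg
      · simp [hz r hr]
    · have : ψ 2 = 1 := radialBump.one_of_mem_closedBall (by simp [radialBump])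
      simp [this]
  rw [e1, e2] at h0
  -- Both radial integrals are multiples of the positive number `∫ r * ψ r`, which can be cancelled.
  have : (∫ r : ℝ, r * ψ r) *
      (∫ x, (d a f).1 (p, x) ∂area - 2 * ∫ x, x.1 a * f.1 (p, x) ∂area) = 0 := by
    have h5 : ∫ x, (coord a * f : P.smooth).1 (p, x) ∂area = ∫ x, x.1 a * f.1 (p, x) ∂area := rfl
    rw [h5] at h0
    linarith
  linarith [(mul_eq_zero.1 this).resolve_left hpos.ne']

end ParamDomain

/-! ### Continuity in the parameters and differentiation under the integral sign -/

namespace ParamDomain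
variable {P : ParamDomain}

lemma continuous_smooth (f : P.smooth) : Continuous f.1 := by
  have h : f.1 = (P.ext f) ∘ fun q : P.carrier × S2 => (q.1.1, q.2.1) := by
    ext ⟨p, x⟩
    exact (ext_coe f.1 p x).symm
  rw [h]
  exact (contDiffOn_ext f).continuousOn.comp_continuous (by fun_prop)
    fun q => coe_mem_cone q.1 q.2

lemma integrable_slice (f : P.smooth) (p : P.carrier) :
    Integrable (fun x => f.1 (p, x)) area :=
  Continuous.integrable_of_hasCompactSupport
    ((continuous_smooth f).comp (by fun_prop)) (HasCompactSupport.of_compactSpace _)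

/-- Integration of a smooth field over the sphere, for fixed parameters. -/
def sphereIntegral (p : P.carrier) : P.smooth →ₗ[ℝ] ℝ where
  toFun f := ∫ x, f.1 (p, x) ∂area
  map_add' f g := integral_add (integrable_slice f p) (integrable_slice g p)
  map_smul' r _ := integral_const_mul r _

lemma sphereIntegral_d (p : P.carrier) (f : P.smooth) (a : Fin 3) :
    sphereIntegral p (d a f) = 2 * sphereIntegral p (coord a * f) :=
  integral_d f p a

/-- A smooth field that vanishes for interior parameters vanishes. -/
lemma eq_zero_of_interior (f : P.smooth)
    (h : ∀ (p : P.carrier), p.1 ∈ interior P.carrier → ∀ x, f.1 (p, x) = 0) : f = 0 := by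
  refine smooth_ext fun p x => ?_
  have h1 : ContinuousWithinAt (fun q => P.ext f (q, x.1)) (interior P.carrier) p.1 := by
    have := (contDiffOn_ext f).continuousOn _ (coe_mem_cone p x)
    refine (this.comp (t := P.cone) (f := fun q => (q, x.1)) (s := interior P.carrier)
      (Continuous.continuousWithinAt (by fun_prop)) fun q hq =>
      mem_cone.2 ⟨interior_subset hq, x.coe_ne_zero⟩)
  have h2 := h1.mem_closure_image (P.carrier_subset p.2)
  have h3 : (fun q => P.ext f (q, x.1)) '' interior P.carrier ⊆ {0} := by
    rintro _ ⟨q, hq, rfl⟩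
    simp [ext_pair _ (interior_subset hq), h ⟨q, interior_subset hq⟩ hq]
  have := closure_mono h3 h2
  simpa [ext_coe] using this

/-- Compactness of the sphere makes the local bound uniform in `x`; it provides the dominating
constant when differentiating under the integral. -/
lemma eventually_bound (f : P.smooth) {γ : ℝ → ℝ × ℝ} {I : Set ℝ} (hγ : ∀ s ∈ I, γ s ∈ P.carrier)
    (hc : ContinuousOn γ I) {u : ℝ} (hu : u ∈ I) :
    ∃ M, ∀ᶠ s in nhds u, s ∈ I → ∀ x : S2, |P.ext f (γ s, x.1)| ≤ M := by
  have hcont : ContinuousOn (fun z : ℝ × S2 => P.ext f (γ z.1, z.2.1)) (I ×ˢ Set.univ) := by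
    refine (contDiffOn_ext f).continuousOn.comp ?_ fun z hz =>
      mem_cone.2 ⟨hγ _ hz.1, z.2.coe_ne_zero⟩
    exact (hc.comp continuousOn_fst fun z hz => hz.1).prodMk (by fun_prop)
  have hcs : Continuous fun x : S2 => |P.ext f (γ u, x.1)| :=
    (hcont.comp_continuous (f := fun x : S2 => (u, x)) (by fun_prop) fun x => ⟨hu, trivial⟩).abs
  obtain ⟨M, hM⟩ := (isCompact_range hcs).bddAbove
  refine ⟨M + 1, ?_⟩
  have := isCompact_univ.eventually_forall_of_forall_eventually (x₀ := u)
    (P := fun s (x : S2) => s ∈ I → |P.ext f (γ s, x.1)| ≤ M + 1) fun x _ => by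
      have h1 := (hcont (u, x) ⟨hu, trivial⟩).abs
      have h2 : |P.ext f (γ u, x.1)| < M + 1 :=
        lt_of_le_of_lt (hM (Set.mem_range_self x)) (lt_add_one M)
      have h3 := eventually_nhdsWithin_iff.1 (h1.eventually (gt_mem_nhds h2))
      filter_upwards [h3] with z hz hI
      exact (hz ⟨hI, trivial⟩).le
  filter_upwards [this] with s hs hI x
  exact hs x trivial hI

/-- Differentiation under the integral sign along a curve of parameters. -/
lemma hasDerivWithinAt_integral (f : P.smooth) {I : Set ℝ} (hI : Convex ℝ I)
    {γ : ℝ → ℝ × ℝ} {γ' : ℝ × ℝ} (hγ : ∀ s ∈ I, γ s ∈ P.carrier)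
    (hd : ∀ s, HasDerivAt γ γ' s) {u : ℝ} (hu : u ∈ I) :
    HasDerivWithinAt (fun s => ∫ x, P.ext f (γ s, x.1) ∂area)
      (∫ x, (deriv (γ', 0) f).1 (⟨γ u, hγ u hu⟩, x) ∂area) I u := by
  have hderiv : ∀ s (hs : s ∈ I) (x : S2), HasDerivWithinAt (fun s => P.ext f (γ s, x.1))
      (P.ext (deriv (γ', 0) f : P.smooth) (γ s, x.1)) I s := fun s hs x => by
    have := hasDerivWithinAt_param f x hγ hs (hd s).hasDerivWithinAt
    rwa [← ext_coe (deriv (γ', 0) f : P.smooth).1] at this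
  have hint : ∀ s ∈ I, Integrable (fun x : S2 => P.ext f (γ s, x.1)) area := fun s hs => by
    have := integrable_slice f ⟨γ s, hγ s hs⟩
    simpa only [← ext_coe] using this
  obtain ⟨M, hM⟩ := eventually_bound (deriv (γ', 0) f) hγ
    (fun s _ => (hd s).continuousAt.continuousWithinAt) hu
  obtain ⟨ε, hε, hball⟩ := Metric.eventually_nhds_iff_ball.1 hM
  rw [hasDerivWithinAt_iff_tendsto_slope]
  have h0 : ∀ᶠ s in nhdsWithin u (I \ {u}), s ∈ I ∧ s ∈ Metric.ball u ε := by
    filter_upwards [self_mem_nhdsWithin, mem_nhdsWithin_of_mem_nhds (Metric.ball_mem_nhds u hε)]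
      with s h1 h2 using ⟨h1.1, h2⟩
  have hlim := tendsto_integral_filter_of_dominated_convergence (μ := area)
    (l := nhdsWithin u (I \ {u})) (F := fun s x => slope (fun s => P.ext f (γ s, x.1)) u s)
    (f := fun x => (deriv (γ', 0) f).1 (⟨γ u, hγ u hu⟩, x)) (fun _ => M) (by
      filter_upwards [h0] with s hs
      simp only [slope_def_module, smul_eq_mul]
      exact (((hint s hs.1).sub (hint u hu)).const_mul (s - u)⁻¹).aestronglyMeasurable) (by
      filter_upwards [h0] with s hs
      refine .of_forall fun x => ?_
      -- The mean value inequality on the convex set `I ∩ ball u ε` bounds the difference quotients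
      -- by the bound of the derivative, also when `u` is an endpoint.
      have hb := (hI.inter (convex_ball u ε)).norm_image_sub_le_of_norm_hasDerivWithin_le
        (f := fun s => P.ext f (γ s, x.1)) (C := M)
        (fun s hs => (hderiv s hs.1 x).mono Set.inter_subset_left)
        (fun s hs => hball s hs.2 hs.1 x) ⟨hu, Metric.mem_ball_self hε⟩ hs
      rw [slope_def_module, norm_smul, norm_inv]
      by_cases h : s = u
      · have hM0 : 0 ≤ M := (abs_nonneg _).trans (hball u (Metric.mem_ball_self hε) hu x)
        simpa [h] using hM0
      · have : 0 < ‖s - u‖ := norm_pos_iff.2 (sub_ne_zero.2 h)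
        rw [inv_mul_le_iff₀ this]
        linarith) (integrable_const M) (by
      refine .of_forall fun x => ?_
      have := hasDerivWithinAt_iff_tendsto_slope.1 (hderiv u hu x)
      rwa [ext_pair _ (hγ u hu), toS2_self] at this)
  refine hlim.congr' ?_
  filter_upwards [h0] with s hs
  simp only [slope_def_module, smul_eq_mul]
  rw [integral_const_mul, integral_sub (hint s hs.1) (hint u hu)]

end ParamDomain

/-! ### Tensor calculus on the sphere in ambient components -/

/-- A ring of functions on the sphere with the coordinate functions `x a` and the ambient components
`d a` of the gradient. -/
structure SphereCalculus (A : Type*) [CommRing A] [Algebra ℝ A] where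
  x : Fin 3 → A
  d : Fin 3 → Derivation ℝ A A
  sum_sq : ∑ a, x a * x a = 1
  d_x : ∀ a b, d a (x b) = (if a = b then 1 else 0) - x a * x b
  comm : ∀ a b f, d a (d b f) = d b (d a f) + x a * d b f - x b * d a f
  radial : ∀ f, ∑ a, x a * d a f = 0

namespace SphereCalculus

variable {A : Type*} [CommRing A] [Algebra ℝ A] (S : SphereCalculus A)

/-- The Laplacian. -/
def lap (f : A) : A := ∑ a, S.d a (S.d a f)

/-- The volume form. -/
def eps : Fin 3 → Fin 3 → A :=
  ![![0, S.x 2, -S.x 1], ![-S.x 2, 0, S.x 0], ![S.x 1, -S.x 0, 0]]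

/-- The permutation symbol. -/
def perm : Fin 3 → Fin 3 → Fin 3 → A :=
  ![![![0, 0, 0], ![0, 0, 1], ![0, -1, 0]], ![![0, 0, -1], ![0, 0, 0], ![1, 0, 0]],
    ![![0, 1, 0], ![-1, 0, 0], ![0, 0, 0]]]

/-- The rotation about the `k`-th axis. -/
def rot (k : Fin 3) (f : A) : A := ∑ a, S.eps a k * S.d a f

/-- The divergence of a 2-tensor. -/
def dv (N : Fin 3 → Fin 3 → A) (b : Fin 3) : A := ∑ a, S.d a (N a b)

/-- The dual of a 2-tensor in its first index. -/
def star (N : Fin 3 → Fin 3 → A) (a b : Fin 3) : A := ∑ e, S.eps a e * N e b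

/-- Twice the traceless part of the Hessian. -/
def hess0 (f : A) (a b : Fin 3) : A :=
  2 * (S.d a (S.d b f) + S.x b * S.d a f) -
    ((if a = b then 1 else 0) - S.x a * S.x b) * S.lap f

/-- Twice the symmetric traceless tensor with potentials `f` and `g`. -/
def pot (f g : A) (a b : Fin 3) : A := S.hess0 f a b + S.star (S.hess0 g) a b

/-- The bracket `ε^{ab} ∇_a f ∇_b g`. -/
def poisson (f g : A) : A := ∑ a, ∑ b, S.eps a b * S.d a f * S.d b g

/-- Symmetric traceless tangential tensors. -/
structure IsSTT (N : Fin 3 → Fin 3 → A) : Prop where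
  symm : ∀ a b, N a b = N b a
  tangent : ∀ a, ∑ b, N a b * S.x b = 0
  trace : ∑ a, N a a = 0

/-- Contraction of two 2-tensors. -/
def dot (M N : Fin 3 → Fin 3 → A) : A := ∑ a, ∑ b, M a b * N a b

variable {S}

lemma sq' : S.x 0 * S.x 0 + S.x 1 * S.x 1 + S.x 2 * S.x 2 = 1 := by
  simpa [Fin.sum_univ_three] using S.sum_sq

lemma radial' (f : A) : S.x 0 * S.d 0 f + S.x 1 * S.d 1 f + S.x 2 * S.d 2 f = 0 := by
  simpa [Fin.sum_univ_three] using S.radial f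

lemma IsSTT.tangent' {N : Fin 3 → Fin 3 → A} (h : S.IsSTT N) (a : Fin 3) :
    N a 0 * S.x 0 + N a 1 * S.x 1 + N a 2 * S.x 2 = 0 := by
  simpa [Fin.sum_univ_three] using h.tangent a

lemma IsSTT.trace' {N : Fin 3 → Fin 3 → A} (h : S.IsSTT N) :
    N 0 0 + N 1 1 + N 2 2 = 0 := by
  simpa [Fin.sum_univ_three] using h.trace

lemma lap_x (k : Fin 3) : S.lap (S.x k) = -2 * S.x k := by
  have h := S.sq'
  simp only [lap, Fin.sum_univ_three, S.d_x, map_sub, Derivation.leibniz, smul_eq_mul]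
  fin_cases k <;> simp <;> linear_combination (2 * S.x _) * h

lemma perm_swap (a b c : Fin 3) : (perm a b c : A) = -perm c b a := by
  fin_cases a <;> fin_cases b <;> fin_cases c <;> simp [perm]

lemma eps_swap (a b : Fin 3) : S.eps a b = -S.eps b a := by
  fin_cases a <;> fin_cases b <;> simp [eps]

lemma d_eps (a b c : Fin 3) : S.d a (S.eps b c) = perm b c a - S.x a * S.eps b c := by
  fin_cases a <;> fin_cases b <;> fin_cases c <;> simp [eps, perm, S.d_x] <;> ring

lemma eps_x (a : Fin 3) : S.eps a 0 * S.x 0 + S.eps a 1 * S.x 1 + S.eps a 2 * S.x 2 = 0 := by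
  fin_cases a <;> simp [eps] <;> ring

lemma eps_perm (a b : Fin 3) :
    S.eps a b = perm a b 0 * S.x 0 + perm a b 1 * S.x 1 + perm a b 2 * S.x 2 := by
  fin_cases a <;> fin_cases b <;> simp [eps, perm]

lemma d_perm (a b c e : Fin 3) : S.d e (perm a b c) = 0 := by
  fin_cases a <;> fin_cases b <;> fin_cases c <;> simp [perm]

lemma x_eps (a : Fin 3) : S.eps 0 a * S.x 0 + S.eps 1 a * S.x 1 + S.eps 2 a * S.x 2 = 0 := by
  fin_cases a <;> simp [eps] <;> ring

/-- The components of a gradient form a vector, so a rotation field acts on the function and also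
turns the index, through the generator `perm a k ·`. -/
lemma rot_d (k a : Fin 3) (f : A) :
    S.rot k (S.d a f) = S.d a (S.rot k f) + ∑ b, perm a k b * S.d b f := by
  have h0 := S.comm 0 a f
  have h1 := S.comm 1 a f
  have h2 := S.comm 2 a f
  simp only [rot, Fin.sum_univ_three, Derivation.leibniz, smul_eq_mul, map_add, d_eps,
    perm_swap a k]
  linear_combination S.eps 0 k * h0 + S.eps 1 k * h1 + S.eps 2 k * h2 + S.d a f * S.x_eps k

lemma rot_mul (k : Fin 3) (f g : A) : S.rot k (f * g) = S.rot k f * g + f * S.rot k g := by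
  simp only [rot, Fin.sum_univ_three, Derivation.leibniz, smul_eq_mul]
  ring

lemma rot_add (k : Fin 3) (f g : A) : S.rot k (f + g) = S.rot k f + S.rot k g := by
  simp only [rot, Fin.sum_univ_three, map_add]
  ring

lemma rot_sub (k : Fin 3) (f g : A) : S.rot k (f - g) = S.rot k f - S.rot k g := by
  simp only [rot, Fin.sum_univ_three, map_sub]
  ring

lemma rot_two (k : Fin 3) : S.rot k 2 = 0 := by
  have : ∀ a, S.d a 2 = 0 := fun a => by exact_mod_cast (S.d a).map_natCast 2
  simp [rot, this]

lemma rot_x (k a : Fin 3) : S.rot k (S.x a) = ∑ b, perm a k b * S.x b := by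
  have h := S.x_eps k
  have := S.eps_perm a k
  simp only [rot, Fin.sum_univ_three, S.d_x]
  have h2 : S.eps 0 k * (if 0 = a then 1 else 0) + S.eps 1 k * (if 1 = a then 1 else 0) +
      S.eps 2 k * (if 2 = a then 1 else 0) = S.eps a k := by
    fin_cases a <;> simp
  linear_combination h2 + this - S.x a * h

lemma lap_add (f g : A) : S.lap (f + g) = S.lap f + S.lap g := by
  simp [lap, Finset.sum_add_distrib]

lemma lap_sub (f g : A) : S.lap (f - g) = S.lap f - S.lap g := by
  simp [lap, Finset.sum_sub_distrib]

lemma lap_mul (f g : A) :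
    S.lap (f * g) = S.lap f * g + f * S.lap g + 2 * ∑ a, S.d a f * S.d a g := by
  simp only [lap, Fin.sum_univ_three, Derivation.leibniz, smul_eq_mul, map_add]
  ring

lemma lap_two_mul (f : A) : S.lap (2 * f) = 2 * S.lap f := by
  rw [two_mul, lap_add, two_mul]

/-- Rotations are isometries. In coordinates, the two index terms produced by `rot_d` contract an
antisymmetric symbol with the sum of both orders of second derivatives and cancel. -/
lemma lap_rot (k : Fin 3) (f : A) : S.rot k (S.lap f) = S.lap (S.rot k f) := by
  have key : ∀ a, S.rot k (S.d a (S.d a f)) = S.d a (S.d a (S.rot k f)) +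
      ∑ b, perm a k b * S.d a (S.d b f) + ∑ b, perm a k b * S.d b (S.d a f) := fun a => by
    rw [rot_d, rot_d]
    simp [Derivation.leibniz, d_perm]
  simp only [lap, Fin.sum_univ_three, rot_add, key]
  fin_cases k <;> simp [perm] <;> ring

/-- The commutator of the Laplacian with the gradient. -/
lemma lap_d (b : Fin 3) (f : A) : S.lap (S.d b f) = S.d b (S.lap f) - 2 * S.x b * S.lap f := by
  have key : ∀ a, S.d a (S.d a (S.d b f)) = S.d b (S.d a (S.d a f)) +
      S.x a * S.d b (S.d a f) - 2 * S.x b * S.d a (S.d a f) +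
      ((if a = a then 1 else 0) - S.x a * S.x a) * S.d b f + S.x a * S.d a (S.d b f)
      - ((if a = b then 1 else 0) - S.x a * S.x b) * S.d a f := fun a => by
    rw [S.comm a b f]
    simp only [map_add, map_sub, Derivation.leibniz, smul_eq_mul, S.d_x, S.comm a b (S.d a f)]
    rw [S.comm a b f]
    ring
  -- The differentiated radial identity trades `x a * d b (d a f)` for first derivatives.
  have r1 : ∑ a, S.d b (S.x a * S.d a f) = 0 := by rw [← map_sum, S.radial, map_zero]
  have r2 := S.radial (S.d b f)
  have h := S.sq'
  have h2 : (if 0 = b then 1 else 0) * S.d 0 f + (if 1 = b then 1 else 0) * S.d 1 f +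
      (if 2 = b then 1 else 0) * S.d 2 f = S.d b f := by fin_cases b <;> simp
  have h3 : (if b = 0 then 1 else 0) * S.d 0 f + (if b = 1 then 1 else 0) * S.d 1 f +
      (if b = 2 then 1 else 0) * S.d 2 f = S.d b f := by fin_cases b <;> simp
  have r0 := S.radial' f
  simp only [Fin.sum_univ_three, Derivation.leibniz, smul_eq_mul, S.d_x] at r1 r2
  simp only [lap, Fin.sum_univ_three, key, map_add]
  simp only [if_true]
  linear_combination r1 + r2 - h2 - h3 - S.d b f * h + 2 * S.x b * r0

end SphereCalculus

/-! ### Traceless Hessians, their duals and divergences -/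

namespace SphereCalculus

variable {A : Type*} [CommRing A] [Algebra ℝ A] {S : SphereCalculus A}

/-- The correction `x b * d a f` is what the tangential projection adds to `d a (d b f)`. It
compensates the commutator of the derivatives, and tangency is the derivative of the radial
identity. -/
lemma hess0_isSTT (f : A) : S.IsSTT (S.hess0 f) where
  symm a b := by
    have h := S.comm a b f
    simp only [hess0, h]
    by_cases hab : a = b
    · subst hab; ring
    · simp only [hab, Ne.symm hab, if_false]; ring
  tangent a := by
    have r1 : S.d a (∑ b, S.x b * S.d b f) = 0 := by rw [S.radial, map_zero]
    have h := S.sq'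
    have r0 := S.radial' f
    have h2 : (if a = 0 then 1 else 0) * S.d 0 f + (if a = 1 then 1 else 0) * S.d 1 f +
      (if a = 2 then 1 else 0) * S.d 2 f = S.d a f := by fin_cases a <;> simp
    have h3 : (if a = 0 then 1 else 0) * S.x 0 + (if a = 1 then 1 else 0) * S.x 1 +
      (if a = 2 then 1 else 0) * S.x 2 = S.x a := by fin_cases a <;> simp
    simp only [Fin.sum_univ_three, Derivation.leibniz, smul_eq_mul, S.d_x, map_add] at r1
    simp only [hess0, Fin.sum_univ_three]
    linear_combination 2 * r1 - 2 * h2 + 2 * S.x a * r0 + 2 * S.d a f * h -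
      S.lap f * h3 + S.lap f * S.x a * h
  trace := by
    have h := S.sq'
    have r0 := S.radial' f
    simp only [hess0, lap, Fin.sum_univ_three]
    simp only [if_true]
    linear_combination 2 * r0 +
      (S.d 0 (S.d 0 f) + S.d 1 (S.d 1 f) + S.d 2 (S.d 2 f)) * h

/-- In two dimensions a quarter turn of one index of a symmetric traceless tensor gives another such
tensor; symmetry of the result needs the trace condition. -/
lemma star_isSTT {N : Fin 3 → Fin 3 → A} (h : S.IsSTT N) : S.IsSTT (S.star N) where
  symm a b := by
    have t := h.tangent'
    have tr := h.trace'
    have s01 := h.symm 1 0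
    have s02 := h.symm 2 0
    have s12 := h.symm 2 1
    have t0 := t 0
    have t1 := t 1
    have t2 := t 2
    fin_cases a <;> fin_cases b <;> simp [star, eps, Fin.sum_univ_three] <;> grind
  tangent a := by
    have t0 := h.tangent' 0
    have t1 := h.tangent' 1
    have t2 := h.tangent' 2
    simp only [star, Fin.sum_univ_three]
    linear_combination S.eps a 0 * t0 + S.eps a 1 * t1 + S.eps a 2 * t2
  trace := by
    have s01 := h.symm 1 0
    have s02 := h.symm 2 0
    have s12 := h.symm 2 1
    simp [star, eps, Fin.sum_univ_three, s01, s02, s12]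
    ring

/-- By symmetry of the dual, the divergence may be taken on the index that `eps` does not touch. The
derivative of `eps` then contributes an antisymmetric symbol and a normal term, and both vanish
against `N`. -/
lemma dv_star {N : Fin 3 → Fin 3 → A} (h : S.IsSTT N) (b : Fin 3) :
    S.dv (S.star N) b = ∑ c, S.eps b c * S.dv N c := by
  have t0 := h.tangent' 0
  have t1 := h.tangent' 1
  have t2 := h.tangent' 2
  have s01 := h.symm 1 0
  have s02 := h.symm 2 0
  have s12 := h.symm 2 1
  have key : ∀ a, S.star N a b = S.star N b a := fun a => (star_isSTT h).symm a b
  simp only [dv, key]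
  simp only [star, Fin.sum_univ_three, Derivation.leibniz, smul_eq_mul, map_add, d_eps]
  fin_cases b <;> simp [perm, eps, s01, s02, s12] at * <;> grind

/-- The term `2 * f` is the curvature of the unit sphere, entering through the commutator `lap_d`.
-/
lemma dv_hess0 (f : A) (b : Fin 3) : S.dv (S.hess0 f) b = S.d b (S.lap f + 2 * f) := by
  have h := S.lap_d b f
  have h1 := S.sq'
  have r1 := S.radial' (S.lap f)
  have r0 := S.radial' f
  have h0 : ∀ a, S.d a 2 = 0 := fun a => by exact_mod_cast (S.d a).map_natCast 2
  have hi : ∀ a, S.d a (if a = b then 1 else 0) = 0 := fun a => by split_ifs <;> simp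
  have h2 : (if 0 = b then 1 else 0) * S.d 0 (S.lap f) + (if 1 = b then 1 else 0) * S.d 1 (S.lap f) +
      (if 2 = b then 1 else 0) * S.d 2 (S.lap f) = S.d b (S.lap f) := by fin_cases b <;> simp
  have h3 : (if 0 = b then 1 else 0) * S.d 0 f + (if 1 = b then 1 else 0) * S.d 1 f +
      (if 2 = b then 1 else 0) * S.d 2 f = S.d b f := by fin_cases b <;> simp
  have h4 : (if 0 = b then 1 else 0) * S.x 0 + (if 1 = b then 1 else 0) * S.x 1 +
      (if 2 = b then 1 else 0) * S.x 2 = S.x b := by fin_cases b <;> simp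
  have hl : S.lap f = S.d 0 (S.d 0 f) + S.d 1 (S.d 1 f) + S.d 2 (S.d 2 f) := by
    simp [lap, Fin.sum_univ_three]
  have hl' : S.lap (S.d b f) = S.d 0 (S.d 0 (S.d b f)) + S.d 1 (S.d 1 (S.d b f)) +
    S.d 2 (S.d 2 (S.d b f)) := by
    simp [lap, Fin.sum_univ_three]
  simp only [dv, hess0, Fin.sum_univ_three, Derivation.leibniz, smul_eq_mul, map_add, map_sub,
    S.d_x, h0, hi]
  simp only [if_true]
  linear_combination 2 * h - 2 * hl' - h2 + 2 * h3 + S.lap f * h4 - 2 * S.x b * r0 + S.x b * r1 -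
    2 * S.lap f * S.x b * h1 - 2 * S.x b * hl


lemma dot_comm (M N : Fin 3 → Fin 3 → A) : dot M N = dot N M := by
  simp [dot, mul_comm]

lemma dot_star (M N : Fin 3 → Fin 3 → A) : dot N (S.star M) = -dot (S.star N) M := by
  simp [dot, star, eps, Fin.sum_univ_three]
  ring

lemma dot_add (M N N' : Fin 3 → Fin 3 → A) :
    dot M (fun a b => N a b + N' a b) = dot M N + dot M N' := by
  simp [dot, Fin.sum_univ_three]
  ring

/-- The trace part and the normal correction of the Hessian are invisible to a traceless tangential
tensor. -/
lemma IsSTT.dot_hess0 {N : Fin 3 → Fin 3 → A} (h : S.IsSTT N) (f : A) :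
    dot N (S.hess0 f) = 2 * ∑ a, ∑ b, N a b * S.d a (S.d b f) := by
  have t0 := h.tangent' 0
  have t1 := h.tangent' 1
  have t2 := h.tangent' 2
  have tr := h.trace'
  simp only [dot, hess0, Fin.sum_univ_three]
  simp
  linear_combination (2 * S.d 0 f + S.x 0 * S.lap f) * t0 + (2 * S.d 1 f + S.x 1 * S.lap f) * t1 +
    (2 * S.d 2 f + S.x 2 * S.lap f) * t2 - S.lap f * tr

lemma pot_isSTT (f g : A) : S.IsSTT (S.pot f g) where
  symm a b := by
    simp only [pot, (hess0_isSTT f).symm a b, (star_isSTT (hess0_isSTT g)).symm a b]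
  tangent a := by
    have := (hess0_isSTT (S := S) f).tangent a
    have := (star_isSTT (hess0_isSTT (S := S) g)).tangent a
    simp_all [pot, add_mul, Finset.sum_add_distrib]
  trace := by
    have := (hess0_isSTT (S := S) f).trace
    have := (star_isSTT (hess0_isSTT (S := S) g)).trace
    simp_all [pot, Finset.sum_add_distrib]

lemma dv_pot (f g : A) (b : Fin 3) : S.dv (S.pot f g) b =
    S.d b (S.lap f + 2 * f) + ∑ c, S.eps b c * S.d c (S.lap g + 2 * g) := by
  have h1 := S.dv_hess0 f b
  have h2 := dv_star (hess0_isSTT (S := S) g) b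
  simp only [dv_hess0] at h2
  rw [← h1, ← h2]
  simp [dv, pot, Finset.sum_add_distrib]

lemma IsSTT.dot_pot {N : Fin 3 → Fin 3 → A} (h : S.IsSTT N) (f g : A) :
    dot N (S.pot f g) = 2 * ∑ a, ∑ b, N a b * S.d a (S.d b f) -
      2 * ∑ a, ∑ b, S.star N a b * S.d a (S.d b g) := by
  have : dot N (S.pot f g) = _ := dot_add N (S.hess0 f) (S.star (S.hess0 g))
  rw [this, dot_star, h.dot_hess0, (star_isSTT h).dot_hess0]
  ring

/-- Differentiating the tangency relation shows that the normal part of the divergence is minus the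
trace. -/
lemma IsSTT.dv_tangent {N : Fin 3 → Fin 3 → A} (h : S.IsSTT N) : ∑ b, S.x b * S.dv N b = 0 := by
  have key : ∀ a, S.d a (∑ b, N a b * S.x b) = 0 := fun a => by rw [h.tangent, map_zero]
  have k0 := key 0
  have k1 := key 1
  have k2 := key 2
  have t0 := h.tangent' 0
  have t1 := h.tangent' 1
  have t2 := h.tangent' 2
  have tr := h.trace'
  simp [Fin.sum_univ_three, S.d_x] at k0 k1 k2
  simp only [dv, Fin.sum_univ_three]
  linear_combination k0 + k1 + k2 - tr + S.x 0 * t0 + S.x 1 * t1 + S.x 2 * t2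

lemma curl_grad (f : A) : ∑ b, S.d b (∑ c, S.eps b c * S.d c f) = 0 := by
  have c01 := S.comm 0 1 f
  have c02 := S.comm 0 2 f
  have c12 := S.comm 1 2 f
  simp only [Fin.sum_univ_three, Derivation.leibniz, smul_eq_mul, map_add, d_eps, c01, c02, c12]
  simp [eps, perm]
  ring

lemma eps_eps_d (f : A) (b : Fin 3) :
    ∑ c, S.eps b c * ∑ e, S.eps c e * S.d e f = -S.d b f := by
  have h := S.sq'
  have r := S.radial' f
  simp only [Fin.sum_univ_three]
  fin_cases b <;> simp [eps]
  · linear_combination S.x 0 * r - S.d 0 f * h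
  · linear_combination S.x 1 * r - S.d 1 f * h
  · linear_combination S.x 2 * r - S.d 2 f * h

lemma dv_star_pot (f g : A) (b : Fin 3) : S.dv (S.star (S.pot f g)) b =
    ∑ c, S.eps b c * S.d c (S.lap f + 2 * f) - S.d b (S.lap g + 2 * g) := by
  rw [dv_star (pot_isSTT f g), sub_eq_add_neg, ← eps_eps_d]
  simp only [dv_pot, mul_add, Finset.sum_add_distrib]

/-- A quarter-turned gradient is divergence free, so a double divergence sees only the electric
potential. For the dual tensor the two potentials exchange roles. -/
lemma div_dv_pot (f g : A) : ∑ b, S.d b (S.dv (S.pot f g) b) = S.lap (S.lap f + 2 * f) := by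
  simp only [dv_pot]
  generalize S.lap f + 2 * f = α
  simp only [map_add _ (S.d _ α), Finset.sum_add_distrib, curl_grad, lap, add_zero]

lemma div_dv_star_pot (f g : A) :
    ∑ b, S.d b (S.dv (S.star (S.pot f g)) b) = -S.lap (S.lap g + 2 * g) := by
  simp only [dv_star_pot]
  generalize S.lap g + 2 * g = β
  simp only [map_sub, Finset.sum_sub_distrib, curl_grad, lap, zero_sub]

end SphereCalculus

namespace SphereCalculus

variable {A : Type*} [CommRing A] [Algebra ℝ A] {S : SphereCalculus A}

/-! ### Integration by parts -/

section Integral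

variable {I : A →ₗ[ℝ] ℝ}

lemma integral_two_mul (f : A) : I (2 * f) = 2 * I f := by
  rw [two_mul, map_add, two_mul]

variable (hI : ∀ a f, I (S.d a f) = 2 * I (S.x a * f))
include hI

lemma integral_div (η : Fin 3 → A) (h : ∑ a, S.x a * η a = 0) : I (∑ a, S.d a (η a)) = 0 := by
  simp only [map_sum, hI]
  rw [← Finset.mul_sum, ← map_sum, h, map_zero, mul_zero]

lemma integral_eq_of_div {f g : A} (η : Fin 3 → A) (h : ∑ a, S.x a * η a = 0)
    (hd : f = g + ∑ a, S.d a (η a)) : I f = I g := by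
  rw [hd, map_add, integral_div hI η h, add_zero]

lemma integral_lap_symm (f g : A) : I (f * S.lap g) = I (g * S.lap f) := by
  refine integral_eq_of_div hI (fun a => f * S.d a g - g * S.d a f) ?_ ?_
  · have h1 := S.radial' f
    have h2 := S.radial' g
    simp only [Fin.sum_univ_three]
    linear_combination f * h2 - g * h1
  · simp only [lap, Fin.sum_univ_three, Derivation.leibniz, smul_eq_mul, map_sub]
    ring

lemma integral_rot_antisymm (k : Fin 3) (f g : A) : I (f * S.rot k g) = -I (g * S.rot k f) := by
  rw [← map_neg]
  refine integral_eq_of_div hI (fun a => f * g * S.eps a k) ?_ ?_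
  · have h := S.x_eps k
    simp only [Fin.sum_univ_three]
    linear_combination f * g * h
  · have h := S.x_eps k
    simp only [rot, Fin.sum_univ_three, Derivation.leibniz, smul_eq_mul, d_eps]
    fin_cases k <;> simp [perm] at h ⊢ <;> linear_combination f * g * h

/-- The derivative is moved from `g` to the coordinate function, and the quarter-turned gradient of
the latter is the rotation field. -/
lemma integral_x_poisson (k : Fin 3) (f g : A) :
    I (S.x k * S.poisson f g) = -I (g * S.rot k f) := by
  rw [← map_neg]
  refine integral_eq_of_div hI (fun b => g * S.x k * ∑ a, S.eps a b * S.d a f) ?_ ?_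
  · have h0 := S.eps_x 0
    have h1 := S.eps_x 1
    have h2 := S.eps_x 2
    simp only [Fin.sum_univ_three]
    linear_combination g * S.x k * (S.d 0 f * h0 + S.d 1 f * h1 + S.d 2 f * h2)
  · have c01 := S.comm 0 1 f
    have c02 := S.comm 0 2 f
    have c12 := S.comm 1 2 f
    simp only [poisson, rot, Fin.sum_univ_three, Derivation.leibniz, smul_eq_mul, map_add, S.d_x, d_eps,
      c01, c02, c12]
    fin_cases k <;> simp [eps, perm] <;> ring

/-- Two integrations by parts, carried by the single tangential field $N\nabla f-f\,\mathrm{div}N$.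
-/
lemma IsSTT.integral_hess {N : Fin 3 → Fin 3 → A} (h : S.IsSTT N) (f : A) :
    I (∑ a, ∑ b, N a b * S.d a (S.d b f)) = I (f * ∑ b, S.d b (S.dv N b)) := by
  have h1 := h.dv_tangent
  have t := h.tangent
  have s := h.symm
  refine integral_eq_of_div hI (fun a => ∑ b, N a b * S.d b f - f * S.dv N a) ?_ ?_
  · have t0 := h.tangent' 0
    have t1 := h.tangent' 1
    have t2 := h.tangent' 2
    rw [s 1 0, s 2 0, s 2 1] at *
    simp only [Fin.sum_univ_three] at h1 ⊢
    rw [s 1 0, s 2 0, s 2 1]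
    linear_combination S.d 0 f * t0 + S.d 1 f * t1 + S.d 2 f * t2 - f * h1
  · simp only [dv, Fin.sum_univ_three, Derivation.leibniz, smul_eq_mul, map_sub, map_add]
    ring

/-- Integration by parts with the field $N(\tilde X\nabla f-f\nabla\tilde X)$. No term without a
divergence of $N$ remains, because the Hessian of a coordinate function is pure trace and $N$ is
traceless. -/
lemma IsSTT.integral_x_hess {N : Fin 3 → Fin 3 → A} (h : S.IsSTT N) (k : Fin 3) (f : A) :
    I (S.x k * ∑ a, ∑ b, N a b * S.d a (S.d b f)) =
      I (∑ b, (f * S.d b (S.x k) - S.x k * S.d b f) * S.dv N b) := by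
  have s := h.symm
  have t0 := h.tangent' 0
  have t1 := h.tangent' 1
  have t2 := h.tangent' 2
  have tr := h.trace'
  refine integral_eq_of_div hI
    (fun a => ∑ b, N a b * (S.x k * S.d b f - f * S.d b (S.x k))) ?_ ?_
  · rw [s 1 0, s 2 0, s 2 1] at *
    simp only [Fin.sum_univ_three]
    rw [s 1 0, s 2 0, s 2 1]
    linear_combination (S.x k * S.d 0 f - f * S.d 0 (S.x k)) * t0 +
      (S.x k * S.d 1 f - f * S.d 1 (S.x k)) * t1 + (S.x k * S.d 2 f - f * S.d 2 (S.x k)) * t2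
  · have key : ∀ a b, S.d a (S.d b (S.x k)) = -((if a = b then 1 else 0) - S.x a * S.x b) * S.x k -
        S.x b * S.d a (S.x k) := fun a b => by
      rw [S.d_x b k]
      have : S.d a (if b = k then 1 else 0) = 0 := by split_ifs <;> simp
      rw [map_sub, this, Derivation.leibniz, S.d_x a b]
      simp only [smul_eq_mul]
      ring
    simp only [dv, Fin.sum_univ_three, Derivation.leibniz, smul_eq_mul, map_sub, map_add, key]
    simp only [s 1 0, s 2 0, s 2 1] at t1 t2 ⊢
    simp
    linear_combination -f * S.x k * tr + (f * S.x k * S.x 0 - f * S.d 0 (S.x k)) * t0 +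
      (f * S.x k * S.x 1 - f * S.d 1 (S.x k)) * t1 + (f * S.x k * S.x 2 - f * S.d 2 (S.x k)) * t2

/-- Since $\Delta\tilde X=-2\tilde X$, the divergence of $\tilde X\nabla f-f\nabla\tilde X$ is
$\tilde X(\Delta+2)f$. -/
lemma integral_electric (k : Fin 3) (f α : A) :
    I (∑ b, (f * S.d b (S.x k) - S.x k * S.d b f) * S.d b α) =
      I (S.x k * α * (S.lap f + 2 * f)) := by
  refine integral_eq_of_div hI
    (fun b => α * (f * S.d b (S.x k) - S.x k * S.d b f)) ?_ ?_
  · have h1 := S.radial' f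
    have h2 := S.radial' (S.x k)
    simp only [Fin.sum_univ_three]
    linear_combination α * f * h2 - α * S.x k * h1
  · have h := S.lap_x k
    simp only [lap, Fin.sum_univ_three] at h
    simp only [lap, Fin.sum_univ_three, Derivation.leibniz, smul_eq_mul, map_sub]
    linear_combination -α * f * h

/-- The curl of $f\nabla\tilde X-\tilde X\nabla f$ is twice a Poisson bracket of $f$ with $\tilde
X$, that is, twice the rotation of $f$ up to sign. -/
lemma integral_magnetic (k : Fin 3) (f α : A) :
    I (∑ b, (f * S.d b (S.x k) - S.x k * S.d b f) * ∑ c, S.eps b c * S.d c α) =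
      I (2 * (α * S.rot k f)) := by
  refine integral_eq_of_div hI
    (fun c => α * ∑ b, (f * S.d b (S.x k) - S.x k * S.d b f) * S.eps b c) ?_ ?_
  · have h0 := S.eps_x 0
    have h1 := S.eps_x 1
    have h2 := S.eps_x 2
    simp only [Fin.sum_univ_three]
    linear_combination α * ((f * S.d 0 (S.x k) - S.x k * S.d 0 f) * h0 +
      (f * S.d 1 (S.x k) - S.x k * S.d 1 f) * h1 + (f * S.d 2 (S.x k) - S.x k * S.d 2 f) * h2)
  · have c01 := S.comm 0 1 f
    have c02 := S.comm 0 2 f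
    have c12 := S.comm 1 2 f
    simp only [rot, Fin.sum_univ_three, Derivation.leibniz, smul_eq_mul, map_add,
      map_sub, d_eps, c01, c02, c12]
    fin_cases k <;> simp [eps, perm, S.d_x] <;> ring_nf

/-- Without a weight the electric and magnetic parts are orthogonal: each second potential pairs
only with the matching double divergence. -/
lemma integral_dot_pot (f g n n' : A) :
    I (dot (S.pot n n') (S.pot f g)) =
      2 * I (f * S.lap (S.lap n + 2 * n)) + 2 * I (g * S.lap (S.lap n' + 2 * n')) := by
  have h := pot_isSTT (S := S) n n'
  rw [h.dot_pot, map_sub, integral_two_mul, integral_two_mul, h.integral_hess hI,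
    (star_isSTT h).integral_hess hI]
  rw [div_dv_pot, div_dv_star_pot, mul_neg, map_neg]
  ring

/-- A coordinate function as weight breaks the orthogonality of the electric and magnetic parts; the
mixed terms are the rotation terms from `integral_magnetic`. -/
lemma integral_x_dot_pot (k : Fin 3) (f g n n' : A) :
    I (S.x k * dot (S.pot n n') (S.pot f g)) =
      2 * I (S.x k * (S.lap n + 2 * n) * (S.lap f + 2 * f)) +
      2 * I (S.x k * (S.lap n' + 2 * n') * (S.lap g + 2 * g)) +
      4 * I ((S.lap n' + 2 * n') * S.rot k f) - 4 * I ((S.lap n + 2 * n) * S.rot k g) := by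
  have h := pot_isSTT (S := S) n n'
  rw [h.dot_pot, mul_sub, mul_left_comm, mul_left_comm (S.x k) 2, map_sub, integral_two_mul,
    integral_two_mul, h.integral_x_hess hI, (star_isSTT h).integral_x_hess hI]
  simp only [dv_star_pot, dv_pot]
  generalize hα : S.lap n + 2 * n = α
  generalize hα' : S.lap n' + 2 * n' = α'
  simp only [mul_add, mul_sub, Finset.sum_add_distrib, Finset.sum_sub_distrib]
  rw [map_add, map_sub, integral_electric hI, integral_electric hI, integral_magnetic hI,
    integral_magnetic hI, integral_two_mul, integral_two_mul, mul_add, mul_add]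
  ring

/-- Integration against the gradient of a coordinate function. -/
lemma integral_grad_x (k : Fin 3) (f g : A) :
    2 * I (g * ∑ a, S.d a (S.x k) * S.d a f) =
      I (S.x k * (f * S.lap g)) - I (S.x k * (g * S.lap f)) + 2 * I (S.x k * (f * g)) := by
  have h := S.lap_mul (S.x k) f
  rw [S.lap_x] at h
  -- The product rule for the Laplacian, with $\Delta\tilde X=-2\tilde X$, removes the gradients.
  have h1 : 2 * (g * ∑ a, S.d a (S.x k) * S.d a f) =
      g * S.lap (S.x k * f) - S.x k * (g * S.lap f) + 2 * (S.x k * (f * g)) := by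
    rw [h]; ring
  rw [← integral_two_mul, h1, map_add, map_sub, integral_lap_symm hI, integral_two_mul, mul_assoc]

/-- The Laplacian is symmetric and commutes with rotations, so $\Delta+2$ and $\Delta$ may be
exchanged between the factors. This cancels the mixed terms in the center of mass flux. -/
lemma integral_lap_rot (k : Fin 3) (f g : A) :
    I ((S.lap g + 2 * g) * S.rot k (S.lap f)) = I (S.lap g * S.rot k (S.lap f + 2 * f)) := by
  have h1 := integral_lap_symm hI g (S.rot k f)
  have h2 := integral_lap_symm hI (S.lap g) (S.rot k f)
  rw [mul_comm (S.rot k f)] at h1 h2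
  rw [add_mul, map_add, rot_add, mul_add, map_add, rot_mul, rot_two, zero_mul, zero_add, lap_rot,
    mul_assoc, integral_two_mul, mul_left_comm, integral_two_mul, h1]

end Integral

end SphereCalculus

/-! ### Laplacian and rotations acting on tensors with potentials -/

namespace SphereCalculus

variable {A : Type*} [CommRing A] [Algebra ℝ A] {S : SphereCalculus A}

/-- Here the Laplacian acts on each ambient component as on a function. The last bracket has a
normal factor in each term and drops out when contracted with tangential tensors. -/
lemma lap_hess0 (f : A) (a b : Fin 3) :
    S.lap (S.hess0 f a b) = S.hess0 (S.lap f) a b + 2 * S.hess0 f a b -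
      2 * (S.x a * S.d b (S.lap f + 2 * f) + S.x b * S.d a (S.lap f + 2 * f)) := by
  have hδ : ∀ (c : Fin 3) (p : Prop) [Decidable p], S.d c (if p then 1 else 0) = 0 :=
    fun c p _ => by split_ifs <;> simp
  have hδl : S.lap (if a = b then 1 else 0) = 0 := by simp [lap, hδ]
  have h2 : ∀ c, S.d c 2 = 0 := fun c => by exact_mod_cast (S.d c).map_natCast 2
  have hr : ∀ (b : Fin 3) (g : A), ∑ c, S.d c (S.x b) * S.d c g = S.d b g := fun b g => by
    have r := S.radial' g
    have h2 : (if 0 = b then 1 else 0) * S.d 0 g + (if 1 = b then 1 else 0) * S.d 1 g +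
      (if 2 = b then 1 else 0) * S.d 2 g = S.d b g := by fin_cases b <;> simp
    simp only [S.d_x, Fin.sum_univ_three]
    linear_combination h2 - S.x b * r
  have hxx : S.lap (S.x a * S.x b) =
      -4 * S.x a * S.x b + 2 * ((if a = b then 1 else 0) - S.x a * S.x b) := by
    rw [lap_mul, hr, lap_x, lap_x, S.d_x]; ring
  have hdd : S.lap (S.d a (S.d b f)) = S.d a (S.d b (S.lap f)) -
      2 * ((if a = b then 1 else 0) - S.x a * S.x b) * S.lap f - 2 * S.x b * S.d a (S.lap f) -
      2 * S.x a * (S.d b (S.lap f) - 2 * S.x b * S.lap f) := by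
    rw [lap_d, lap_d]
    simp only [map_sub, Derivation.leibniz, smul_eq_mul, h2, S.d_x]
    ring
  have hxd : S.lap (S.x b * S.d a f) = -2 * S.x b * S.d a f +
      S.x b * (S.d a (S.lap f) - 2 * S.x a * S.lap f) + 2 * S.d b (S.d a f) := by
    rw [lap_mul, hr, lap_x, lap_d]
  have hg : ∑ c, S.d c ((if a = b then 1 else 0) - S.x a * S.x b) * S.d c (S.lap f) =
      -(S.x b * S.d a (S.lap f) + S.x a * S.d b (S.lap f)) := by
    rw [← hr a, ← hr b]
    simp only [map_sub, hδ, Derivation.leibniz, smul_eq_mul, Fin.sum_univ_three]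
    ring
  rw [hess0, lap_sub, lap_two_mul, lap_add, hdd, hxd, lap_mul, hg, lap_sub, hδl, hxx, S.comm b a f]
  simp only [hess0, map_add, Derivation.leibniz, smul_eq_mul, h2]
  ring

/-- For a tangential field `m` the tangential part of the ambient curl involves no genuine
derivative: it comes from the normal components `x · d c m = -m c`. -/
lemma curl_tangent {n m : Fin 3 → A} (hn : n 0 * S.x 0 + n 1 * S.x 1 + n 2 * S.x 2 = 0)
    (hm : m 0 * S.x 0 + m 1 * S.x 1 + m 2 * S.x 2 = 0) :
    ∑ a, ∑ e, ∑ c, n a * (perm a e c * S.d c (m e)) = ∑ a, ∑ c, n a * (S.eps a c * m c) := by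
  have key : ∀ c, S.d c (m 0 * S.x 0 + m 1 * S.x 1 + m 2 * S.x 2) = 0 := fun c => by
    rw [hm, map_zero]
  have k0 := key 0
  have k1 := key 1
  have k2 := key 2
  have s0 := S.radial' (m 0)
  have s1 := S.radial' (m 1)
  have s2 := S.radial' (m 2)
  have h := S.sq'
  simp [S.d_x] at k0 k1 k2
  simp [Fin.sum_univ_three, perm, eps]
  linear_combination
    (-n 0 * (S.d 2 (m 1) - S.d 1 (m 2)) - n 1 * (S.d 0 (m 2) - S.d 2 (m 0)) -
      n 2 * (S.d 1 (m 0) - S.d 0 (m 1))) * h +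
    (S.x 0 * (S.d 2 (m 1) - S.d 1 (m 2)) + S.x 1 * (S.d 0 (m 2) - S.d 2 (m 0)) +
      S.x 2 * (S.d 1 (m 0) - S.d 0 (m 1))) * hn +
    (S.x 1 * n 2 - S.x 2 * n 1) * (s0 - k0 - S.x 0 * hm) +
    (S.x 2 * n 0 - S.x 0 * n 2) * (s1 - k1 - S.x 1 * hm) +
    (S.x 0 * n 1 - S.x 1 * n 0) * (s2 - k2 - S.x 2 * hm)

lemma IsSTT.dot_lap_hess0 {N : Fin 3 → Fin 3 → A} (h : S.IsSTT N) (f : A) :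
    dot N (fun a b => S.lap (S.hess0 f a b)) =
      dot N (S.hess0 (S.lap f)) + 2 * dot N (S.hess0 f) := by
  have t0 := h.tangent' 0
  have t1 := h.tangent' 1
  have t2 := h.tangent' 2
  have s := h.symm
  simp only [dot, lap_hess0]
  generalize S.lap f + 2 * f = w
  simp only [Fin.sum_univ_three]
  rw [s 1 0, s 2 0, s 2 1] at *
  linear_combination -4 * (S.d 0 w * t0 + S.d 1 w * t1 + S.d 2 w * t2)

lemma eps_self (a : Fin 3) : S.eps a a = 0 := by
  fin_cases a <;> simp [eps]

lemma lap_eps (a b : Fin 3) : S.lap (S.eps a b) = -2 * S.eps a b := by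
  have hn : ∀ f, S.lap (-f) = -S.lap f := fun f => by simp [lap]
  have h0 : S.lap 0 = 0 := by simp [lap]
  fin_cases a <;> fin_cases b <;> simp [eps, lap_x, hn, h0]

/-- The product rule for the Laplacian of `eps * M` yields `-2` times the dual from `lap_eps`, and a
cross term that by `curl_tangent` contributes `+2` times the dual. Against tangential tensors the
Laplacian thus commutes with the dual. -/
lemma IsSTT.dot_lap_star {N M : Fin 3 → Fin 3 → A} (h : S.IsSTT N) (hM : S.IsSTT M) :
    dot N (fun a b => S.lap (S.star M a b)) = -dot (S.star N) (fun a b => S.lap (M a b)) := by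
  have s := h.symm
  have sM := hM.symm
  have key : ∀ a b, S.lap (S.star M a b) = -2 * S.star M a b +
      ∑ e, S.eps a e * S.lap (M e b) + 2 * ∑ e, ∑ c, perm a e c * S.d c (M e b) := fun a b => by
    have r0 := S.radial' (M 0 b)
    have r1 := S.radial' (M 1 b)
    have r2 := S.radial' (M 2 b)
    simp only [star, Fin.sum_univ_three, lap_add, lap_mul, lap_eps, d_eps]
    linear_combination -2 * (S.eps a 0 * r0 + S.eps a 1 * r1 + S.eps a 2 * r2)
  have hc : ∀ b, _ := fun b => S.curl_tangent (n := fun a => N a b) (m := fun e => M e b)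
    (by have := h.tangent' b; rwa [s b 0, s b 1, s b 2] at this)
    (by have := hM.tangent' b; rwa [sM b 0, sM b 1, sM b 2] at this)
  have c0 := hc 0
  have c1 := hc 1
  have c2 := hc 2
  simp only [Fin.sum_univ_three] at c0 c1 c2
  simp only [dot, key]
  simp only [star, Fin.sum_univ_three]
  rw [eps_swap 1 0, eps_swap 2 0, eps_swap 2 1] at *
  simp only [eps_self] at *
  linear_combination 2 * (c0 + c1 + c2)

lemma IsSTT.dot_lap_pot {N : Fin 3 → Fin 3 → A} (h : S.IsSTT N) (f g : A) :
    dot N (fun a b => S.lap (S.pot f g a b)) =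
      dot N (S.pot (S.lap f) (S.lap g)) + 2 * dot N (S.pot f g) := by
  have e : ∀ f g, dot N (S.pot f g) = dot N (S.hess0 f) + dot N (S.star (S.hess0 g)) :=
    fun f g => dot_add N (S.hess0 f) (S.star (S.hess0 g))
  have e2 : dot N (fun a b => S.lap (S.pot f g a b)) = dot N (fun a b => S.lap (S.hess0 f a b)) +
      dot N (fun a b => S.lap (S.star (S.hess0 g) a b)) := by
    rw [← dot_add]
    simp only [pot, lap_add]
  rw [e2, e, e, h.dot_lap_hess0, h.dot_lap_star (hess0_isSTT g), (star_isSTT h).dot_lap_hess0,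
    dot_star, dot_star]
  ring

lemma rot_eps (k a e : Fin 3) : S.rot k (S.eps a e) =
    ∑ c, perm a k c * S.eps c e + ∑ c, perm e k c * S.eps a c := by
  have hn : ∀ f, S.rot k (-f) = -S.rot k f := fun f => by simp [rot]
  have h0 : S.rot k 0 = 0 := by simp [rot]
  fin_cases a <;> fin_cases e <;> fin_cases k <;>
    simp [eps, hn, h0, rot_x, Fin.sum_univ_three, perm] at *

lemma rot_hess0 (k : Fin 3) (f : A) (a b : Fin 3) :
    S.rot k (S.hess0 f a b) = S.hess0 (S.rot k f) a b +
      ∑ c, perm a k c * S.hess0 f c b + ∑ c, perm b k c * S.hess0 f a c := by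
  have hδ : S.rot k (if a = b then 1 else 0) = 0 := by
    simp only [rot]; split_ifs <;> simp
  have hdd : S.rot k (S.d a (S.d b f)) = S.d a (S.d b (S.rot k f)) +
      ∑ c, perm b k c * S.d a (S.d c f) + ∑ c, perm a k c * S.d c (S.d b f) := by
    rw [rot_d, rot_d]
    simp [Derivation.leibniz, d_perm]
  have e1 : ∑ c, perm a k c * (if c = b then 1 else 0) = (perm a k b : A) := by simp
  have e2 : ∑ c, perm b k c * (if a = c then 1 else 0) = (perm b k a : A) := by simp
  have e3 := perm_swap (A := A) a k b
  rw [hess0, rot_sub, rot_mul, rot_two, rot_add, hdd, rot_mul, rot_mul, rot_x, rot_d, rot_sub, hδ,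
    rot_mul, rot_x, rot_x, lap_rot]
  simp only [hess0]
  simp only [Fin.sum_univ_three] at *
  linear_combination S.lap f * (e1 + e2 + e3)

/-- A rotation preserves metric and volume form, so the Lie derivative of a tensor with potentials
has the rotated potentials. The two sums are the index terms by which the Lie derivative differs
from the derivative of components. -/
lemma rot_pot (k : Fin 3) (f g : A) (a b : Fin 3) :
    S.rot k (S.pot f g a b) = S.pot (S.rot k f) (S.rot k g) a b +
      ∑ c, perm a k c * S.pot f g c b + ∑ c, perm b k c * S.pot f g a c := by
  have hs : S.rot k (S.star (S.hess0 g) a b) = S.star (S.hess0 (S.rot k g)) a b +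
      ∑ c, perm a k c * S.star (S.hess0 g) c b + ∑ c, perm b k c * S.star (S.hess0 g) a c := by
    simp only [star, Fin.sum_univ_three, rot_add, rot_mul, rot_hess0, rot_eps]
    fin_cases k <;> simp [perm] <;> ring
  simp only [pot, rot_add, hs, rot_hess0, mul_add, Finset.sum_add_distrib]
  ring

end SphereCalculus

/-! ### The flux of the angular momentum aspect and its curl term -/

namespace SphereCalculus

variable {A : Type*} [CommRing A] [Algebra ℝ A] {S : SphereCalculus A}

variable (S) in
/-- The exterior derivative of a tangential one-form. -/
def curl (η : Fin 3 → A) (i j : Fin 3) : A :=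
  S.d i (η j) - S.x i * η j - (S.d j (η i) - S.x j * η i)

variable (S) in
/-- Four times the time derivative of the angular momentum aspect, up to normal components. -/
def evol (m : A) (C N : Fin 3 → Fin 3 → A) (i : Fin 3) : A :=
  4 * S.d i m + 2 * S.d i (dot C N) + ∑ j, C i j * S.dv N j + ∑ j, N i j * S.dv C j -
    ∑ j, ∑ l, N j l * S.d i (C j l) - 2 * ∑ j, S.d j (∑ l, C j l * N l i) +
    ∑ j, (S.d j (S.curl (S.dv C) i j) - 2 * S.x j * S.curl (S.dv C) i j)

variable (S) in
/-- The part of `evol` that contributes to the evolution of the charges. -/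
def flux (m : A) (C N : Fin 3 → Fin 3 → A) (i : Fin 3) : A :=
  S.evol m C N i - ∑ j, C i j * S.dv N j - ∑ j, N i j * S.dv C j

section Integral

variable {I : A →ₗ[ℝ] ℝ} (hI : ∀ a f, I (S.d a f) = 2 * I (S.x a * f))
include hI

/-- The subtracted `2 * x j * F i j` absorbs the right-hand side of `hI`, so no tangency of `F` is
needed. -/
lemma integral_parts (Y : Fin 3 → A) (F : Fin 3 → Fin 3 → A) :
    I (∑ i, Y i * ∑ j, (S.d j (F i j) - 2 * S.x j * F i j)) =
      -I (∑ i, ∑ j, S.d j (Y i) * F i j) := by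
  have h : ∀ i j, I (Y i * (S.d j (F i j) - 2 * S.x j * F i j)) = -I (S.d j (Y i) * F i j) := by
    intro i j
    have h1 := hI j (Y i * F i j)
    rw [Derivation.leibniz, smul_eq_mul, smul_eq_mul, map_add] at h1
    have h2 : Y i * (S.d j (F i j) - 2 * S.x j * F i j) =
      Y i * S.d j (F i j) - 2 * (S.x j * (Y i * F i j)) := by ring
    rw [h2, map_sub, integral_two_mul, mul_comm (S.d j (Y i))]
    linarith
  simp only [Finset.mul_sum, map_sum, h, Finset.sum_neg_distrib]

lemma integral_parts_tangent (Y : Fin 3 → A) (P : Fin 3 → Fin 3 → A)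
    (h : ∀ i, ∑ j, S.x j * P j i = 0) :
    I (∑ i, Y i * ∑ j, S.d j (P j i)) = -I (∑ i, ∑ j, S.d j (Y i) * P j i) := by
  have h1 := integral_parts hI Y fun i j => P j i
  rw [← h1]
  congr 1
  refine Finset.sum_congr rfl fun i _ => ?_
  have := h i
  simp only [Fin.sum_univ_three] at this ⊢
  linear_combination 2 * Y i * this

omit hI in
-- The identity `x · d i v = -v i` for tangential `v` cancels the normal corrections in `curl`,
-- which is therefore tangential.
lemma curl_radial {v : Fin 3 → A} (hv : ∑ b, S.x b * v b = 0) (i : Fin 3) :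
    ∑ j, S.x j * S.curl v i j = 0 := by
  have hd : S.d i (∑ b, S.x b * v b) = 0 := by rw [hv, map_zero]
  have r := S.radial' (v i)
  have h := S.sq'
  simp only [Fin.sum_univ_three, map_add, Derivation.leibniz, smul_eq_mul, S.d_x] at hd hv
  simp only [curl, Fin.sum_univ_three]
  have h2 : v 0 * (if i = 0 then 1 else 0) + v 1 * (if i = 1 then 1 else 0) +
      v 2 * (if i = 2 then 1 else 0) = v i := by fin_cases i <;> simp
  linear_combination hd - r - h2 + v i * h

/-- Two integrations by parts reduce the integral to a multiple of $\int Y\cdot\mathrm{div}\,C$.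
This vanishes because the symmetrized derivative of the Killing field $Y$ has no tangential part. -/
lemma integral_curl_rot (k : Fin 3) {C : Fin 3 → Fin 3 → A} (h : S.IsSTT C) :
    I (∑ i, S.eps i k * ∑ j, (S.d j (S.curl (S.dv C) i j) - 2 * S.x j * S.curl (S.dv C) i j)) =
      0 := by
  rw [integral_parts hI]
  have hv := h.dv_tangent
  have hc : I (∑ j, S.eps j k * S.dv C j) = 0 := by
    have := integral_parts_tangent hI (fun j => S.eps j k) C fun j => by
      have := h.tangent j
      simpa only [h.symm, mul_comm] using this
    simp only [dv]
    rw [this]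
    have t := h.tangent'
    have t0 := t 0
    have t1 := t 1
    have t2 := t 2
    have s01 := h.symm 1 0
    have s02 := h.symm 2 0
    have s12 := h.symm 2 1
    have : ∑ i, ∑ j, S.d j (S.eps i k) * C j i = 0 := by
      simp only [d_eps, Fin.sum_univ_three, s01, s02, s12] at *
      have : ∀ i j : Fin 3, (perm i k j : A) = -perm j k i := fun i j => perm_swap i k j
      have hz : ∀ i : Fin 3, (perm i k i : A) = 0 := fun i => by
        fin_cases i <;> fin_cases k <;> simp [perm]
      rw [hz, hz, hz, this 1 0, this 2 0, this 2 1]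
      linear_combination -S.eps 0 k * t0 - S.eps 1 k * t1 - S.eps 2 k * t2
    rw [this, map_zero, neg_zero]
  generalize S.dv C = v at *
  have c0 := curl_radial hv 0
  have c1 := curl_radial hv 1
  have c2 := curl_radial hv 2
  have e : ∑ i, ∑ j, S.d j (S.eps i k) * S.curl v i j =
      2 * ∑ i, ∑ j, perm i k j * (S.d i (v j) - S.x i * v j) := by
    simp only [Fin.sum_univ_three] at c0 c1 c2
    have : ∑ i, ∑ j, S.d j (S.eps i k) * S.curl v i j =
        ∑ i, ∑ j, perm i k j * S.curl v i j := by
      simp only [d_eps, Fin.sum_univ_three]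
      linear_combination -S.eps 0 k * c0 - S.eps 1 k * c1 - S.eps 2 k * c2
    rw [this]
    simp only [curl, Fin.sum_univ_three]
    fin_cases k <;> simp [perm] <;> ring
  have hp : ∀ i j, I (perm i k j * (S.d i (v j) - S.x i * v j)) =
      I (perm i k j * (S.x i * v j)) := fun i j => by
    have h1 := hI i (perm i k j * v j)
    rw [Derivation.leibniz, d_perm, smul_zero, add_zero, smul_eq_mul] at h1
    rw [mul_sub, map_sub, h1, mul_left_comm (S.x i)]
    ring
  rw [e, integral_two_mul]
  simp only [map_sum, hp]
  simp only [← map_sum]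
  have : ∑ i, ∑ j, perm i k j * (S.x i * v j) = -∑ j, S.eps j k * v j := by
    simp only [Fin.sum_univ_three]
    fin_cases k <;> simp [perm, eps]
  rw [this, map_neg, hc]
  simp

/-- After one integration by parts an antisymmetric tensor meets the Hessian of a coordinate
function, whose only failure to be symmetric in components is normal. -/
lemma integral_curl_grad (k : Fin 3) {C : Fin 3 → Fin 3 → A} (h : S.IsSTT C) :
    I (∑ i, S.d i (S.x k) *
      ∑ j, (S.d j (S.curl (S.dv C) i j) - 2 * S.x j * S.curl (S.dv C) i j)) = 0 := by
  rw [integral_parts hI]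
  have hv := h.dv_tangent
  generalize S.dv C = v at *
  have c0 := curl_radial hv 0
  have c1 := curl_radial hv 1
  have c2 := curl_radial hv 2
  have c01 := S.comm 0 1 (S.x k)
  have c02 := S.comm 0 2 (S.x k)
  have c12 := S.comm 1 2 (S.x k)
  have : ∑ i, ∑ j, S.d j (S.d i (S.x k)) * S.curl v i j = 0 := by
    have as : ∀ i j, S.curl v i j = -S.curl v j i := fun i j => by simp only [curl]; ring
    have az : ∀ i, S.curl v i i = 0 := fun i => by simp only [curl]; ring
    simp only [Fin.sum_univ_three, az, as 1 0, as 2 0, as 2 1] at *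
    linear_combination (-S.curl v 0 1) * c01 + (-S.curl v 0 2) * c02 - S.curl v 1 2 * c12 +
      S.d 0 (S.x k) * c0 + S.d 1 (S.x k) * c1 + S.d 2 (S.x k) * c2
  rw [this, map_zero, neg_zero]

end Integral

end SphereCalculus

/-! ### The flux integrals in terms of the potentials -/

namespace SphereCalculus

variable {A : Type*} [CommRing A] [Algebra ℝ A] {S : SphereCalculus A}

lemma dot_two_mul {M N P Q : Fin 3 → Fin 3 → A} (hM : ∀ a b, 2 * M a b = P a b)
    (hN : ∀ a b, 2 * N a b = Q a b) : 4 * dot M N = dot P Q := by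
  simp only [dot, Fin.sum_univ_three, ← hM, ← hN]
  ring

/-- The Hessian of a coordinate function is $-\tilde X^k\sigma$; the last term is the normal
correction. -/
lemma d_d_x (a b k : Fin 3) : S.d a (S.d b (S.x k)) =
    -((if a = b then 1 else 0) - S.x a * S.x b) * S.x k - S.x b * S.d a (S.x k) := by
  rw [S.d_x b k]
  have : S.d a (if b = k then 1 else 0) = 0 := by split_ifs <;> simp
  rw [map_sub, this, Derivation.leibniz, S.d_x a b]
  simp only [smul_eq_mul]
  ring

section Integral

variable {I : A →ₗ[ℝ] ℝ}

lemma integral_four_mul (f : A) : I (4 * f) = 4 * I f := by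
  have : (4 : A) * f = 2 * (2 * f) := by ring
  rw [this, integral_two_mul, integral_two_mul]
  ring

variable (hI : ∀ a f, I (S.d a f) = 2 * I (S.x a * f))
include hI

lemma integral_rot (k : Fin 3) (f : A) : I (S.rot k f) = 0 := by
  have h := integral_rot_antisymm hI k 1 f
  have h1 : S.rot k 1 = 0 := by simp [rot]
  rwa [h1, mul_zero, map_zero, neg_zero, one_mul] at h

/-- Green's identity with the eigenvalue `-2` of the coordinate functions. -/
lemma integral_grad_x_grad (k : Fin 3) (f : A) :
    I (∑ i, S.d i (S.x k) * S.d i f) = 2 * I (S.x k * f) := by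
  have h := integral_grad_x hI k f 1
  have h1 : S.lap 1 = 0 := by simp [lap]
  have h2 := integral_lap_symm hI (S.x k) f
  rw [lap_x, ← integral_two_mul] at *
  simp only [h1, one_mul, mul_zero, map_zero, mul_one] at h
  rw [h2] at h
  have h3 : f * (-2 * S.x k) = -(2 * (S.x k * f)) := by ring
  rw [h3, map_neg, integral_two_mul, integral_two_mul] at h
  rw [integral_two_mul]
  linarith

variable {C N : Fin 3 → Fin 3 → A} {c c' n n' : A}

/-- The gradient and curl terms integrate to zero against a rotation field. The remaining terms are
minus the contraction of `N` with the Lie derivative of `C`, whose potentials are given by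
`rot_pot`. -/
lemma integral_eps_flux (k : Fin 3) (m : A) (hC : S.IsSTT C) (hN : S.IsSTT N)
    (hc : ∀ a b, 2 * C a b = S.pot c c' a b) (hn : ∀ a b, 2 * N a b = S.pot n n' a b) :
    2 * I (∑ i, S.eps i k * S.flux m C N i) =
      I (S.x k * S.poisson c (S.lap (S.lap n + 2 * n))) +
      I (S.x k * S.poisson c' (S.lap (S.lap n' + 2 * n'))) := by
  have e : ∑ i, S.eps i k * S.flux m C N i = S.rot k (4 * m + 2 * dot C N) -
      dot N (fun a b => S.rot k (C a b)) -
      2 * ∑ i, S.eps i k * ∑ j, S.d j (∑ l, C j l * N l i) +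
      ∑ i, S.eps i k * ∑ j, (S.d j (S.curl (S.dv C) i j) - 2 * S.x j * S.curl (S.dv C) i j) := by
    have h2 : S.rot k (4 * m + 2 * dot C N) = 4 * S.rot k m + 2 * S.rot k (dot C N) := by
      have h4 : (4 : A) * m = 2 * (2 * m) := by ring
      rw [h4, rot_add, rot_mul, rot_mul, rot_mul, rot_two]
      ring
    have h3 : dot N (fun a b => S.rot k (C a b)) =
        ∑ i, S.eps i k * ∑ j, ∑ l, N j l * S.d i (C j l) := by
      simp only [dot, rot, Fin.sum_univ_three]
      ring
    rw [h2, h3]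
    generalize hp : dot C N = p
    simp only [flux, evol, rot, hp, Fin.sum_univ_three]
    ring
  have hx : ∀ i, ∑ j, S.x j * ∑ l, C j l * N l i = 0 := fun i => by
    have t0 := hC.tangent' 0
    have t1 := hC.tangent' 1
    have t2 := hC.tangent' 2
    simp only [Fin.sum_univ_three, hC.symm 1 0, hC.symm 2 0, hC.symm 2 1] at *
    linear_combination N 0 i * t0 + N 1 i * t1 + N 2 i * t2
  have hp := integral_parts_tangent hI (fun i => S.eps i k) _ hx
  have hp2 : ∑ i, ∑ j, S.d j (S.eps i k) * ∑ l, C j l * N l i =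
      ∑ i, ∑ j, perm i k j * ∑ l, C j l * N l i := by
    have x0 := hx 0
    have x1 := hx 1
    have x2 := hx 2
    simp only [d_eps]
    generalize (fun i j => ∑ l, C j l * N l i) = P at *
    simp only [Fin.sum_univ_three] at *
    linear_combination -S.eps 0 k * x0 - S.eps 1 k * x1 - S.eps 2 k * x2
  -- The bracket is the contraction of `N` with the Lie derivative of `C` along the rotation. The
  -- factor `4` appears because both tensors are half of a `pot`.
  have h4 : 4 * (dot N (fun a b => S.rot k (C a b)) -
      2 * ∑ i, ∑ j, perm i k j * ∑ l, C j l * N l i) =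
      dot (S.pot n n') (S.pot (S.rot k c) (S.rot k c')) := by
    have hr : ∀ a b, S.pot (S.rot k c) (S.rot k c') a b = 2 * (S.rot k (C a b) -
        ∑ c, perm a k c * C c b - ∑ c, perm b k c * C a c) := fun a b => by
      have := S.rot_pot k c c' a b
      simp only [← hc, rot_mul, rot_two] at this
      simp only [Fin.sum_univ_three] at *
      linear_combination -this
    simp only [dot, hr, ← hn]
    simp only [Fin.sum_univ_three, hC.symm 1 0, hC.symm 2 0, hC.symm 2 1, hN.symm 1 0,
      hN.symm 2 0, hN.symm 2 1]
    ring
  have h5 := congrArg I h4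
  rw [integral_four_mul, map_sub, integral_two_mul, integral_dot_pot hI] at h5
  rw [e, map_add, map_sub, map_sub, integral_rot hI, integral_curl_rot hI k hC, integral_two_mul,
    hp, hp2, integral_x_poisson hI, integral_x_poisson hI, mul_comm (S.lap (_ + _)),
    mul_comm (S.lap (_ + _))]
  linarith

/-- The terms $\int\tilde X\,C\cdot N$ cancel: three gradients of $C\cdot N$ give `6`, the
divergence of the product $CN$ gives `-4`, and moving the derivative off `C` gives `-2`. What
remains is $\int\tilde X(N\cdot\Delta C-C\cdot\Delta N)$. -/
lemma integral_grad_flux (k : Fin 3) (m : A) (hC : S.IsSTT C) (hN : S.IsSTT N)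
    (hc : ∀ a b, 2 * C a b = S.pot c c' a b) (hn : ∀ a b, 2 * N a b = S.pot n n' a b) :
    2 * I (∑ i, S.d i (S.x k) * (2 * S.flux m C N i - 8 * S.d i m - S.d i (dot C N))) =
      I (S.x k * ((S.lap n + 2 * n) * S.lap (S.lap c + 2 * c))) -
      I (S.x k * ((S.lap c + 2 * c) * S.lap (S.lap n + 2 * n))) +
      I (S.x k * ((S.lap n' + 2 * n') * S.lap (S.lap c' + 2 * c'))) -
      I (S.x k * ((S.lap c' + 2 * c') * S.lap (S.lap n' + 2 * n'))) := by
  have e : ∑ i, S.d i (S.x k) * (2 * S.flux m C N i - 8 * S.d i m - S.d i (dot C N)) =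
      ∑ i, S.d i (S.x k) * S.d i (dot C N) + 2 * ∑ i, S.d i (S.x k) * S.d i (dot C N) -
      2 * dot N (fun a b => ∑ i, S.d i (S.x k) * S.d i (C a b)) -
      4 * ∑ i, S.d i (S.x k) * ∑ j, S.d j (∑ l, C j l * N l i) +
      2 * ∑ i, S.d i (S.x k) *
        ∑ j, (S.d j (S.curl (S.dv C) i j) - 2 * S.x j * S.curl (S.dv C) i j) := by
    have h3 : dot N (fun a b => ∑ i, S.d i (S.x k) * S.d i (C a b)) =
        ∑ i, S.d i (S.x k) * ∑ j, ∑ l, N j l * S.d i (C j l) := by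
      simp only [dot, Fin.sum_univ_three]
      ring
    rw [h3]
    generalize hp : dot C N = p
    generalize hX : (fun i => S.d i (S.x k)) = X
    have hX' : ∀ i, S.d i (S.x k) = X i := fun i => congrFun hX i
    simp only [flux, evol, hX', hp, Fin.sum_univ_three]
    ring
  have hx : ∀ i, ∑ j, S.x j * ∑ l, C j l * N l i = 0 := fun i => by
    have t0 := hC.tangent' 0
    have t1 := hC.tangent' 1
    have t2 := hC.tangent' 2
    simp only [Fin.sum_univ_three, hC.symm 1 0, hC.symm 2 0, hC.symm 2 1] at *
    linear_combination N 0 i * t0 + N 1 i * t1 + N 2 i * t2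
  have hp := integral_parts_tangent hI (fun i => S.d i (S.x k)) _ hx
  have hp2 : ∑ i, ∑ j, S.d j (S.d i (S.x k)) * ∑ l, C j l * N l i = -(S.x k * dot C N) := by
    have x0 := hx 0
    have x1 := hx 1
    have x2 := hx 2
    have hd : dot C N = ∑ i, ∑ l, C i l * N l i := by
      simp only [dot, Fin.sum_univ_three, hN.symm 1 0, hN.symm 2 0, hN.symm 2 1]
    have ht : ∀ j, ∑ i, S.x i * ∑ l, C j l * N l i = 0 := fun j => by
      have t0 := hN.tangent' 0
      have t1 := hN.tangent' 1
      have t2 := hN.tangent' 2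
      simp only [Fin.sum_univ_three] at *
      linear_combination C j 0 * t0 + C j 1 * t1 + C j 2 * t2
    have y0 := ht 0
    have y1 := ht 1
    have y2 := ht 2
    simp only [d_d_x, hd]
    generalize S.d 0 (S.x k) = X0
    generalize (fun i j => ∑ l, C j l * N l i) = P at *
    generalize hX : (fun i => S.d i (S.x k)) = X
    have hX' : ∀ i, S.d i (S.x k) = X i := fun i => congrFun hX i
    simp only [Fin.sum_univ_three, hX'] at *
    simp
    linear_combination S.x k * (S.x 0 * x0 + S.x 1 * x1 + S.x 2 * x2) -
      (X 0 * y0 + X 1 * y1 + X 2 * y2)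
  -- `integral_grad_x` is applied to each ambient component as a scalar function.
  have h4 : ∀ M Q : Fin 3 → Fin 3 → A,
      2 * I (dot M fun a b => ∑ i, S.d i (S.x k) * S.d i (Q a b)) =
      I (S.x k * dot Q (fun a b => S.lap (M a b))) - I (S.x k * dot M (fun a b => S.lap (Q a b))) +
      2 * I (S.x k * dot Q M) := fun M Q => by
    simp only [dot, Finset.mul_sum (a := S.x k), map_sum]
    simp only [Finset.mul_sum (R := ℝ), ← Finset.sum_sub_distrib, ← Finset.sum_add_distrib]
    exact Finset.sum_congr rfl fun a _ => Finset.sum_congr rfl fun b _ =>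
      integral_grad_x hI k _ _
  have h5 : 4 * dot N (fun a b => ∑ i, S.d i (S.x k) * S.d i (C a b)) =
      dot (S.pot n n') (fun a b => ∑ i, S.d i (S.x k) * S.d i (S.pot c c' a b)) :=
    dot_two_mul hn fun a b => by
      rw [← hc]
      have h2 : ∀ a, S.d a 2 = 0 := fun a => by exact_mod_cast (S.d a).map_natCast 2
      simp only [Derivation.leibniz, h2, smul_eq_mul, mul_zero, add_zero, Fin.sum_univ_three]
      ring
  have h6 := congrArg I h5
  have h7 := h4 (S.pot n n') (S.pot c c')
  have h8 := congrArg (fun t => I (S.x k * t)) (dot_two_mul hc hn)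

  rw [mul_left_comm, integral_four_mul] at h8
  rw [integral_four_mul] at h6
  rw [(pot_isSTT _ _).dot_lap_pot, (pot_isSTT _ _).dot_lap_pot, mul_add, mul_add, map_add, map_add,
    mul_left_comm, integral_two_mul, mul_left_comm, integral_two_mul,
    dot_comm (S.pot n n') (S.pot c c'), integral_x_dot_pot hI k (S.lap n),
    integral_x_dot_pot hI k (S.lap c)] at h7
  -- These four relations cancel the products of electric with magnetic potentials.
  have r1 := integral_lap_rot hI k c n'
  have r2 := integral_lap_rot hI k c' n
  have r3 := integral_rot_antisymm hI k (S.lap n') (S.lap c + 2 * c)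
  have r4 := integral_rot_antisymm hI k (S.lap n) (S.lap c' + 2 * c')
  simp only [← lap_two_mul, ← lap_add] at h7
  rw [e, map_add, map_sub, map_sub, map_add, integral_two_mul, integral_two_mul, integral_two_mul,
    integral_four_mul, integral_curl_grad hI k hC, hp, hp2, integral_grad_x_grad hI, map_neg]
  simp only [mul_assoc] at h7 ⊢
  linarith

/-- The double divergence pairs to zero with the weight, since the Hessian of a coordinate function
is pure trace. In $\int\tilde X|N|^2$ the two mixed terms agree after use of the symmetry of
$\Delta$ and combine into one bracket. -/
lemma integral_grad_mass (k : Fin 3) (hN : S.IsSTT N) (hn : ∀ a b, 2 * N a b = S.pot n n' a b) :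
    I (∑ i, S.d i (S.x k) * S.d i (2 * ∑ b, S.d b (S.dv N b) - dot N N)) =
      -I (S.x k * ((S.lap n + 2 * n) * (S.lap n + 2 * n))) -
      I (S.x k * ((S.lap n' + 2 * n') * (S.lap n' + 2 * n'))) +
      4 * I (S.x k * S.poisson n (S.lap n' + 2 * n')) := by
  have h1 : I (S.x k * ∑ b, S.d b (S.dv N b)) = 0 := by
    rw [← hN.integral_hess hI]
    have : ∑ a, ∑ b, N a b * S.d a (S.d b (S.x k)) = 0 := by
      have t0 := hN.tangent' 0
      have t1 := hN.tangent' 1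
      have t2 := hN.tangent' 2
      have tr := hN.trace'
      simp only [d_d_x]
      generalize hX : (fun i => S.d i (S.x k)) = X
      have hX' : ∀ i, S.d i (S.x k) = X i := fun i => congrFun hX i
      simp only [Fin.sum_univ_three, hX']
      simp
      linear_combination (-X 0 + S.x k * S.x 0) * t0 + (-X 1 + S.x k * S.x 1) * t1 +
        (-X 2 + S.x k * S.x 2) * t2 - S.x k * tr
    rw [this, map_zero]
  have h2 := congrArg (fun t => I (S.x k * t)) (dot_two_mul hn hn)

  rw [mul_left_comm, integral_four_mul, integral_x_dot_pot hI] at h2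
  have r1 := integral_lap_symm hI n' (S.rot k n)
  have r2 := integral_rot_antisymm hI k (S.lap n) n'
  have r3 := integral_rot_antisymm hI k n n'
  rw [lap_rot] at r2
  have r4 : I ((S.lap n + 2 * n) * S.rot k n') = -I ((S.lap n' + 2 * n') * S.rot k n) := by
    rw [add_mul, add_mul, map_add, map_add, mul_assoc, mul_assoc, integral_two_mul,
      integral_two_mul, mul_comm (S.lap n') (S.rot k n)]
    linarith
  rw [integral_grad_x_grad hI, mul_sub, map_sub, mul_left_comm, integral_two_mul, h1,
    integral_x_poisson hI]
  simp only [mul_assoc] at h2 ⊢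
  linarith

end Integral

end SphereCalculus

/-! ### Ricci curvature of a metric over a ring with derivations -/

section Ricci

variable {A B : Type*} [CommRing A] [Algebra ℝ A] [CommRing B] [Algebra ℝ B]

/-- Twice the Christoffel symbols of the first kind. -/
def lowChr (D : Fin 4 → Derivation ℝ A A) (g : Fin 4 → Fin 4 → A) (κ μ ν : Fin 4) : A :=
  D μ (g κ ν) + D ν (g κ μ) - D κ (g μ ν)

/-- Twice the Christoffel symbols of the metric `g` with inverse `gi`. -/
def twoChr (D : Fin 4 → Derivation ℝ A A) (g gi : Fin 4 → Fin 4 → A) (l μ ν : Fin 4) : A :=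
  ∑ κ, gi l κ * lowChr D g κ μ ν

/-- Four times the Ricci tensor. -/
def fourRicci (D : Fin 4 → Derivation ℝ A A) (g gi : Fin 4 → Fin 4 → A) (μ ν : Fin 4) : A :=
  2 * (∑ l, D l (twoChr D g gi l μ ν) - D ν (∑ l, twoChr D g gi l l μ)) +
    ((∑ κ, (∑ l, twoChr D g gi l l κ) * twoChr D g gi κ μ ν) -
      ∑ l, ∑ κ, twoChr D g gi l ν κ * twoChr D g gi κ l μ)

lemma map_twoChr {D : Fin 4 → Derivation ℝ A A} {D' : Fin 4 → Derivation ℝ B B} (φ : A →+* B)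
    (hφ : ∀ μ f, φ (D μ f) = D' μ (φ f)) (g gi : Fin 4 → Fin 4 → A) (l μ ν : Fin 4) :
    φ (twoChr D g gi l μ ν) =
      twoChr D' (fun a b => φ (g a b)) (fun a b => φ (gi a b)) l μ ν := by
  simp [twoChr, lowChr, hφ]

lemma map_fourRicci {D : Fin 4 → Derivation ℝ A A} {D' : Fin 4 → Derivation ℝ B B} (φ : A →+* B)
    (hφ : ∀ μ f, φ (D μ f) = D' μ (φ f)) (g gi : Fin 4 → Fin 4 → A) (μ ν : Fin 4) :
    φ (fourRicci D g gi μ ν) =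
      fourRicci D' (fun a b => φ (g a b)) (fun a b => φ (gi a b)) μ ν := by
  simp only [fourRicci, map_add, map_sub, map_mul, map_sum, hφ, map_twoChr φ hφ, map_ofNat]

end Ricci

/-! ### Calculus near null infinity -/

/-- A ring of functions of the retarded time, of `rho = 1 / r` and of the point `x` of the sphere,
with the derivative `T` in the retarded time and `r` times the spatial derivatives `d`. -/
structure ScriCalculus (A : Type*) [CommRing A] [Algebra ℝ A] where
  x : Fin 3 → A
  rho : A
  T : Derivation ℝ A A
  d : Fin 3 → Derivation ℝ A A
  sum_sq : ∑ a, x a * x a = 1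
  d_x : ∀ a b, d a (x b) = (if a = b then 1 else 0) - x a * x b
  T_x : ∀ a, T (x a) = 0
  T_rho : T rho = 0
  d_rho : ∀ a, d a rho = -(rho * x a)
  T_d : ∀ a f, T (d a f) = d a (T f)

namespace ScriCalculus

variable {A : Type*} [CommRing A] [Algebra ℝ A] (S : ScriCalculus A)

/-- The round metric. -/
def sig (a b : Fin 3) : A := (if a = b then 1 else 0) - S.x a * S.x b

/-- The coordinate derivatives. -/
def D : Fin 4 → Derivation ℝ A A := Fin.cons S.T fun i => S.rho • S.d i

variable {S}

lemma d_x' (a b : Fin 3) : S.d a (S.x b) = S.sig a b := S.d_x a b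

lemma sig_symm (a b : Fin 3) : S.sig a b = S.sig b a := by
  simp only [sig, eq_comm (a := a), mul_comm]

lemma sum_sig_mul (a : Fin 3) (v : Fin 3 → A) :
    ∑ b, S.sig a b * v b = v a - S.x a * ∑ b, S.x b * v b := by
  simp [sig, sub_mul, Finset.sum_sub_distrib, Finset.mul_sum, mul_assoc]

lemma sum_sig_mul_of_tangent (a : Fin 3) {v : Fin 3 → A} (hv : ∑ b, S.x b * v b = 0) :
    ∑ b, S.sig a b * v b = v a := by
  rw [sum_sig_mul, hv, mul_zero, sub_zero]

lemma sum_sig_x (a : Fin 3) : ∑ b, S.sig a b * S.x b = 0 := by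
  rw [sum_sig_mul, S.sum_sq, mul_one, sub_self]

lemma d_sig (a b c : Fin 3) :
    S.d a (S.sig b c) = -(S.sig a b * S.x c) - S.x b * S.sig a c := by
  have : S.d a (if b = c then 1 else 0) = 0 := by split_ifs <;> simp
  rw [sig, map_sub, this, Derivation.leibniz, d_x', d_x', smul_eq_mul, smul_eq_mul]
  ring

@[simp] lemma D_zero (f : A) : S.D 0 f = S.T f := rfl

@[simp] lemma D_succ (i : Fin 3) (f : A) : S.D i.succ f = S.rho * S.d i f := rfl

/-- Contraction of the derivatives of a tangential vector field with the normal. -/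
lemma sum_x_d (i : Fin 3) {v : Fin 3 → A} (hv : ∑ j, S.x j * v j = 0) :
    ∑ j, S.x j * S.d i (v j) = -v i := by
  have h : S.d i (∑ j, S.x j * v j) = 0 := by rw [hv, map_zero]
  have h2 := sum_sig_mul_of_tangent i hv
  simp only [Fin.sum_univ_three, map_add, Derivation.leibniz, smul_eq_mul, d_x'] at h h2 ⊢
  linear_combination h - h2

lemma sum_x_T {v : Fin 3 → A} (hv : ∑ j, S.x j * v j = 0) : ∑ j, S.x j * S.T (v j) = 0 := by
  have h : S.T (∑ j, S.x j * v j) = 0 := by rw [hv, map_zero]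
  simpa only [map_sum, Derivation.leibniz, smul_eq_mul, S.T_x, mul_zero, add_zero] using h

variable (S) in
/-- The coefficients of a metric in Bondi-Sachs coordinates: `P` is the inverse of `U`, `w` and `k`
are obtained from `W` is `r` times the shift and `h` by lowering and raising indices. -/
structure Bondi where
  U : A
  P : A
  V : A
  W : Fin 3 → A
  w : Fin 3 → A
  h : Fin 3 → Fin 3 → A
  k : Fin 3 → Fin 3 → A
  U_P : U * P = 1
  x_W : ∑ i, S.x i * W i = 0
  w_eq : ∀ i, w i = ∑ j, h i j * W j
  h_symm : ∀ i j, h i j = h j i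
  x_h : ∀ j, ∑ i, S.x i * h i j = 0
  k_symm : ∀ i j, k i j = k j i
  x_k : ∀ j, ∑ i, S.x i * k i j = 0
  k_h : ∀ i l, ∑ j, k i j * h j l = S.sig i l
  k_T_h : ∑ i, ∑ j, k i j * S.T (h i j) = 0
  k_d_h : ∀ a, ∑ i, ∑ j, k i j * S.d a (h i j) = 0

/-! ### Inverse metric and Christoffel symbols in Bondi-Sachs gauge -/

namespace Bondi

variable (B : S.Bondi)

/-- The `uu` component of the metric. -/
def g00 : A := -(B.U * B.V) + ∑ i, B.w i * B.W i

/-- The mixed components of the metric. -/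
def b (i : Fin 3) : A := -B.U * S.x i + B.w i

/-- The metric. -/
def met : Fin 4 → Fin 4 → A :=
  Fin.cons (Fin.cons B.g00 B.b) fun i => Fin.cons (B.b i) (B.h i)

/-- The inverse metric. -/
def inv : Fin 4 → Fin 4 → A :=
  Fin.cons (Fin.cons 0 fun i => -(B.P * S.x i)) fun i => Fin.cons (-(B.P * S.x i)) fun j =>
    B.P * B.V * S.x i * S.x j + B.k i j + B.P * (S.x i * B.W j + B.W i * S.x j)

/-- Twice the Christoffel symbols of the first kind. -/
abbrev low : Fin 4 → Fin 4 → Fin 4 → A := lowChr S.D B.met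

/-- Twice the Christoffel symbols. -/
abbrev chr : Fin 4 → Fin 4 → Fin 4 → A := twoChr S.D B.met B.inv

lemma met_zero_zero : B.met 0 0 = B.g00 := rfl
lemma met_zero_succ (i : Fin 3) : B.met 0 i.succ = B.b i := rfl
lemma met_succ_zero (i : Fin 3) : B.met i.succ 0 = B.b i := rfl
lemma met_succ_succ (i j : Fin 3) : B.met i.succ j.succ = B.h i j := rfl
lemma inv_zero_zero : B.inv 0 0 = 0 := rfl
lemma inv_zero_succ (i : Fin 3) : B.inv 0 i.succ = -(B.P * S.x i) := rfl
lemma inv_succ_zero (i : Fin 3) : B.inv i.succ 0 = -(B.P * S.x i) := rfl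
lemma inv_succ_succ (i j : Fin 3) : B.inv i.succ j.succ =
    B.P * B.V * S.x i * S.x j + B.k i j + B.P * (S.x i * B.W j + B.W i * S.x j) := rfl

lemma x_w : ∑ i, S.x i * B.w i = 0 := by
  have h := B.x_h
  have h0 := h 0
  have h1 := h 1
  have h2 := h 2
  simp only [w_eq, Fin.sum_univ_three] at *
  linear_combination B.W 0 * h0 + B.W 1 * h1 + B.W 2 * h2

lemma x_b : ∑ i, S.x i * B.b i = -B.U := by
  have h := B.x_w
  have h2 := S.sum_sq
  simp only [b, Fin.sum_univ_three] at *
  linear_combination h - B.U * h2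

lemma k_w (i : Fin 3) : ∑ j, B.k i j * B.w j = B.W i := by
  have h := sum_sig_mul_of_tangent i B.x_W
  have h0 := B.k_h i 0
  have h1 := B.k_h i 1
  have h2 := B.k_h i 2
  simp only [w_eq, Fin.sum_univ_three] at *
  linear_combination h + B.W 0 * h0 + B.W 1 * h1 + B.W 2 * h2

lemma k_x (i : Fin 3) : ∑ j, B.k i j * S.x j = 0 := by
  simpa only [mul_comm, B.k_symm] using B.x_k i

lemma met_symm (μ ν : Fin 4) : B.met μ ν = B.met ν μ := by
  refine Fin.cases ?_ (fun i => ?_) μ <;> refine Fin.cases ?_ (fun j => ?_) ν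
  · rfl
  · rfl
  · rfl
  · exact B.h_symm i j

lemma chr_symm (l μ ν : Fin 4) : B.chr l μ ν = B.chr l ν μ := by
  simp only [twoChr, lowChr, B.met_symm μ ν]
  exact Finset.sum_congr rfl fun κ _ => by ring

lemma inv_mul_met (μ ν : Fin 4) : ∑ κ, B.inv μ κ * B.met κ ν = if μ = ν then 1 else 0 := by
  have hb := B.x_b
  have hw := B.x_w
  have hU := B.U_P
  refine Fin.cases ?_ (fun i => ?_) μ <;> refine Fin.cases ?_ (fun j => ?_) ν
  · rw [Fin.sum_univ_succ]
    simp only [inv_zero_zero, inv_zero_succ, met_zero_zero, met_succ_zero, Fin.sum_univ_three,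
      if_true] at *
    linear_combination hU - B.P * hb
  · have h := B.x_h j
    rw [Fin.sum_univ_succ]
    simp only [inv_zero_zero, inv_zero_succ, met_zero_succ, met_succ_succ, Fin.sum_univ_three,
      (Fin.succ_ne_zero j).symm, if_false] at *
    linear_combination -B.P * h
  · have h := B.k_w i
    have h2 := B.k_x i
    have h3 := S.sum_sq
    rw [Fin.sum_univ_succ]
    simp only [inv_succ_zero, inv_succ_succ, met_zero_zero, met_succ_zero, g00,
      b, Fin.sum_univ_three, Fin.succ_ne_zero i, if_false] at *
    have hW := B.x_W
    simp only [Fin.sum_univ_three] at hW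
    linear_combination h - B.U * h2 + (B.P * B.V * S.x i + B.P * B.W i) * hb +
      (-B.U * B.P * S.x i) * hW + (- B.W i) * hU
  · have h := B.x_h j
    have h1 := B.k_h i j
    have h2 := B.w_eq j
    have hs := B.h_symm
    rw [Fin.sum_univ_succ]
    simp only [inv_succ_zero, inv_succ_succ, met_zero_succ, met_succ_succ, b, sig,
      Fin.sum_univ_three, Fin.succ_inj, hs j] at *
    linear_combination h1 + (B.P * B.V * S.x i + B.P * B.W i) * h - B.P * S.x i * h2 +
      S.x i * S.x j * hU

/-- The differential of the retarded time is null with radial gradient, so raising to index `0` sees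
only radial components. -/
lemma chr_zero (μ ν : Fin 4) : B.chr 0 μ ν = -(B.P * ∑ i, S.x i * B.low i.succ μ ν) := by
  rw [chr, twoChr, Fin.sum_univ_succ]
  simp only [inv_zero_zero, inv_zero_succ, Fin.sum_univ_three]
  ring

/-- Splits off the radial part, the multiple of `x j`, which later drops out of contractions with
tangential tensors. -/
lemma chr_succ (j : Fin 3) (μ ν : Fin 4) : B.chr j.succ μ ν =
    ∑ l, B.k j l * B.low l.succ μ ν - B.W j * B.chr 0 μ ν +
    S.x j * (-(B.P * B.low 0 μ ν) - B.V * B.chr 0 μ ν +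
      B.P * ∑ l, B.W l * B.low l.succ μ ν) := by
  rw [chr_zero, chr, twoChr, Fin.sum_univ_succ]
  simp only [inv_succ_zero, inv_succ_succ, Fin.sum_univ_three]
  ring

lemma x_T_b : ∑ i, S.x i * S.T (B.b i) = -S.T B.U := by
  have h : S.T (∑ i, S.x i * B.b i) = S.T (-B.U) := by rw [B.x_b]
  simpa only [map_sum, map_neg, Derivation.leibniz, smul_eq_mul, S.T_x, mul_zero, add_zero] using h

lemma chr_zero_zero_zero :
    B.chr 0 0 0 = B.P * (2 * S.T B.U + S.rho * ∑ i, S.x i * S.d i B.g00) := by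
  have h := B.x_T_b
  rw [chr_zero]
  simp only [low, lowChr, met_succ_zero, met_zero_zero, D_zero, D_succ, Fin.sum_univ_three] at *
  linear_combination -2 * B.P * h

lemma sum_x_d_b (i : Fin 3) : ∑ j, S.x j * S.d i (B.b j) = -S.d i B.U - B.w i := by
  have h := sum_x_d i B.x_w
  have h2 := S.sum_sq
  have h3 := S.sum_sig_x i
  simp only [b, map_add, Derivation.leibniz, d_x', map_neg, smul_eq_mul, Fin.sum_univ_three] at *
  linear_combination h - S.d i B.U * h2 - B.U * h3

lemma chr_zero_zero_succ (i : Fin 3) : B.chr 0 0 i.succ = B.P * S.rho *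
    (S.d i B.U + B.w i - S.x i * ∑ j, S.x j * S.d j B.U + ∑ j, S.x j * S.d j (B.w i)) := by
  have h := B.sum_x_d_b i
  have h2 := sum_x_T (B.x_h i)
  have h3 := S.sum_sig_x i
  rw [chr_zero]
  simp only [low, lowChr, met_succ_zero, met_zero_succ, met_succ_succ, D_zero, D_succ,
    Fin.sum_univ_three, sig_symm i] at *
  have h4 : ∀ j, S.d j (B.b i) = -(S.d j B.U * S.x i) - B.U * S.sig j i + S.d j (B.w i) :=
    fun j => by
      simp only [b, map_add, Derivation.leibniz, d_x', map_neg, smul_eq_mul]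
      ring
  simp only [h4]
  linear_combination -B.P * h2 - B.P * S.rho * h - B.P * S.rho * B.U * h3

lemma chr_zero_succ_succ (i j : Fin 3) : B.chr 0 i.succ j.succ =
    B.P * S.rho * (2 * B.h i j + ∑ l, S.x l * S.d l (B.h i j)) := by
  have h1 := sum_x_d i (B.x_h j)
  have h2 := sum_x_d j (B.x_h i)
  rw [chr_zero]
  simp only [low, lowChr, met_succ_succ, D_succ, Fin.sum_univ_three, B.h_symm j i] at *
  linear_combination -B.P * S.rho * (h1 + h2)

/-- The trace of the Christoffel symbols is the logarithmic derivative of the volume density, and in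
this gauge the density is `U`; the determinant condition enters as `k_T_h`. -/
lemma chr_trace_zero : ∑ l, B.chr l l 0 = 2 * B.P * S.T B.U := by
  have h := B.x_T_b
  have h0 := sum_x_T (B.x_h 0)
  have h1 := sum_x_T (B.x_h 1)
  have h2 := sum_x_T (B.x_h 2)
  have hk := B.k_T_h
  have k0 := B.k_symm 1 0
  have k1 := B.k_symm 2 0
  have k2 := B.k_symm 2 1
  simp only [chr, twoChr, lowChr, Fin.sum_univ_succ (n := 3), inv_zero_zero, inv_zero_succ,
    inv_succ_zero, inv_succ_succ, met_zero_zero, met_zero_succ, met_succ_zero, met_succ_succ,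
    D_zero, D_succ, Fin.sum_univ_three,
    k0, k1, k2, B.h_symm 1 0, B.h_symm 2 0, B.h_symm 2 1] at *
  linear_combination -2 * B.P * h + hk +
    B.P * (B.V * S.x 0 + 2 * B.W 0) * h0 + B.P * (B.V * S.x 1 + 2 * B.W 1) * h1 +
    B.P * (B.V * S.x 2 + 2 * B.W 2) * h2

lemma chr_trace_succ (i : Fin 3) :
    ∑ l, B.chr l l i.succ = 2 * B.P * (S.rho * S.d i B.U) := by
  have h := B.sum_x_d_b i
  have h0 := sum_x_d i (B.x_h 0)
  have h1 := sum_x_d i (B.x_h 1)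
  have h2 := sum_x_d i (B.x_h 2)
  have hw := B.w_eq i
  have hx := B.x_h i
  have hk := B.k_d_h i
  have k0 := B.k_symm 1 0
  have k1 := B.k_symm 2 0
  have k2 := B.k_symm 2 1
  have hi := B.h_symm i
  simp only [chr, twoChr, lowChr, Fin.sum_univ_succ (n := 3), inv_zero_zero, inv_zero_succ,
    inv_succ_zero, inv_succ_succ, met_zero_zero, met_zero_succ, met_succ_zero, met_succ_succ,
    D_zero, D_succ, Fin.sum_univ_three, k0, k1, k2, hi 0, hi 1, hi 2, B.h_symm 1 0, B.h_symm 2 0,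
    B.h_symm 2 1] at *
  linear_combination S.rho * (-2 * B.P * h + hk +
    B.P * (B.V * S.x 0 + 2 * B.W 0) * h0 + B.P * (B.V * S.x 1 + 2 * B.W 1) * h1 +
    B.P * (B.V * S.x 2 + 2 * B.W 2) * h2 - B.P * B.V * hx + 2 * B.P * hw)

end Bondi

end ScriCalculus

/-! ### Expansion of the Christoffel symbols in powers of `rho` -/

namespace ScriCalculus

variable {A : Type*} [CommRing A] [Algebra ℝ A] {S : ScriCalculus A}

namespace Bondi

/-- The expansion of the metric coefficients in powers of `rho`. -/
structure Expansion (B : S.Bondi) where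
  m : A
  U2 : A
  U3 : A
  V2 : A
  s : A
  C : Fin 3 → Fin 3 → A
  h3 : Fin 3 → Fin 3 → A
  W1 : Fin 3 → A
  W2 : Fin 3 → A
  W3 : Fin 3 → A
  U_eq : B.U = 1 + S.rho ^ 2 * U2 + S.rho ^ 3 * U3
  V_eq : B.V = 1 - 2 * S.rho * m + S.rho ^ 2 * V2
  W_eq : ∀ i, B.W i = S.rho * W1 i + S.rho ^ 2 * W2 i + S.rho ^ 3 * W3 i
  h_eq : ∀ i j, B.h i j = S.sig i j + S.rho * C i j + S.rho ^ 2 * (s * S.sig i j) +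
    S.rho ^ 3 * h3 i j
  C_symm : ∀ i j, C i j = C j i
  x_C : ∀ j, ∑ i, S.x i * C i j = 0
  x_W1 : ∑ i, S.x i * W1 i = 0
  x_W2 : ∑ i, S.x i * W2 i = 0
  radial_m : ∑ i, S.x i * S.d i m = 0
  radial_U2 : ∑ i, S.x i * S.d i U2 = 0
  radial_C : ∀ a b, ∑ i, S.x i * S.d i (C a b) = 0
  radial_W1 : ∀ a, ∑ i, S.x i * S.d i (W1 a) = 0
  radial_W2 : ∀ a, ∑ i, S.x i * S.d i (W2 a) = 0
  two_W1 : ∀ i, 2 * W1 i = ∑ j, S.d j (C j i)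

namespace Expansion

variable {B : S.Bondi} (E : B.Expansion)

/-- The second coefficient of the lowered shift. -/
def w2 (i : Fin 3) : A := E.W2 i + ∑ j, E.C i j * E.W1 j

/-- The exterior derivative of the first coefficient of the shift. -/
def F (i j : Fin 3) : A := S.d i (E.W1 j) - S.x i * E.W1 j - (S.d j (E.W1 i) - S.x j * E.W1 i)

/-- The second coefficient of twice the Christoffel symbols `Γ^j_{0i}`. -/
def H (i j : Fin 3) : A :=
  -2 * S.x j * (S.d i E.m - S.x i * E.m) + S.T E.s * S.sig i j + E.F i j -
    ∑ l, E.C j l * S.T (E.C i l) + S.x j * ∑ l, E.W1 l * S.T (E.C i l)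

lemma d_rho_pow (i : Fin 3) (n : ℕ) (f : A) :
    S.d i (S.rho ^ n * f) = S.rho ^ n * (S.d i f - n * S.x i * f) := by
  rw [Derivation.leibniz, Derivation.leibniz_pow, S.d_rho]
  rcases n with _ | n
  · simp
  · simp only [smul_eq_mul, nsmul_eq_mul, add_tsub_cancel_right, pow_succ]
    ring

lemma d_rho_mul (i : Fin 3) (f : A) :
    S.d i (S.rho * f) = S.rho * (S.d i f - S.x i * f) := by
  simpa using d_rho_pow i 1 f

lemma T_rho_pow (n : ℕ) (f : A) : S.T (S.rho ^ n * f) = S.rho ^ n * S.T f := by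
  rw [Derivation.leibniz, Derivation.leibniz_pow, S.T_rho]
  simp

lemma T_rho_mul (f : A) : S.T (S.rho * f) = S.rho * S.T f := by
  simpa using T_rho_pow 1 f

lemma T_sig (i j : Fin 3) : S.T (S.sig i j) = 0 := by
  have : S.T (if i = j then 1 else 0) = 0 := by split_ifs <;> simp
  rw [sig, map_sub, this, Derivation.leibniz, S.T_x, S.T_x]
  simp

/-- The part of `h` of second order. -/
def h2 (i j : Fin 3) : A := E.s * S.sig i j + S.rho * E.h3 i j

lemma h_eq' (i j : Fin 3) :
    B.h i j = S.sig i j + S.rho * E.C i j + S.rho ^ 2 * E.h2 i j := by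
  rw [E.h_eq, h2]
  ring

/-- The first derivatives of `C` in the Christoffel symbols of the first kind. -/
def c (l j i : Fin 3) : A :=
  S.d j (E.C l i) - S.x j * E.C l i + (S.d i (E.C l j) - S.x i * E.C l j) -
    (S.d l (E.C j i) - S.x l * E.C j i)

lemma d_two (i : Fin 3) (f : A) : S.d i (2 * f) = 2 * S.d i f := by
  rw [two_mul, two_mul, map_add]

lemma T_two (f : A) : S.T (2 * f) = 2 * S.T f := by
  rw [two_mul, two_mul, map_add]

lemma C_x (i : Fin 3) : ∑ j, E.C i j * S.x j = 0 := by
  simpa only [mul_comm, E.C_symm] using E.x_C i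

lemma C_x' (i : Fin 3) : ∑ j, S.x j * E.C i j = 0 := by
  simpa only [E.C_symm i] using E.x_C i

lemma x_w2 : ∑ i, S.x i * E.w2 i = 0 := by
  have h := E.x_W2
  have h0 := E.x_C 0
  have h1 := E.x_C 1
  have h2 := E.x_C 2
  simp only [w2, Fin.sum_univ_three] at *
  linear_combination h + E.W1 0 * h0 + E.W1 1 * h1 + E.W1 2 * h2

lemma radial_w2 (a : Fin 3) : ∑ i, S.x i * S.d i (E.w2 a) = 0 := by
  have h := E.radial_W2 a
  have h0 := E.radial_C a 0
  have h1 := E.radial_C a 1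
  have h2 := E.radial_C a 2
  have k0 := E.radial_W1 0
  have k1 := E.radial_W1 1
  have k2 := E.radial_W1 2
  simp only [w2, Fin.sum_univ_three, map_add, Derivation.leibniz, smul_eq_mul] at *
  linear_combination h + E.W1 0 * h0 + E.W1 1 * h1 + E.W1 2 * h2 + E.C a 0 * k0 + E.C a 1 * k1 +
    E.C a 2 * k2

lemma x_F (i : Fin 3) : ∑ j, S.x j * E.F i j = 0 := by
  have h := sum_x_d i E.x_W1
  have h1 := E.radial_W1 i
  have h2 := E.x_W1
  have h3 := S.sum_sq
  simp only [F, Fin.sum_univ_three] at *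
  linear_combination h - h1 - S.x i * h2 + E.W1 i * h3

lemma F_antisymm (i j : Fin 3) : E.F i j = -E.F j i := by
  simp only [F]
  ring

section Truncated

variable (h4 : S.rho ^ 4 = 0)
include h4

omit E in
-- With `rho ^ 4 = 0` remainders of fourth order vanish literally. Coefficients that never matter
-- are hidden in the existential `K`, `Z`, `q` of the lemmas that follow.
lemma rho_pow : S.rho ^ 5 = 0 ∧ S.rho ^ 6 = 0 ∧ S.rho ^ 7 = 0 ∧ S.rho ^ 8 = 0 ∧
    S.rho ^ 9 = 0 := by
  have : ∀ n, S.rho ^ (4 + n) = 0 := fun n => by rw [pow_add, h4, zero_mul]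
  exact ⟨this 1, this 2, this 3, this 4, this 5⟩

/-- The geometric series for the inverse stops after one term, because the square of the correction
is a multiple of `rho ^ 4`. -/
lemma P_eq : B.P = 1 - S.rho ^ 2 * E.U2 - S.rho ^ 3 * E.U3 := by
  have h := B.U_P
  rw [E.U_eq] at h
  linear_combination (1 - S.rho ^ 2 * E.U2 - S.rho ^ 3 * E.U3) * h +
    B.P * (E.U2 ^ 2 + 2 * S.rho * E.U2 * E.U3 + S.rho ^ 2 * E.U3 ^ 2) * h4

omit h4 in
-- The relation `k_h` has the fixed-point form `k = σ - rho * k C + rho ^ 2 * K`; substituting it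
-- once into itself gives the first-order term.
lemma k_eq (i j : Fin 3) : ∃ K, B.k i j = S.sig i j - S.rho * E.C i j + S.rho ^ 2 * K := by
  have key : ∀ i j, ∃ K, B.k i j = S.sig i j - S.rho * ∑ l, B.k i l * E.C l j + S.rho ^ 2 * K :=
    fun i j => ⟨-(E.s * B.k i j + S.rho * ∑ l, B.k i l * E.h3 l j), by
      have h := B.k_h i j
      have h2 := sum_sig_mul_of_tangent j (v := fun l => B.k i l)
        (by simpa only [mul_comm, B.k_symm i] using B.x_k i)
      simp only [E.h_eq, sig_symm _ j, Fin.sum_univ_three] at *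
      linear_combination h - (1 + S.rho ^ 2 * E.s) * h2⟩
  choose K hK using key
  have h2 := sum_sig_mul_of_tangent i (v := fun l => E.C l j) (E.x_C j)
  refine ⟨K i j + ∑ l, (∑ a, B.k i a * E.C a l) * E.C l j - S.rho * ∑ l, K i l * E.C l j, ?_⟩
  rw [hK i j]
  have e : ∑ l, B.k i l * E.C l j = ∑ l, (S.sig i l - S.rho * ∑ a, B.k i a * E.C a l +
      S.rho ^ 2 * K i l) * E.C l j := by simp only [← hK]
  rw [e]
  simp only [Fin.sum_univ_three] at *
  linear_combination -S.rho * h2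

omit h4 in
lemma g00_eq : ∃ q, B.g00 = -1 + 2 * (S.rho * E.m) + S.rho ^ 2 * q := by
  refine ⟨-E.U2 - S.rho * E.U3 + 2 * S.rho * E.m * (E.U2 + S.rho * E.U3) - E.V2 * B.U +
    ∑ i, ∑ j, B.h i j * (E.W1 j + S.rho * E.W2 j + S.rho ^ 2 * E.W3 j) *
      (E.W1 i + S.rho * E.W2 i + S.rho ^ 2 * E.W3 i), ?_⟩
  simp only [g00, B.w_eq, E.W_eq, E.V_eq, Fin.sum_univ_three]
  have := E.U_eq
  linear_combination (-1 + 2 * S.rho * E.m) * this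

omit h4 in
lemma w_eq (i : Fin 3) :
    ∃ K, B.w i = S.rho * E.W1 i + S.rho ^ 2 * E.w2 i + S.rho ^ 3 * K := by
  have h1 := sum_sig_mul_of_tangent i E.x_W1
  have h2 := sum_sig_mul_of_tangent i E.x_W2
  refine ⟨∑ j, (S.sig i j * E.W3 j + E.C i j * (E.W2 j + S.rho * E.W3 j) +
    (E.s * S.sig i j + S.rho * E.h3 i j) * (E.W1 j + S.rho * E.W2 j + S.rho ^ 2 * E.W3 j)), ?_⟩
  simp only [B.w_eq, E.W_eq, E.h_eq, w2, Fin.sum_univ_three] at *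
  linear_combination S.rho * h1 + S.rho ^ 2 * h2

lemma chr_zero_zero_zero_eq :
    ∃ K, B.chr 0 0 0 = S.rho ^ 2 * (2 * S.T E.U2 - 2 * E.m) + S.rho ^ 3 * K := by
  obtain ⟨q, hq⟩ := E.g00_eq
  have h1 := E.radial_m
  have h2 := S.sum_sq
  refine ⟨2 * S.T E.U3 + ∑ i, S.x i * (S.d i q - 2 * S.x i * q), ?_⟩
  rw [chr_zero_zero_zero, E.P_eq h4, E.U_eq, hq]
  simp only [map_add, map_neg, d_two, d_rho_mul, d_rho_pow, T_rho_pow, Derivation.map_one_eq_zero,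
    Fin.sum_univ_three, Nat.cast_ofNat] at *
  generalize S.d 0 q - _ = q0
  generalize S.d 1 q - _ = q1
  generalize S.d 2 q - _ = q2
  obtain ⟨p5, p6, p7, p8, p9⟩ := rho_pow h4
  linear_combination (norm := skip) 2 * S.rho ^ 2 * (h1 - E.m * h2)
  ring_nf
  simp only [h4, p5, p6, zero_mul, add_zero, sub_zero, neg_zero]

/-- No unknown coefficient is left: the overall factor `rho` moves the undetermined third-order part
of the lowered shift to fourth order. The second-order coefficient cancels by the radial identity
for `W1`. -/
lemma chr_zero_zero_succ_eq (i : Fin 3) :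
    B.chr 0 0 i.succ = S.rho ^ 3 * (S.d i E.U2 - E.w2 i) := by
  obtain ⟨K, hK⟩ := E.w_eq i
  have h1 := E.radial_U2
  have k1 := E.radial_W1 i
  have k2 := E.radial_w2 i
  have h2 := S.sum_sq
  rw [chr_zero_zero_succ, E.P_eq h4, E.U_eq, hK]
  simp only [map_add, d_rho_mul, d_rho_pow, Derivation.map_one_eq_zero, Fin.sum_univ_three,
    Nat.cast_ofNat] at *
  obtain ⟨p5, p6, p7, p8, p9⟩ := rho_pow h4
  linear_combination (norm := skip) S.rho * (-S.x i * S.rho ^ 2 * h1 +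
    2 * S.x i * S.rho ^ 2 * E.U2 * h2 + S.rho * k1 - S.rho * E.W1 i * h2 + S.rho ^ 2 * k2 -
    2 * S.rho ^ 2 * E.w2 i * h2)
  ring_nf
  simp only [h4, p5, p6, p7, zero_mul, add_zero, sub_zero, neg_zero]

lemma chr_zero_succ_succ_eq (i j : Fin 3) : ∃ K, B.chr 0 i.succ j.succ =
    2 * (S.rho * S.sig i j) + S.rho ^ 2 * E.C i j + S.rho ^ 3 * K := by
  have h1 := E.radial_C i j
  have h2 := S.sum_sq
  have s1 := S.sum_sig_x i
  have s2 := S.sum_sig_x j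
  simp only [sig_symm i, sig_symm j] at s1 s2
  have e : 2 * B.h i j + ∑ l, S.x l * S.d l (B.h i j) = 2 * S.sig i j + S.rho * E.C i j +
      S.rho ^ 2 * (2 * E.h2 i j + ∑ l, S.x l * (S.d l (E.h2 i j) - 2 * S.x l * E.h2 i j)) := by
    rw [E.h_eq']
    simp only [map_add, d_rho_mul, d_rho_pow, d_sig, Fin.sum_univ_three, Nat.cast_ofNat] at *
    linear_combination S.rho * (h1 - E.C i j * h2) - S.x j * s1 - S.x i * s2
  rw [chr_zero_succ_succ, e, E.P_eq h4]
  generalize 2 * E.h2 i j + _ = Q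
  exact ⟨Q - (E.U2 + S.rho * E.U3) * (2 * S.sig i j + S.rho * E.C i j + S.rho ^ 2 * Q), by ring⟩

omit h4 in
lemma low_succ_zero_zero (l : Fin 3) : ∃ K, B.low l.succ 0 0 =
    -2 * S.x l * S.T B.U + 2 * (S.rho * S.T (E.W1 l)) +
      S.rho ^ 2 * (2 * S.T (E.w2 l) - 2 * (S.d l E.m - S.x l * E.m)) + S.rho ^ 3 * K := by
  obtain ⟨K, hK⟩ := E.w_eq l
  obtain ⟨q, hq⟩ := E.g00_eq
  refine ⟨2 * S.T K - (S.d l q - 2 * S.x l * q), ?_⟩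
  simp only [low, lowChr, met_succ_zero, met_zero_zero, D_zero, D_succ, b, hq, hK, map_add, map_neg,
    d_two, d_rho_mul, d_rho_pow, T_rho_pow, T_rho_mul, Derivation.map_one_eq_zero, Nat.cast_ofNat,
    Derivation.leibniz _ (-B.U), smul_eq_mul, S.T_x]
  ring

/-- The order of quantifiers matters: the undetermined second-order part is radial, with one `Z`
common to all `k`, so contraction with a tangential tensor removes it. -/
lemma chr_succ_zero_zero_eq : ∃ Z, ∀ k : Fin 3, ∃ K, B.chr k.succ 0 0 =
    2 * (S.rho * S.T (E.W1 k)) +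
      2 * S.rho ^ 2 * (S.T (E.w2 k) - ∑ l, E.C k l * S.T (E.W1 l) - S.d k E.m) +
      S.x k * (-2 * (S.rho * S.T E.m) + S.rho ^ 2 * Z) + S.rho ^ 3 * K := by
  obtain ⟨q, hq⟩ := E.g00_eq
  obtain ⟨M, hM⟩ := E.chr_zero_zero_zero_eq h4
  choose e he using E.low_succ_zero_zero
  choose K hK using E.k_eq
  have hl : B.low 0 0 0 = 2 * (S.rho * S.T E.m) + S.rho ^ 2 * S.T q := by
    simp only [low, lowChr, met_zero_zero, D_zero, hq, map_add, map_neg, T_two, T_rho_mul,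
      T_rho_pow, Derivation.map_one_eq_zero]
    ring
  have hTU : S.T B.U = S.rho ^ 2 * (S.T E.U2 + S.rho * S.T E.U3) := by
    rw [E.U_eq]
    simp only [map_add, T_rho_pow, Derivation.map_one_eq_zero]
    ring
  refine ⟨-S.T q + (E.U2 + S.rho * E.U3) * (2 * (S.rho * S.T E.m) + S.rho ^ 2 * S.T q) -
    B.V * (2 * S.T E.U2 - 2 * E.m + S.rho * M) + B.P * ∑ l, (E.W1 l + S.rho * E.W2 l +
    S.rho ^ 2 * E.W3 l) * (-2 * S.x l * (S.rho * (S.T E.U2 + S.rho * S.T E.U3)) +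
      2 * S.T (E.W1 l) + S.rho * (2 * S.T (E.w2 l) - 2 * (S.d l E.m - S.x l * E.m)) +
      S.rho ^ 2 * e l),
fun k => ?_⟩
  have h1 := sum_sig_mul_of_tangent k (sum_x_T E.x_W1)
  have h2 := sum_sig_mul_of_tangent k (sum_x_T E.x_w2)
  have h3 := sum_sig_mul_of_tangent k E.radial_m
  have h5 := B.k_x k
  have hs : ∃ L, ∑ l, B.k k l * B.low l.succ 0 0 = 2 * (S.rho * S.T (E.W1 k)) +
      2 * S.rho ^ 2 * (S.T (E.w2 k) - ∑ l, E.C k l * S.T (E.W1 l) - S.d k E.m) +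
      S.rho ^ 3 * L := by
    refine ⟨∑ l, (S.sig k l * e l - E.C k l * (2 * S.T (E.w2 l) - 2 * S.d l E.m + S.rho * e l) +
      K k l * (2 * S.T (E.W1 l) + S.rho * (2 * S.T (E.w2 l) - 2 * S.d l E.m) +
        S.rho ^ 2 * e l)), ?_⟩
    have : ∀ l, B.k k l * B.low l.succ 0 0 = B.k k l * S.x l * (-2 * S.T B.U + 2 * S.rho ^ 2 * E.m) +
        (S.sig k l - S.rho * E.C k l + S.rho ^ 2 * K k l) * (2 * (S.rho * S.T (E.W1 l)) +
        S.rho ^ 2 * (2 * S.T (E.w2 l) - 2 * S.d l E.m) + S.rho ^ 3 * e l) := fun l => by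
      rw [he, ← hK]
      ring
    simp only [this, Fin.sum_univ_three] at *
    linear_combination (-2 * S.T B.U + 2 * S.rho ^ 2 * E.m) * h5 + 2 * S.rho * h1 +
      2 * S.rho ^ 2 * (h2 - h3)
  obtain ⟨L, hL⟩ := hs
  rw [chr_succ, hL, hM, hl, E.W_eq]
  refine ⟨L - (E.W1 k + S.rho * E.W2 k + S.rho ^ 2 * E.W3 k) * (2 * S.T E.U2 - 2 * E.m + S.rho * M), ?_⟩
  simp only [he, hTU, E.W_eq, Fin.sum_univ_three]
  have hP := E.P_eq h4
  linear_combination -S.x k * (2 * (S.rho * S.T E.m) + S.rho ^ 2 * S.T q) * hP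

omit h4 in
lemma low_succ_zero_succ (l i : Fin 3) : ∃ K, B.low l.succ 0 i.succ =
    S.rho * S.T (E.C i l) + S.rho ^ 2 * (S.T E.s * S.sig i l + E.F i l) + S.rho ^ 3 * K := by
  obtain ⟨K, hK⟩ := E.w_eq l
  obtain ⟨K', hK'⟩ := E.w_eq i
  refine ⟨-(S.d i E.U2 - 2 * S.x i * E.U2 + S.rho * (S.d i E.U3 - 3 * S.x i * E.U3)) * S.x l +
    (S.d l E.U2 - 2 * S.x l * E.U2 + S.rho * (S.d l E.U3 - 3 * S.x l * E.U3)) * S.x i +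
    S.T (E.h3 i l) + (S.d i (E.w2 l) - 2 * S.x i * E.w2 l) +
    S.rho * (S.d i K - 3 * S.x i * K) - (S.d l (E.w2 i) - 2 * S.x l * E.w2 i) -
    S.rho * (S.d l K' - 3 * S.x l * K'), ?_⟩
  have hb : ∀ a b, S.d a (B.b b) = -(S.d a B.U * S.x b) - B.U * S.sig a b + S.d a (B.w b) :=
    fun a b => by
      simp only [Bondi.b, map_add, Derivation.leibniz, d_x', map_neg, smul_eq_mul]
      ring
  simp only [low, lowChr, met_succ_zero, met_zero_succ, met_succ_succ, D_zero, D_succ, hb]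
  rw [B.h_symm l i, E.h_eq, hK, hK', E.U_eq, S.sig_symm l i]
  simp only [map_add, d_rho_mul, d_rho_pow, T_rho_mul, T_rho_pow, Derivation.map_one_eq_zero,
    Nat.cast_ofNat, Derivation.leibniz _ E.s, T_sig, smul_eq_mul, F]
  ring

lemma chr_succ_zero_succ_eq (j i : Fin 3) : ∃ K, B.chr j.succ 0 i.succ =
    S.rho * S.T (E.C i j) + S.rho ^ 2 * E.H i j + S.rho ^ 3 * K := by
  obtain ⟨q, hq⟩ := E.g00_eq
  choose e he using fun l => E.low_succ_zero_succ l i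
  choose K hK using E.k_eq
  have h1 := sum_sig_mul_of_tangent j (sum_x_T (E.C_x' i))
  have h2 := sum_sig_mul_of_tangent j (E.x_F i)
  have h3 := sum_sig_mul_of_tangent j (v := S.sig i) (by simpa only [mul_comm] using S.sum_sig_x i)
  have hl : B.low 0 0 i.succ = 2 * (S.rho ^ 2 * (S.d i E.m - S.x i * E.m)) +
      S.rho ^ 3 * (S.d i q - 2 * S.x i * q) := by
    simp only [low, lowChr, met_zero_zero, met_zero_succ, D_zero, D_succ, hq, map_add, map_neg,
      d_two, d_rho_mul, d_rho_pow, Derivation.map_one_eq_zero, Nat.cast_ofNat]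
    ring
  rw [chr_succ, hl, E.chr_zero_zero_succ_eq h4]
  refine ⟨∑ l, (S.sig j l * e l - E.C j l * (S.T E.s * S.sig i l + E.F i l + S.rho * e l) +
      K j l * (S.T (E.C i l) + S.rho * (S.T E.s * S.sig i l + E.F i l) + S.rho ^ 2 * e l)) -
      B.W j * (S.d i E.U2 - E.w2 i) + S.x j * (- (S.d i q - 2 * S.x i * q) +
      (E.U2 + S.rho * E.U3) * (2 * (S.rho * (S.d i E.m - S.x i * E.m)) +
      S.rho ^ 2 * (S.d i q - 2 * S.x i * q)) - B.V * (S.d i E.U2 - E.w2 i) +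
      ∑ l, ((E.W2 l + S.rho * E.W3 l) * S.T (E.C i l) + (E.W1 l + S.rho * E.W2 l +
      S.rho ^ 2 * E.W3 l) * (S.T E.s * S.sig i l + E.F i l + S.rho * e l)) -
      (E.U2 + S.rho * E.U3) * ∑ l, (E.W1 l + S.rho * E.W2 l + S.rho ^ 2 * E.W3 l) *
      (S.rho * S.T (E.C i l) + S.rho ^ 2 * (S.T E.s * S.sig i l + E.F i l) + S.rho ^ 3 * e l)), ?_⟩
  simp only [he, hK, E.W_eq, E.P_eq h4, H, Fin.sum_univ_three] at *
  linear_combination S.rho * h1 + S.rho ^ 2 * (S.T E.s * h3 + h2)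

omit h4 in
lemma low_succ_succ_succ (l j i : Fin 3) : ∃ K, B.low l.succ j.succ i.succ =
    -2 * (S.rho * (S.x l * S.sig j i)) + S.rho ^ 2 * E.c l j i + S.rho ^ 3 * K := by
  refine ⟨S.d j (E.h2 l i) - 2 * S.x j * E.h2 l i + (S.d i (E.h2 l j) - 2 * S.x i * E.h2 l j) -
    (S.d l (E.h2 j i) - 2 * S.x l * E.h2 j i), ?_⟩
  simp only [low, lowChr, met_succ_succ, D_succ, E.h_eq', map_add, d_rho_mul, d_rho_pow, d_sig,
    Nat.cast_ofNat, c, S.sig_symm i j, S.sig_symm l]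
  ring

/-- As before, what is unknown at second order is confined to the radial direction through a single
`Z`. -/
lemma chr_succ_succ_succ_eq (j i : Fin 3) : ∃ Z, ∀ k : Fin 3, ∃ K, B.chr k.succ j.succ i.succ =
    S.rho ^ 2 * (E.c k j i - 2 * E.W1 k * S.sig j i) +
      S.x k * (S.rho * S.T (E.C j i) + S.rho ^ 2 * Z) + S.rho ^ 3 * K := by
  obtain ⟨M, hM⟩ := E.chr_zero_succ_succ_eq h4 j i
  choose e he using fun l => E.low_succ_succ_succ l j i
  choose K hK using E.k_eq
  choose w hw using E.w_eq
  have hl : ∃ Q, B.low 0 j.succ i.succ = -2 * (S.rho * S.sig j i) - S.rho * S.T (E.C j i) +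
      S.rho ^ 2 * Q := by
    have hb : ∀ a b, S.d a (B.b b) = -(S.d a B.U * S.x b) - B.U * S.sig a b + S.d a (B.w b) :=
      fun a b => by
        simp only [Bondi.b, map_add, Derivation.leibniz, d_x', map_neg, smul_eq_mul]
        ring
    refine ⟨-S.T (E.h2 j i) - S.rho * (S.d i E.U2 - 2 * S.x i * E.U2 +
      S.rho * (S.d i E.U3 - 3 * S.x i * E.U3)) * S.x j - S.rho * (S.d j E.U2 - 2 * S.x j * E.U2 +
      S.rho * (S.d j E.U3 - 3 * S.x j * E.U3)) * S.x i - 2 * S.rho * (E.U2 + S.rho * E.U3) * S.sig j i +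
      (S.d i (E.W1 j) - S.x i * E.W1 j) + (S.d j (E.W1 i) - S.x j * E.W1 i) +
      S.rho * (S.d i (E.w2 j) - 2 * S.x i * E.w2 j + (S.d j (E.w2 i) - 2 * S.x j * E.w2 i)) +
      S.rho ^ 2 * (S.d i (w j) - 3 * S.x i * w j + (S.d j (w i) - 3 * S.x j * w i)), ?_⟩
    simp only [low, lowChr, met_zero_succ, met_succ_succ, D_zero, D_succ, hb,
      E.h_eq', hw, E.U_eq, map_add, d_rho_mul, d_rho_pow, T_rho_mul, T_rho_pow, T_sig,
      Derivation.map_one_eq_zero, Nat.cast_ofNat, S.sig_symm i j]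
    ring
  obtain ⟨Q, hQ⟩ := hl
  refine ⟨-(∑ l, S.x l * E.c l j i) - Q + (E.U2 + S.rho * E.U3) * (-2 * (S.rho * S.sig j i) -
      S.rho * S.T (E.C j i) + S.rho ^ 2 * Q) - (E.C j i + S.rho * M) +
      (2 * E.m - S.rho * E.V2) * (2 * S.sig j i + S.rho * E.C j i + S.rho ^ 2 * M) +
      B.P * ∑ l, (E.W1 l + S.rho * E.W2 l + S.rho ^ 2 * E.W3 l) *
      (-2 * (S.x l * S.sig j i) + S.rho * E.c l j i + S.rho ^ 2 * e l),
fun k => ?_⟩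
  have h1 := S.sum_sig_mul k fun l => E.c l j i
  have h5 := B.k_x k
  have hs : ∃ L, ∑ l, B.k k l * B.low l.succ j.succ i.succ = S.rho ^ 2 * E.c k j i -
      S.rho ^ 2 * (S.x k * ∑ l, S.x l * E.c l j i) + S.rho ^ 3 * L := by
    refine ⟨∑ l, (S.sig k l * e l - E.C k l * (E.c l j i + S.rho * e l) +
      S.rho * K k l * (E.c l j i + S.rho * e l)), ?_⟩
    have : ∀ l, B.k k l * B.low l.succ j.succ i.succ =
        B.k k l * S.x l * (-2 * (S.rho * S.sig j i)) +
        (S.sig k l - S.rho * E.C k l + S.rho ^ 2 * K k l) *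
        (S.rho ^ 2 * E.c l j i + S.rho ^ 3 * e l) := fun l => by
      rw [he, ← hK]
      ring
    simp only [this, Fin.sum_univ_three] at *
    linear_combination (-2 * (S.rho * S.sig j i)) * h5 + S.rho ^ 2 * h1
  obtain ⟨L, hL⟩ := hs
  rw [chr_succ, hL, hM, hQ, E.W_eq, E.V_eq]
  refine ⟨L - (E.W2 k + S.rho * E.W3 k) * 2 * S.sig j i - (E.W1 k + S.rho * E.W2 k +
      S.rho ^ 2 * E.W3 k) * (E.C j i + S.rho * M), ?_⟩
  simp only [he, E.W_eq, Fin.sum_univ_three]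
  have hP := E.P_eq h4
  linear_combination -S.x k * (-2 * (S.rho * S.sig j i) -
      S.rho * S.T (E.C j i) + S.rho ^ 2 * Q) * hP

end Truncated

end Expansion

end Bondi

end ScriCalculus

/-! ### Leading coefficients of the Ricci tensor -/

namespace ScriCalculus.Bondi.Expansion

variable {A : Type*} [CommRing A] [Algebra ℝ A] {S : ScriCalculus A} {B : S.Bondi}
  (E : B.Expansion) (h4 : S.rho ^ 4 = 0)

omit E in
-- The traces multiplying Christoffel symbols become derivatives of `U`, and time and space indices
-- are separated so that the expansions can be inserted.
lemma fourRicci_split (μ ν : Fin 4) : fourRicci S.D B.met B.inv μ ν =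
    2 * (S.T (B.chr 0 μ ν) + ∑ j : Fin 3, S.rho * S.d j (B.chr j.succ μ ν) -
      S.D ν (∑ l, B.chr l l μ)) + (2 * B.P * S.T B.U * B.chr 0 μ ν +
      ∑ j : Fin 3, 2 * B.P * (S.rho * S.d j B.U) * B.chr j.succ μ ν) -
    (B.chr 0 0 ν * B.chr 0 0 μ + ∑ k : Fin 3, B.chr 0 ν k.succ * B.chr k.succ 0 μ +
      ∑ k : Fin 3, B.chr k.succ 0 ν * B.chr 0 μ k.succ +
      ∑ j : Fin 3, ∑ k : Fin 3, B.chr k.succ j.succ ν * B.chr j.succ μ k.succ) := by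
  have h1 : ∑ κ, (∑ l, B.chr l l κ) * B.chr κ μ ν = 2 * B.P * S.T B.U * B.chr 0 μ ν +
      ∑ j : Fin 3, 2 * B.P * (S.rho * S.d j B.U) * B.chr j.succ μ ν := by
    rw [Fin.sum_univ_succ, B.chr_trace_zero]
    simp only [B.chr_trace_succ]
  have h2 : ∑ l, ∑ κ, B.chr l ν κ * B.chr κ l μ = 
      B.chr 0 0 ν * B.chr 0 0 μ + ∑ k : Fin 3, B.chr 0 ν k.succ * B.chr k.succ 0 μ +
      ∑ k : Fin 3, B.chr k.succ 0 ν * B.chr 0 μ k.succ +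
      ∑ j : Fin 3, ∑ k : Fin 3, B.chr k.succ j.succ ν * B.chr j.succ μ k.succ := by
    rw [Finset.sum_comm (s := (Finset.univ : Finset (Fin 3)))]
    simp only [Fin.sum_univ_succ (n := 3), Finset.sum_add_distrib, B.chr_symm _ ν 0,
      B.chr_symm _ ν (Fin.succ _), B.chr_symm _ (Fin.succ _) μ]
    ring
  rw [fourRicci, h1, h2, Fin.sum_univ_succ (f := fun l => S.D l _)]
  simp only [D_zero, D_succ]
  ring

include h4

lemma sum_chr_mul_chr_zero (i : Fin 3) : ∑ k : Fin 3, B.chr 0 i.succ k.succ * B.chr k.succ 0 0 =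
    4 * (S.rho ^ 2 * S.T (E.W1 i)) + S.rho ^ 3 * (4 * S.T (E.w2 i) - 4 * S.d i E.m -
      2 * ∑ l, E.C i l * S.T (E.W1 l)) := by
  choose M hM using E.chr_zero_succ_succ_eq h4 i
  obtain ⟨Z, hZ⟩ := E.chr_succ_zero_zero_eq h4
  choose K hK using hZ
  have h1 := sum_sig_mul_of_tangent i (sum_x_T E.x_W1)
  have h2 := sum_sig_mul_of_tangent i (sum_x_T E.x_w2)
  have h3 := sum_sig_mul_of_tangent i E.radial_m
  have h5 := S.sum_sig_x i
  have h6 := E.C_x i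
  have h7 := sum_sig_mul_of_tangent i
    (v := fun k => ∑ l, E.C k l * S.T (E.W1 l)) (by
      have h0 := E.x_C 0
      have h1 := E.x_C 1
      have h2 := E.x_C 2
      simp only [Fin.sum_univ_three] at *
      linear_combination S.T (E.W1 0) * h0 + S.T (E.W1 1) * h1 + S.T (E.W1 2) * h2)
  simp only [hM, hK]
  clear hM hK
  obtain ⟨Q, hQ⟩ : ∃ Q : Fin 3 → A, ∀ k, ∑ l, E.C k l * S.T (E.W1 l) = Q k := ⟨_, fun _ => rfl⟩
  simp only [hQ] at h7 ⊢
  have hQi := hQ i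
  clear hQ
  simp only [Fin.sum_univ_three] at *
  obtain ⟨p5, p6, -⟩ := rho_pow h4
  linear_combination (norm := skip) 4 * S.rho ^ 2 * h1 + 4 * S.rho ^ 3 * (h2 - h3 - h7) +
    2 * S.rho ^ 3 * hQi + (2 * S.rho * (-2 * (S.rho * S.T E.m) + S.rho ^ 2 * Z)) * h5 +
    S.rho ^ 2 * (-2 * (S.rho * S.T E.m) + S.rho ^ 2 * Z) * h6
  ring_nf
  simp only [h4, p5, p6, zero_mul, add_zero, sub_zero]

/-- The radial parts of the first factor meet `x · T C = 0`, or the radial part `2 * x j * m` of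
`H`; the latter contribution vanishes by the same tangency after summation over `j`. -/
lemma sum_chr_mul_chr_succ (i : Fin 3) :
    ∑ j : Fin 3, ∑ k : Fin 3, B.chr k.succ j.succ i.succ * B.chr j.succ 0 k.succ =
    S.rho ^ 3 * (∑ j, ∑ k, S.T (E.C k j) * S.d i (E.C k j) -
      2 * ∑ j, S.T (E.C i j) * E.W1 j - S.x i * ∑ j, ∑ k, S.T (E.C k j) * E.C k j) := by
  choose Z hZ using fun j => E.chr_succ_succ_succ_eq h4 j i
  choose K hK using hZ
  choose L hL using E.chr_succ_zero_succ_eq h4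
  have hx : ∀ j, ∑ k, S.x k * S.T (E.C k j) = 0 := fun j => sum_x_T (E.x_C j)
  have hH : ∀ j, ∑ k, S.x k * E.H k j = 2 * S.x j * E.m := fun j => by
    have h1 := E.radial_m
    have h2 := S.sum_sq
    have h3 := S.sum_sig_x j
    have h5 := E.x_F j
    have y0 := hx 0
    have y1 := hx 1
    have y2 := hx 2
    have f0 := E.F_antisymm 0 j
    have f1 := E.F_antisymm 1 j
    have f2 := E.F_antisymm 2 j
    simp only [H, S.sig_symm _ j, Fin.sum_univ_three] at *
    linear_combination -2 * S.x j * (h1 - E.m * h2) + S.T E.s * h3 - h5 + S.x 0 * f0 + S.x 1 * f1 +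
      S.x 2 * f2 + (S.x j * E.W1 0 - E.C j 0) * y0 + (S.x j * E.W1 1 - E.C j 1) * y1 +
      (S.x j * E.W1 2 - E.C j 2) * y2
  have hs : ∀ k, ∑ j, S.sig i j * S.T (E.C j k) = S.T (E.C i k) := fun k =>
    sum_sig_mul_of_tangent i (hx k)
  have hc : ∑ j, ∑ k, S.T (E.C k j) * E.c k j i = ∑ j, ∑ k, S.T (E.C k j) * S.d i (E.C k j) -
      S.x i * ∑ j, ∑ k, S.T (E.C k j) * E.C k j := by
    have cs := E.C_symm
    simp only [c, Fin.sum_univ_three, cs 1 0, cs 2 0, cs 2 1]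
    ring
  have e : ∀ j : Fin 3, ∑ k : Fin 3, B.chr k.succ j.succ i.succ * B.chr j.succ 0 k.succ =
      S.rho ^ 3 * ∑ k, S.T (E.C k j) * E.c k j i -
      2 * S.rho ^ 3 * ∑ k, S.T (E.C k j) * E.W1 k * S.sig j i +
      S.rho ^ 3 * (2 * S.x j * E.m * S.T (E.C j i)) := fun j => by
    have hx' := hx j
    have hH' := hH j
    simp only [hK, hL, Fin.sum_univ_three] at *
    obtain ⟨p5, p6, -⟩ := rho_pow h4
    linear_combination (norm := skip) S.rho * (S.rho * S.T (E.C j i) + S.rho ^ 2 * Z j) * hx' +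
      S.rho ^ 2 * (S.rho * S.T (E.C j i) + S.rho ^ 2 * Z j) * hH'
    ring_nf
    simp only [h4, p5, p6, zero_mul, add_zero, sub_zero]
  have hxi := hx i
  have s0 := hs 0
  have s1 := hs 1
  have s2 := hs 2
  have cs := E.C_symm
  simp only [e]
  clear e hK hL
  simp only [Fin.sum_univ_three, S.sig_symm _ i, cs 1 0, cs 2 0, cs 2 1, cs i] at *
  linear_combination S.rho ^ 3 * hc - 2 * S.rho ^ 3 * (E.W1 0 * s0 + E.W1 1 * s1 + E.W1 2 * s2) +
    2 * S.rho ^ 3 * E.m * hxi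

/-- The `rho ^ 2` coefficient vanishes because the leading shift is half the divergence of the
shear. The `rho ^ 3` coefficient contains the evolution of the angular momentum aspect through `T
(w2 i)`. -/
lemma fourRicci_zero_succ (i : Fin 3) : fourRicci S.D B.met B.inv 0 i.succ = S.rho ^ 3 *
    (-2 * S.d i (S.T E.U2) - 6 * S.T (E.w2 i) + 2 * ∑ j, E.C i j * S.T (E.W1 j) + 4 * S.d i E.m +
      2 * ∑ j, S.T (E.C i j) * E.W1 j - ∑ j, ∑ k, S.T (E.C k j) * S.d i (E.C k j) +
      S.x i * (8 * S.T E.U2 + ∑ j, ∑ k, S.T (E.C k j) * E.C k j) +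
      2 * ∑ j, (S.d j (E.H i j) - 2 * S.x j * E.H i j)) := by
  choose L hL using E.chr_succ_zero_succ_eq h4
  obtain ⟨M, hM⟩ := E.chr_zero_zero_zero_eq h4
  have hx := sum_x_T (E.C_x' i)
  have hd : ∑ j, S.d j (S.T (E.C i j)) = 2 * S.T (E.W1 i) := by
    rw [← T_two, E.two_W1, map_sum]
    simp only [S.T_d, E.C_symm i]
  have hP := E.P_eq h4
  have hdP : S.d i (2 * B.P * S.T B.U) = 2 * (S.rho ^ 2 * (S.d i (S.T E.U2) - 2 * S.x i * S.T E.U2)) +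
      2 * (S.rho ^ 3 * (S.d i (S.T E.U3) - 3 * S.x i * S.T E.U3)) := by
    have : 2 * B.P * S.T B.U = 2 * (S.rho ^ 2 * S.T E.U2) + 2 * (S.rho ^ 3 * S.T E.U3) := by
      obtain ⟨p5, p6, -⟩ := rho_pow h4
      rw [hP, E.U_eq]
      simp only [map_add, T_rho_pow, Derivation.map_one_eq_zero]
      ring_nf
      simp only [h4, p5, p6, zero_mul, sub_zero]
    rw [this]
    simp only [map_add, d_two, d_rho_pow, Nat.cast_ofNat]
  have hdU : ∀ j, S.d j B.U = S.rho ^ 2 * (S.d j E.U2 - 2 * S.x j * E.U2 +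
      S.rho * (S.d j E.U3 - 3 * S.x j * E.U3)) := fun j => by
    rw [E.U_eq]
    simp only [map_add, d_rho_pow, Derivation.map_one_eq_zero, Nat.cast_ofNat]
    ring
  rw [fourRicci_split, E.sum_chr_mul_chr_zero h4, E.sum_chr_mul_chr_succ h4, B.chr_trace_zero,
    D_succ, hdP, E.chr_zero_zero_succ_eq h4, hM]
  simp only [hL, E.chr_zero_zero_succ_eq h4, hdU, map_add, map_sub, d_rho_mul, d_rho_pow, T_rho_pow,
    Nat.cast_ofNat, S.T_d]
  obtain ⟨H, hH⟩ : ∃ H : Fin 3 → A, ∀ k, E.H i k = H k := ⟨_, fun _ => rfl⟩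
  have hTU : S.T B.U = S.rho ^ 2 * (S.T E.U2 + S.rho * S.T E.U3) := by
    rw [E.U_eq]
    simp only [map_add, T_rho_pow, Derivation.map_one_eq_zero]
    ring
  simp only [hH, hTU]
  generalize ∑ j, ∑ k, S.T (E.C k j) * S.d i (E.C k j) = q1
  generalize ∑ j, ∑ k, S.T (E.C k j) * E.C k j = q2
  generalize ∑ j, S.T (E.C i j) * E.W1 j = q3
  generalize ∑ j, E.C i j * S.T (E.W1 j) = q4
  clear hdP hL hdU hH
  simp only [Fin.sum_univ_three] at *
  obtain ⟨p5, p6, p7, -⟩ := rho_pow h4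
  linear_combination (norm := skip) 2 * S.rho ^ 2 * (hd - hx)
  ring_nf
  simp only [h4, p5, p6, p7, zero_mul, add_zero, sub_zero, neg_zero]

/-- For this component the coefficient of `rho ^ 2` is the one that matters; the factor `rho`
discards undetermined coefficients of third order. -/
lemma rho_mul_fourRicci_zero_zero : S.rho * fourRicci S.D B.met B.inv 0 0 = S.rho ^ 3 *
    (4 * ∑ k, S.d k (S.T (E.W1 k)) - 8 * S.T E.m -
      ∑ j, ∑ k, S.T (E.C k j) * S.T (E.C k j)) := by
  obtain ⟨L, hL⟩ : ∃ L : Fin 3 → Fin 3 → A, ∀ j i : Fin 3, B.chr j.succ 0 i.succ =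
      S.rho * S.T (E.C i j) + S.rho ^ 2 * L j i := by
    choose L hL using E.chr_succ_zero_succ_eq h4
    exact ⟨fun j i => E.H i j + S.rho * L j i, fun j i => by rw [hL]; ring⟩
  obtain ⟨K, hK⟩ : ∃ K : Fin 3 → A, ∀ k : Fin 3, B.chr k.succ 0 0 =
      2 * (S.rho * (S.T (E.W1 k) - S.x k * S.T E.m)) + S.rho ^ 2 * K k := by
    obtain ⟨Z, hZ⟩ := E.chr_succ_zero_zero_eq h4
    choose K hK using hZ
    exact ⟨fun k => 2 * (S.T (E.w2 k) - ∑ l, E.C k l * S.T (E.W1 l) - S.d k E.m) +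
      S.x k * Z + S.rho * K k, fun k => by rw [hK]; ring⟩
  obtain ⟨M, hM⟩ := E.chr_zero_zero_zero_eq h4
  have hx := sum_x_T E.x_W1
  have hr : ∑ i, S.x i * S.d i (S.T E.m) = 0 := by
    have := congrArg S.T E.radial_m
    simpa [Derivation.leibniz, S.T_x, S.T_d] using this
  have hd : ∑ i, S.d i (S.x i) = 2 := by
    have := S.sum_sq
    simp only [S.d_x, if_true, Fin.sum_univ_three] at *
    linear_combination -this
  have h2 := S.sum_sq
  have hTU : S.T B.U = S.rho ^ 2 * (S.T E.U2 + S.rho * S.T E.U3) := by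
    rw [E.U_eq]
    simp only [map_add, T_rho_pow, Derivation.map_one_eq_zero]
    ring
  have hdP : S.T (2 * B.P * S.T B.U) = 2 * (S.rho ^ 2 * S.T (S.T E.U2)) +
      2 * (S.rho ^ 3 * S.T (S.T E.U3)) := by
    have : 2 * B.P * S.T B.U = 2 * (S.rho ^ 2 * S.T E.U2) + 2 * (S.rho ^ 3 * S.T E.U3) := by
      obtain ⟨p5, p6, -⟩ := rho_pow h4
      rw [E.P_eq h4, hTU]
      ring_nf
      simp only [h4, p5, p6, zero_mul, sub_zero]
    rw [this]
    simp only [map_add, T_two, T_rho_pow]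
  have hdU : ∀ j, S.d j B.U = S.rho ^ 2 * (S.d j E.U2 - 2 * S.x j * E.U2 +
      S.rho * (S.d j E.U3 - 3 * S.x j * E.U3)) := fun j => by
    rw [E.U_eq]
    simp only [map_add, d_rho_pow, Derivation.map_one_eq_zero, Nat.cast_ofNat]
    ring
  rw [fourRicci_split, B.chr_trace_zero, D_zero, hdP, hM]
  simp only [B.chr_symm _ (Fin.succ _) 0, hL, hK, E.chr_zero_zero_succ_eq h4, hdU, hTU, map_add,
    map_sub, d_two, T_two, d_rho_mul, d_rho_pow, T_rho_pow, Nat.cast_ofNat,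
    Derivation.leibniz _ (S.x _), smul_eq_mul]
  clear hdP hL hdU hK hTU
  simp only [Fin.sum_univ_three, E.C_symm 1 0, E.C_symm 2 0, E.C_symm 2 1] at *
  obtain ⟨p5, p6, p7, -⟩ := rho_pow h4
  linear_combination (norm := skip) 4 * S.rho ^ 3 * (- hx - hr - S.T E.m * hd + S.T E.m * h2)
  ring_nf
  simp only [h4, p5, p6, p7, zero_mul, add_zero, sub_zero]

end ScriCalculus.Bondi.Expansion

/-! ### Truncation modulo `rho ^ 4` -/

namespace ScriCalculus

variable {A : Type*} [CommRing A] [Algebra ℝ A] (S : ScriCalculus A)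

section Quotient

/-- The ideal of fields that vanish to fourth order at null infinity. -/
abbrev ideal : Ideal A := Ideal.span {S.rho ^ 4}

/-- The derivative of `rho` is a multiple of `rho`, so the ideal is stable and the derivation
descends to the quotient. -/
lemma d_mem_ideal (i : Fin 3) (f : A) (hf : Ideal.Quotient.mkₐ ℝ S.ideal f = 0) :
    Ideal.Quotient.mkₐ ℝ S.ideal (S.d i f) = 0 := by
  rw [Ideal.Quotient.mkₐ_eq_mk, Ideal.Quotient.eq_zero_iff_mem, Ideal.mem_span_singleton] at *
  obtain ⟨g, rfl⟩ := hf
  rw [Bondi.Expansion.d_rho_pow]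
  exact dvd_mul_right _ _

lemma T_mem_ideal (f : A) (hf : Ideal.Quotient.mkₐ ℝ S.ideal f = 0) :
    Ideal.Quotient.mkₐ ℝ S.ideal (S.T f) = 0 := by
  rw [Ideal.Quotient.mkₐ_eq_mk, Ideal.Quotient.eq_zero_iff_mem, Ideal.mem_span_singleton] at *
  obtain ⟨g, rfl⟩ := hf
  rw [Bondi.Expansion.T_rho_pow]
  exact dvd_mul_right _ _

/-- The calculus modulo terms of fourth order. -/
def truncated : ScriCalculus (A ⧸ S.ideal) where
  x a := Ideal.Quotient.mkₐ ℝ S.ideal (S.x a)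
  rho := Ideal.Quotient.mkₐ ℝ S.ideal S.rho
  T := Derivation.liftOfSurjective (Ideal.Quotient.mkₐ_surjective ℝ S.ideal) S.T_mem_ideal
  d i := Derivation.liftOfSurjective (Ideal.Quotient.mkₐ_surjective ℝ S.ideal) (S.d_mem_ideal i)
  sum_sq := by simp only [← map_mul, ← map_sum, S.sum_sq, map_one]
  d_x a b := by
    rw [Derivation.liftOfSurjective_apply, S.d_x]
    split_ifs <;> simp
  T_x a := by rw [Derivation.liftOfSurjective_apply, S.T_x, map_zero]
  T_rho := by rw [Derivation.liftOfSurjective_apply, S.T_rho, map_zero]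
  d_rho a := by rw [Derivation.liftOfSurjective_apply, S.d_rho, map_neg, map_mul]
  T_d a f := by
    obtain ⟨f, rfl⟩ := Ideal.Quotient.mkₐ_surjective ℝ S.ideal f
    simp only [Derivation.liftOfSurjective_apply, S.T_d]

/-- The quotient map. -/
def proj : A →ₐ[ℝ] A ⧸ S.ideal := Ideal.Quotient.mkₐ ℝ S.ideal

variable {S}

lemma proj_x (a : Fin 3) : S.proj (S.x a) = S.truncated.x a := rfl

lemma proj_rho : S.proj S.rho = S.truncated.rho := rfl

lemma proj_T (f : A) : S.proj (S.T f) = S.truncated.T (S.proj f) :=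
  (Derivation.liftOfSurjective_apply _ S.T_mem_ideal f).symm

lemma proj_d (i : Fin 3) (f : A) : S.proj (S.d i f) = S.truncated.d i (S.proj f) :=
  (Derivation.liftOfSurjective_apply _ (S.d_mem_ideal i) f).symm

lemma proj_sig (a b : Fin 3) : S.proj (S.sig a b) = S.truncated.sig a b := by
  simp only [sig, map_sub, map_mul, proj_x]
  split_ifs <;> simp

lemma proj_D (μ : Fin 4) (f : A) : S.proj (S.D μ f) = S.truncated.D μ (S.proj f) := by
  refine Fin.cases ?_ (fun i => ?_) μ
  · exact proj_T f
  · simp only [D_succ, map_mul, proj_rho, proj_d]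

lemma truncated_rho_pow : S.truncated.rho ^ 4 = 0 := by
  rw [← proj_rho, ← map_pow]
  exact Ideal.Quotient.eq_zero_iff_mem.2 (Ideal.mem_span_singleton_self _)

lemma dvd_of_proj_eq {f g : A} (h : S.proj f = S.proj g) : S.rho ^ 4 ∣ f - g :=
  Ideal.mem_span_singleton.1 ((Ideal.Quotient.mk_eq_mk_iff_sub_mem f g).1 h)

/-- The metric modulo terms of fourth order. -/
def Bondi.truncated (B : S.Bondi) : S.truncated.Bondi where
  U := S.proj B.U
  P := S.proj B.P
  V := S.proj B.V
  W i := S.proj (B.W i)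
  w i := S.proj (B.w i)
  h i j := S.proj (B.h i j)
  k i j := S.proj (B.k i j)
  U_P := by rw [← map_mul, B.U_P, map_one]
  x_W := by simp only [← proj_x, ← map_mul, ← map_sum, B.x_W, map_zero]
  w_eq i := by simp only [B.w_eq, map_mul, map_sum]
  h_symm i j := by rw [B.h_symm]
  x_h j := by simp only [← proj_x, ← map_mul, ← map_sum, B.x_h, map_zero]
  k_symm i j := by rw [B.k_symm]
  x_k j := by simp only [← proj_x, ← map_mul, ← map_sum, B.x_k, map_zero]
  k_h i l := by simp only [← proj_sig, ← map_mul, ← map_sum, B.k_h]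
  k_T_h := by simp only [← proj_T, ← map_mul, ← map_sum, B.k_T_h, map_zero]
  k_d_h a := by simp only [← proj_d, ← map_mul, ← map_sum, B.k_d_h, map_zero]

namespace Bondi

variable {B : S.Bondi}

lemma proj_met (μ ν : Fin 4) : S.proj (B.met μ ν) = B.truncated.met μ ν := by
  refine Fin.cases ?_ (fun i => ?_) μ <;> refine Fin.cases ?_ (fun j => ?_) ν
  · simp only [met_zero_zero, g00, map_add, map_neg, map_mul, map_sum]
    rfl
  · simp only [met_zero_succ, b, map_add, map_neg, map_mul]
    rfl
  · simp only [met_succ_zero, b, map_add, map_neg, map_mul]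
    rfl
  · rfl

lemma proj_inv (μ ν : Fin 4) : S.proj (B.inv μ ν) = B.truncated.inv μ ν := by
  refine Fin.cases ?_ (fun i => ?_) μ <;> refine Fin.cases ?_ (fun j => ?_) ν
  · exact map_zero _
  · simp only [inv_zero_succ, map_neg, map_mul]
    rfl
  · simp only [inv_succ_zero, map_neg, map_mul]
    rfl
  · simp only [inv_succ_succ, map_add, map_mul]
    rfl

lemma proj_fourRicci (μ ν : Fin 4) : S.proj (fourRicci S.D B.met B.inv μ ν) =
    fourRicci S.truncated.D B.truncated.met B.truncated.inv μ ν := by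
  have h := map_fourRicci (S.proj : A →+* A ⧸ S.ideal) proj_D B.met B.inv μ ν
  simp only [AlgHom.coe_toRingHom, proj_met, proj_inv] at h
  exact h

/-- The expansion modulo terms of fourth order. -/
def Expansion.truncated (E : B.Expansion) : B.truncated.Expansion where
  m := S.proj E.m
  U2 := S.proj E.U2
  U3 := S.proj E.U3
  V2 := S.proj E.V2
  s := S.proj E.s
  C i j := S.proj (E.C i j)
  h3 i j := S.proj (E.h3 i j)
  W1 i := S.proj (E.W1 i)
  W2 i := S.proj (E.W2 i)
  W3 i := S.proj (E.W3 i)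
  U_eq := by
    have h := congrArg S.proj E.U_eq
    simp only [map_add, map_mul, map_pow, map_one, proj_rho] at h
    exact h
  V_eq := by
    have h := congrArg S.proj E.V_eq
    simp only [map_add, map_sub, map_mul, map_pow, map_one, map_ofNat, proj_rho] at h
    exact h
  W_eq i := by
    have h := congrArg S.proj (E.W_eq i)
    simp only [map_add, map_mul, map_pow, proj_rho] at h
    exact h
  h_eq i j := by
    have h := congrArg S.proj (E.h_eq i j)
    simp only [map_add, map_mul, map_pow, proj_rho, proj_sig] at h
    exact h
  C_symm i j := by rw [E.C_symm]
  x_C j := by simp only [← proj_x, ← map_mul, ← map_sum, E.x_C, map_zero]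
  x_W1 := by simp only [← proj_x, ← map_mul, ← map_sum, E.x_W1, map_zero]
  x_W2 := by simp only [← proj_x, ← map_mul, ← map_sum, E.x_W2, map_zero]
  radial_m := by simp only [← proj_x, ← proj_d, ← map_mul, ← map_sum, E.radial_m, map_zero]
  radial_U2 := by simp only [← proj_x, ← proj_d, ← map_mul, ← map_sum, E.radial_U2, map_zero]
  radial_C a b := by simp only [← proj_x, ← proj_d, ← map_mul, ← map_sum, E.radial_C, map_zero]
  radial_W1 a := by simp only [← proj_x, ← proj_d, ← map_mul, ← map_sum, E.radial_W1, map_zero]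
  radial_W2 a := by simp only [← proj_x, ← proj_d, ← map_mul, ← map_sum, E.radial_W2, map_zero]
  two_W1 i := by
    have h := congrArg S.proj (E.two_W1 i)
    simp only [map_mul, map_sum, map_ofNat, proj_d] at h
    exact h

namespace Expansion

variable (E : B.Expansion)

/-- In the quotient ring `rho ^ 4 = 0` holds, and an equality there is divisibility by `rho ^ 4`
upstairs. -/
lemma dvd_fourRicci_zero_zero : S.rho ^ 4 ∣ S.rho * fourRicci S.D B.met B.inv 0 0 - S.rho ^ 3 *
    (4 * ∑ k, S.d k (S.T (E.W1 k)) - 8 * S.T E.m -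
      ∑ j, ∑ k, S.T (E.C k j) * S.T (E.C k j)) := by
  apply dvd_of_proj_eq
  have h := E.truncated.rho_mul_fourRicci_zero_zero truncated_rho_pow
  rw [← proj_fourRicci] at h
  simp only [map_mul, proj_rho, h, map_pow, map_sub, map_sum, proj_d, proj_T, map_ofNat]
  rfl

lemma dvd_fourRicci_zero_succ (i : Fin 3) :
    S.rho ^ 4 ∣ fourRicci S.D B.met B.inv 0 i.succ - S.rho ^ 3 *
    (-2 * S.d i (S.T E.U2) - 6 * S.T (E.w2 i) + 2 * ∑ j, E.C i j * S.T (E.W1 j) + 4 * S.d i E.m +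
      2 * ∑ j, S.T (E.C i j) * E.W1 j - ∑ j, ∑ k, S.T (E.C k j) * S.d i (E.C k j) +
      S.x i * (8 * S.T E.U2 + ∑ j, ∑ k, S.T (E.C k j) * E.C k j) +
      2 * ∑ j, (S.d j (E.H i j) - 2 * S.x j * E.H i j)) := by
  apply dvd_of_proj_eq
  have h := E.truncated.fourRicci_zero_succ truncated_rho_pow i
  rw [← proj_fourRicci] at h
  have hw : ∀ i, S.proj (E.w2 i) = E.truncated.w2 i := fun i => by
    simp only [w2, map_add, map_sum, map_mul]
    rfl
  have hF : ∀ i j, S.proj (E.F i j) = E.truncated.F i j := fun i j => by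
    simp only [F, map_sub, map_mul, proj_d, proj_x]
    rfl
  have hH : ∀ i j, S.proj (E.H i j) = E.truncated.H i j := fun i j => by
    simp only [H, map_add, map_sub, map_mul, map_neg, map_sum, hF, proj_d, proj_T, proj_x,
      proj_sig, map_ofNat]
    rfl
  rw [h]
  simp only [map_mul, proj_rho, map_pow, map_add, map_sub, map_neg, map_sum, proj_d, proj_T, proj_x,
    map_ofNat, hw, hH]
  rfl

end Expansion

end Bondi

end Quotient

variable {S}

/-! ### Consequences of the determinant gauge -/

section Determinant

variable {h : Fin 3 → Fin 3 → A} (h_symm : ∀ i j, h i j = h j i)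
  (x_h : ∀ j, ∑ i, S.x i * h i j = 0)
  (det_h : (Matrix.of fun i j => h i j + S.x i * S.x j).det = 1)

include h_symm in
lemma adjugate_symm (i j : Fin 3) :
    (Matrix.of fun i j => h i j + S.x i * S.x j).adjugate i j =
      (Matrix.of fun i j => h i j + S.x i * S.x j).adjugate j i := by
  have h1 : (Matrix.of fun i j => h i j + S.x i * S.x j).transpose =
      Matrix.of fun i j => h i j + S.x i * S.x j := by
    ext i j
    simp [h_symm j i, mul_comm]
  rw [← Matrix.transpose_apply (Matrix.adjugate _), Matrix.adjugate_transpose, h1]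

include det_h in
lemma adjugate_mul (i l : Fin 3) :
    ∑ j, (Matrix.of fun i j => h i j + S.x i * S.x j).adjugate i j * (h j l + S.x j * S.x l) =
      if i = l then 1 else 0 := by
  have h1 := congrFun (congrFun (Matrix.adjugate_mul
    (Matrix.of fun i j => h i j + S.x i * S.x j)) i) l
  rw [det_h, one_smul, Matrix.mul_apply, Matrix.one_apply] at h1
  exact h1

include h_symm x_h det_h in
-- Since `h` annihilates `x`, the normal is an eigenvector of `h + x ⊗ x` with eigenvalue `1`, hence
-- also of its inverse, the adjugate.
lemma adjugate_mul_x (i : Fin 3) :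
    ∑ j, (Matrix.of fun i j => h i j + S.x i * S.x j).adjugate i j * S.x j = S.x i := by
  have h0 := adjugate_mul det_h i 0
  have h1 := adjugate_mul det_h i 1
  have h2 := adjugate_mul det_h i 2
  have hs := S.sum_sq
  have e : (if i = 0 then 1 else 0) * S.x 0 + (if i = 1 then 1 else 0) * S.x 1 +
      (if i = 2 then 1 else 0) * S.x 2 = S.x i := by fin_cases i <;> simp
  generalize (Matrix.of fun i j => h i j + S.x i * S.x j).adjugate i = a at *
  have y := x_h
  have y0 := y 0
  have y1 := y 1
  have y2 := y 2
  simp only [Fin.sum_univ_three, h_symm 1 0, h_symm 2 0, h_symm 2 1] at *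
  linear_combination S.x 0 * h0 + S.x 1 * h1 + S.x 2 * h2 + e - a 0 * y0 - a 1 * y1 - a 2 * y2 -
    (a 0 * S.x 0 + a 1 * S.x 1 + a 2 * S.x 2) * hs

include h_symm x_h det_h in
-- Jacobi's formula for the derivative of a determinant equal to `1`; the contributions of `x ⊗ x`
-- cancel by tangency of `h` and `∑ x i * x i = 1`.
lemma adjugate_contract_deriv (D : Derivation ℝ A A) :
    ∑ i, ∑ j, ((Matrix.of fun i j => h i j + S.x i * S.x j).adjugate i j - S.x i * S.x j) *
      D (h i j) = 0 := by
  have hD := congrArg D det_h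
  have ha : ∀ i j, (Matrix.of fun i j => h i j + S.x i * S.x j).adjugate i j * D (h i j) =
    (Matrix.of fun i j => h i j + S.x i * S.x j).adjugate i j * (D (h i j + S.x i * S.x j) -
      S.x i * D (S.x j) - S.x j * D (S.x i)) := fun i j => by
    simp only [map_add, Derivation.leibniz, smul_eq_mul]
    ring
  have x0 := adjugate_mul_x h_symm x_h det_h 0
  have x1 := adjugate_mul_x h_symm x_h det_h 1
  have x2 := adjugate_mul_x h_symm x_h det_h 2
  have s01 := adjugate_symm (S := S) h_symm 1 0
  have s02 := adjugate_symm (S := S) h_symm 2 0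
  have s12 := adjugate_symm (S := S) h_symm 2 1
  have hx : ∀ j, ∑ i, (S.x i * D (h i j) + h i j * D (S.x i)) = 0 := fun j => by
    have := congrArg D (x_h j)
    simpa only [map_sum, Derivation.leibniz, smul_eq_mul, map_zero] using this
  have hsq : ∑ i, 2 * (S.x i * D (S.x i)) = 0 := by
    have := congrArg D S.sum_sq
    simpa only [map_sum, Derivation.leibniz, smul_eq_mul, Derivation.map_one_eq_zero, two_mul]
      using this
  have hdet : ∑ i, ∑ j, (Matrix.of fun i j => h i j + S.x i * S.x j).adjugate i j *
      D (h i j + S.x i * S.x j) = 0 := by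
    have hm : ∀ i j, h i j + S.x i * S.x j = h j i + S.x j * S.x i := fun i j => by
      rw [h_symm, mul_comm]
    obtain ⟨M, hM⟩ : ∃ M : Fin 3 → Fin 3 → A, ∀ i j, h i j + S.x i * S.x j = M i j :=
      ⟨_, fun _ _ => rfl⟩
    simp only [hM] at *
    clear ha x0 x1 x2 s01 s02 s12
    rw [Matrix.adjugate_fin_three]
    rw [Matrix.det_fin_three] at hD
    simp [Fin.sum_univ_three, Derivation.leibniz, hm 1 0, hm 2 0, hm 2 1] at hD ⊢
    linear_combination hD
  have y0 := hx 0
  have y1 := hx 1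
  have y2 := hx 2
  have z0 := x_h 0
  have z1 := x_h 1
  have z2 := x_h 2
  simp only [sub_mul, Finset.sum_sub_distrib, ha]
  clear hD ha
  generalize (Matrix.of fun i j => h i j + S.x i * S.x j).adjugate = a at *
  simp only [Fin.sum_univ_three, s01, s02, s12, h_symm 1 0, h_symm 2 0, h_symm 2 1] at *
  linear_combination hdet - 2 * D (S.x 0) * x0 - 2 * D (S.x 1) * x1 - 2 * D (S.x 2) * x2 - hsq -
    S.x 0 * y0 - S.x 1 * y1 - S.x 2 * y2 + D (S.x 0) * z0 + D (S.x 1) * z1 + D (S.x 2) * z2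

end Determinant

/-- The metric determined by `U`, `V`, `W` and `h` when `h` has unit determinant in the tangential
directions. -/
def Bondi.ofDet (U P V : A) (W : Fin 3 → A) (h : Fin 3 → Fin 3 → A) (U_P : U * P = 1)
    (x_W : ∑ i, S.x i * W i = 0) (h_symm : ∀ i j, h i j = h j i)
    (x_h : ∀ j, ∑ i, S.x i * h i j = 0)
    (det_h : (Matrix.of fun i j => h i j + S.x i * S.x j).det = 1) : S.Bondi where
  U := U
  P := P
  V := V
  W := W
  w i := ∑ j, h i j * W j
  h := h
  k i j := (Matrix.of fun i j => h i j + S.x i * S.x j).adjugate i j - S.x i * S.x j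
  U_P := U_P
  x_W := x_W
  w_eq i := rfl
  h_symm := h_symm
  x_h := x_h
  k_symm i j := by rw [adjugate_symm h_symm, mul_comm]
  x_k j := by
    have h1 := adjugate_mul_x h_symm x_h det_h j
    have h2 := S.sum_sq
    simp only [adjugate_symm (S := S) h_symm _ j, Fin.sum_univ_three] at *
    linear_combination h1 - S.x j * h2
  k_h i l := by
    have h1 := adjugate_mul_x h_symm x_h det_h i
    have h2 := S.sum_sq
    have h3 := adjugate_mul det_h i l
    have h4 := x_h l
    simp only [sig, Fin.sum_univ_three] at *
    linear_combination h3 - S.x l * h1 - S.x i * h4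
  k_T_h := adjugate_contract_deriv h_symm x_h det_h S.T
  k_d_h a := adjugate_contract_deriv h_symm x_h det_h (S.d a)

end ScriCalculus

/-! ### The Ricci tensor of a metric on spacetime -/

namespace ParamDomain
variable {P : ParamDomain}

variable (P) in
/-- Fields that depend on the retarded time and on `rho = 1 / r`. -/
def scri : ScriCalculus P.smooth where
  x := coord
  rho := sndParam
  T := dFst
  -- This is `r` times the spatial derivative: the angular gradient, plus the derivative in `rho`,
  -- for which `∂_a rho = -rho ^ 2 * x a`.
  d a := d a - (coord a * sndParam : P.smooth) • dSnd
  sum_sq := sum_coord_sq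
  d_x a b := by
    change d a (coord b) - coord a * sndParam * dSnd (coord b) = _
    rw [d_coord, dSnd_coord, mul_zero, sub_zero]
  T_x := dFst_coord
  T_rho := dFst_sndParam
  d_rho a := by
    change d a sndParam - coord a * sndParam * dSnd sndParam = _
    rw [d_sndParam, dSnd_sndParam]
    ring
  T_d a f := by
    change dFst (d a f - coord a * sndParam * dSnd f) =
      d a (dFst f) - coord a * sndParam * dSnd (dFst f)
    simp only [map_sub, Derivation.leibniz, dFst_d, dFst_dSnd, dFst_coord, dFst_sndParam,
      smul_eq_mul]
    ring

lemma scri_d (a : Fin 3) (f : P.smooth) :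
    P.scri.d a f = d a f - coord a * sndParam * dSnd f := rfl

/-- Evaluation of fields at a point. -/
def evalAt (q : P.carrier × S2) : P.smooth →ₐ[ℝ] ℝ :=
  (Pi.evalAlgHom ℝ (fun _ : P.carrier × S2 => ℝ) q).comp P.smooth.val

/-- A field as a function on spacetime. -/
def lift4 (f : P.smooth) (z : Fin 4 → ℝ) : ℝ :=
  P.ext f ((z 0, ‖spacePart z‖⁻¹), spacePart z)

variable (P) in
/-- The points of spacetime with parameters in the interior of the domain. -/
def region : Set (Fin 4 → ℝ) :=
  {z | spacePart z ≠ 0 ∧ (z 0, ‖spacePart z‖⁻¹) ∈ interior P.carrier}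

/-- The linear map `spacePart`. -/
def spaceCLM : (Fin 4 → ℝ) →L[ℝ] E3 :=
  (EuclideanSpace.equiv (Fin 3) ℝ).symm.toContinuousLinearMap.comp
    (ContinuousLinearMap.pi fun i => ContinuousLinearMap.proj i.succ)

lemma spaceCLM_apply (z : Fin 4 → ℝ) : spaceCLM z = spacePart z := rfl

lemma isOpen_region : IsOpen P.region := by
  have h1 : Continuous fun z => spacePart z := spaceCLM.continuous
  have h2 : IsOpen {z | spacePart z ≠ 0} := isOpen_compl_singleton.preimage h1
  have h3 : ContinuousOn (fun z : Fin 4 → ℝ => (z 0, ‖spacePart z‖⁻¹)) {z | spacePart z ≠ 0} :=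
    ContinuousOn.prodMk (continuous_apply 0).continuousOn
      (h1.norm.continuousOn.inv₀ fun z hz => norm_ne_zero_iff.2 hz)
  exact h3.isOpen_inter_preimage h2 isOpen_interior

lemma lift4_eq (f : P.smooth) {z : Fin 4 → ℝ} (hz : z ∈ P.region) : lift4 f z =
    evalAt (⟨(z 0, ‖spacePart z‖⁻¹), interior_subset hz.2⟩, toS2 (spacePart z)) f :=
  ext_pair _ _ _

lemma hasFDerivAt_norm_inv {y : E3} (hy : y ≠ 0) :
    HasFDerivAt (fun y : E3 => ‖y‖⁻¹) (-(‖y‖ ^ 3)⁻¹ • innerSL ℝ y) y := by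
  have hy' : 0 < ‖y‖ := norm_pos_iff.2 hy
  have h := (hasStrictFDerivAt_norm_sq (F := E3) y).hasFDerivAt.sqrt (by positivity)
  simp only [Real.sqrt_sq (norm_nonneg _)] at h
  have h2 := HasDerivAt.comp_hasFDerivAt (f := fun y : E3 => ‖y‖) y
    (hasDerivAt_inv (x := ‖y‖) hy'.ne') h
  refine h2.congr_fderiv ?_
  ext v
  simp
  field_simp

/-- The chain rule through `(u, y) ↦ (u, 1 / ‖y‖, y / ‖y‖)`. It identifies coordinate derivatives on
spacetime with the derivations `D` of the ring. -/
lemma pderiv4_lift4 (f : P.smooth) {z : Fin 4 → ℝ} (hz : z ∈ P.region) (μ : Fin 4) :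
    pderiv4 (lift4 f) z μ = lift4 (P.scri.D μ f) z := by
  obtain ⟨hy, hp⟩ := hz
  have hy' : 0 < ‖spacePart z‖ := norm_pos_iff.2 hy
  set p : ℝ × ℝ := (z 0, ‖spacePart z‖⁻¹) with hpdef
  have hmem : (p, spacePart z) ∈ P.cone := mem_cone.2 ⟨interior_subset hp, hy⟩
  have hnhds : P.cone ∈ nhds (p, spacePart z) := by
    refine mem_interior_iff_mem_nhds.1 ?_
    rw [cone, interior_prod_eq, isOpen_compl_singleton.interior_eq]
    exact ⟨hp, hy⟩
  have h1 : HasFDerivAt (P.ext f) (fderivWithin ℝ (P.ext f) P.cone (p, spacePart z))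
      (p, spacePart z) :=
    (((contDiffOn_ext f).differentiableOn (by simp) _ hmem).hasFDerivWithinAt).hasFDerivAt hnhds
  have h2 : HasFDerivAt (fun z => spacePart z) spaceCLM z := spaceCLM.hasFDerivAt
  have h3 : HasFDerivAt (fun z : Fin 4 → ℝ => ((z 0, ‖spacePart z‖⁻¹), spacePart z)) _ z :=
    ((ContinuousLinearMap.proj (R := ℝ) (φ := fun _ : Fin 4 => ℝ) 0).hasFDerivAt.prodMk
      ((hasFDerivAt_norm_inv hy).comp z h2)).prodMk h2
  have h4 := HasFDerivAt.comp (g := P.ext f) z h1 h3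
  rw [pderiv4, show lift4 f = P.ext f ∘ fun z : Fin 4 → ℝ => ((z 0, ‖spacePart z‖⁻¹), spacePart z)
    from rfl, h4.fderiv]
  refine Fin.cases ?_ (fun i => ?_) μ
  · rw [ScriCalculus.D_zero]
    change _ = P.ext (deriv ((1, 0), 0) f : P.smooth) (p, spacePart z)
    rw [ext_deriv _ _ hmem]
    have : spaceCLM (Pi.single 0 1) = 0 := by
      ext i
      simp [spaceCLM_apply, spacePart]
    simp [this]
  · have hs : spaceCLM (Pi.single i.succ 1) = EuclideanSpace.single i (1 : ℝ) := by
      ext j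
      simp [spaceCLM_apply, spacePart, Pi.single_apply]
    have e1 := ext_deriv (0, EuclideanSpace.single i 1) f hmem
    have e2 := ext_deriv ((0, 1), 0) f hmem
    rw [ext_pair _ (interior_subset hp)] at e1 e2
    have hl : lift4 (P.scri.D i.succ f) z = ‖spacePart z‖⁻¹ *
        ((d i f).1 (⟨p, interior_subset hp⟩, toS2 (spacePart z)) -
        (‖spacePart z‖⁻¹ * spacePart z i) * ‖spacePart z‖⁻¹ *
          (dSnd f).1 (⟨p, interior_subset hp⟩, toS2 (spacePart z))) := by
      rw [lift4, ← hpdef, ext_pair _ (interior_subset hp), ScriCalculus.D_succ, scri_d]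
      have : (toS2 (spacePart z)).1 i = ‖spacePart z‖⁻¹ * spacePart z i := by
        rw [toS2_coe hy]
        simp
      rw [← this]
      rfl
    rw [hl, d, dSnd, e1, e2]
    simp only [ContinuousLinearMap.comp_apply, ContinuousLinearMap.prod_apply, hs]
    have hv : ∀ a : ℝ, (((0 : ℝ), a), EuclideanSpace.single i (1 : ℝ)) = 
        ‖spacePart z‖⁻¹ • ((0 : ℝ × ℝ), ‖spacePart z‖ • EuclideanSpace.single i (1 : ℝ)) +
        a • (((0 : ℝ), (1 : ℝ)), (0 : E3)) := fun a => by
      simp [smul_smul, hy'.ne']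
    have h0 : ContinuousLinearMap.proj (R := ℝ) (φ := fun _ : Fin 4 => ℝ) 0
        (Pi.single i.succ 1) = 0 := by simp
    rw [h0, hv, map_add, map_smul, map_smul, smul_zero]
    simp only [smul_apply, smul_eq_mul, innerSL_apply_apply, inner_single]
    field_simp
    ring

/-- The Ricci tensor in terms of fields. -/
lemma four_mul_ricci {g : (Fin 4 → ℝ) → Matrix (Fin 4) (Fin 4) ℝ} {met inv : Fin 4 → Fin 4 → P.smooth}
    (hg : ∀ w ∈ P.region, ∀ μ ν, g w μ ν = lift4 (met μ ν) w)
    (hinv : ∀ μ ν, ∑ κ, inv μ κ * met κ ν = if μ = ν then 1 else 0)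
    {z : Fin 4 → ℝ} (hz : z ∈ P.region) (μ ν : Fin 4) :
    4 * ricci g z μ ν = lift4 (fourRicci P.scri.D met inv μ ν) z := by
  have hi : ∀ w ∈ P.region, ∀ l κ, (g w)⁻¹ l κ = lift4 (inv l κ) w := fun w hw l κ => by
    have : (g w)⁻¹ = Matrix.of fun l κ => lift4 (inv l κ) w := by
      refine Matrix.inv_eq_left_inv ?_
      ext a b
      rw [Matrix.mul_apply, Matrix.one_apply]
      simp only [Matrix.of_apply, hg w hw, lift4_eq _ hw, ← map_mul, ← map_sum, hinv]
      split_ifs <;> simp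
    rw [this, Matrix.of_apply]
  -- Agreement on the open region suffices for differentiation; nothing is assumed about the metric
  -- outside it.
  have hpd : ∀ {F : (Fin 4 → ℝ) → ℝ} {f : P.smooth}, (∀ w ∈ P.region, F w = lift4 f w) →
      ∀ w ∈ P.region, ∀ μ, pderiv4 F w μ = lift4 (P.scri.D μ f) w := fun {F f} hF w hw μ => by
    have he : F =ᶠ[nhds w] lift4 f := by
      filter_upwards [isOpen_region.mem_nhds hw] with v hv using hF v hv
    rw [← pderiv4_lift4 f hw, pderiv4, pderiv4, he.fderiv_eq]
  have hc : ∀ w ∈ P.region, ∀ l μ ν,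
      christoffel g w l μ ν = lift4 ((2⁻¹ : ℝ) • twoChr P.scri.D met inv l μ ν) w :=
    fun w hw l μ ν => by
      have h1 : ∀ a b c, pderiv4 (fun w => g w a b) w c = lift4 (P.scri.D c (met a b)) w :=
        fun a b c => hpd (fun w hw => hg w hw a b) w hw c
      simp only [christoffel, twoChr, lowChr, h1, hi w hw, lift4_eq _ hw, map_smul, map_sum, map_mul,
        map_sub, map_add, Finset.smul_sum, smul_eq_mul]
      exact Finset.sum_congr rfl fun κ _ => by ring
  have hdc : ∀ l μ ν κ, pderiv4 (fun w => christoffel g w l μ ν) z κ =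
      2⁻¹ * lift4 (P.scri.D κ (twoChr P.scri.D met inv l μ ν)) z := fun l μ ν κ => by
    rw [hpd (fun w hw => hc w hw l μ ν) z hz κ, Derivation.map_smul]
    simp only [lift4_eq _ hz, map_smul, smul_eq_mul]
  rw [ricci]
  simp only [hdc, hc z hz, fourRicci, lift4_eq _ hz, map_smul, map_sum, map_mul, map_sub, map_add,
    smul_eq_mul, map_ofNat]
  simp only [Fin.sum_univ_four]
  ring

end ParamDomain

/-! ### Smooth functions on the sphere and smooth fields -/

/-- Smoothness of the radial projection turns functions smooth on the manifold `S2` into smooth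
functions on punctured space that are constant along rays. -/
lemma contMDiffOn_toS2 : ContMDiffOn 𝓘(ℝ, E3) (𝓡 2) ∞ toS2 {0}ᶜ := by
  intro y hy
  let U : TopologicalSpace.Opens E3 := ⟨{0}ᶜ, isOpen_compl_singleton⟩
  have : Fact (Module.finrank ℝ E3 = 2 + 1) := ⟨by simp⟩
  have hf : ContMDiff 𝓘(ℝ, E3) 𝓘(ℝ, E3) ∞ fun z : U => (toS2 z.1 : E3) := fun z => by
    have hz : z.1 ≠ 0 := z.2
    rw [contMDiffAt_subtype_iff (f := fun y : E3 => (toS2 y : E3))]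
    have : ContDiffAt ℝ ∞ (fun y : E3 => ‖y‖⁻¹ • y) z.1 :=
      ((contDiffAt_norm ℝ hz).inv (norm_ne_zero_iff.2 hz)).smul contDiffAt_id
    refine (this.congr_of_eventuallyEq ?_).contMDiffAt
    filter_upwards [isOpen_compl_singleton.mem_nhds hz] with w hw using toS2_coe hw
  have h2 := hf.codRestrict_sphere (n := 2) fun z => (toS2 z.1).2
  have h3 := (contMDiffAt_subtype_iff (U := U) (f := toS2) (x := ⟨y, hy⟩)).1 (h2 ⟨y, hy⟩)
  exact h3.contMDiffWithinAt

lemma contDiffOn_of_smoothOnScri {I : Set ℝ} {f : ℝ → S2 → ℝ} (hf : SmoothOnScri I f) :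
    ContDiffOn ℝ ∞ (fun q : (ℝ × ℝ) × E3 => f q.1.1 (toS2 q.2)) {q | q.1.1 ∈ I ∧ q.2 ≠ 0} := by
  rw [← contMDiffOn_iff_contDiffOn]
  refine ContMDiffOn.comp (g := fun p : ℝ × S2 => f p.1 p.2)
    (f := fun q : (ℝ × ℝ) × E3 => (q.1.1, toS2 q.2)) hf ?_ fun q hq => hq.1
  refine ContMDiffOn.prodMk ?_ ?_
  · exact (ContDiff.contDiffOn (by fun_prop)).contMDiffOn
  · exact contMDiffOn_toS2.comp (ContDiff.contDiffOn (by fun_prop)).contMDiffOn fun q hq => hq.2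

lemma contDiffOn_of_smoothUpToScri {I : Set ℝ} {R : ℝ → ℝ} {f : ℝ → ℝ → S2 → ℝ}
    (hf : SmoothUpToScri I R f) :
    ContDiffOn ℝ ∞ (fun q : (ℝ × ℝ) × E3 => f q.1.1 q.1.2 (toS2 q.2))
      {q | (q.1.1 ∈ I ∧ 0 ≤ q.1.2 ∧ q.1.2 * R q.1.1 < 1) ∧ q.2 ≠ 0} := by
  rw [← contMDiffOn_iff_contDiffOn]
  refine ContMDiffOn.comp (g := fun p : (ℝ × ℝ) × S2 => f p.1.1 p.1.2 p.2)
    (f := fun q : (ℝ × ℝ) × E3 => ((q.1.1, q.1.2), toS2 q.2)) hf ?_ fun q hq => hq.1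
  refine ContMDiffOn.prodMk (ContMDiffOn.prodMk ?_ ?_) ?_
  · exact (ContDiff.contDiffOn (by fun_prop)).contMDiffOn
  · exact (ContDiff.contDiffOn (by fun_prop)).contMDiffOn
  · exact contMDiffOn_toS2.comp (ContDiff.contDiffOn (by fun_prop)).contMDiffOn fun q hq => hq.2

lemma contDiffOn_of_contMDiff {f : S2 → ℝ} (hf : ContMDiff (𝓡 2) 𝓘(ℝ, ℝ) ∞ f) :
    ContDiffOn ℝ ∞ (fun q : (ℝ × ℝ) × E3 => f (toS2 q.2)) {q | q.2 ≠ 0} := by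
  rw [← contMDiffOn_iff_contDiffOn]
  exact hf.comp_contMDiffOn
    (contMDiffOn_toS2.comp (ContDiff.contDiffOn (by fun_prop)).contMDiffOn fun q hq => hq)

/-! ### Passing from the vacuum equations to coefficients at null infinity -/

namespace ParamDomain

variable {P : ParamDomain}

/-- Away from null infinity `rho` is invertible, and the interior parameters are dense, so `rho` is
not a zero divisor. -/
lemma eq_zero_of_rho_pow_mul (hP : ∀ p ∈ interior P.carrier, p.2 ≠ 0) {n : ℕ} {f : P.smooth}
    (h : sndParam ^ n * f = 0) : f = 0 := by
  refine eq_zero_of_interior f fun p hp x => ?_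
  have h1 : (sndParam ^ n * f : P.smooth).1 (p, x) = 0 := by rw [h]; rfl
  have h2 : p.1.2 ^ n * f.1 (p, x) = 0 := h1
  exact (mul_eq_zero.1 h2).resolve_left (pow_ne_zero _ (hP _ hp))

/-- The common factor `rho ^ 3` is cancelled, and what remains is evaluated at `rho = 0`. -/
lemma eq_zero_of_dvd (hP : ∀ p ∈ interior P.carrier, p.2 ≠ 0) {f : P.smooth}
    (h : sndParam ^ 4 ∣ 0 - sndParam ^ 3 * f) {p : P.carrier} (hp : p.1.2 = 0) (x : S2) :
    f.1 (p, x) = 0 := by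
  obtain ⟨K, hK⟩ := h
  have h1 : f + sndParam * K = 0 := eq_zero_of_rho_pow_mul hP (n := 3) (by linear_combination -hK)
  have h2 : (f + sndParam * K : P.smooth).1 (p, x) = 0 := by rw [h1]; rfl
  have h3 : f.1 (p, x) + p.1.2 * K.1 (p, x) = 0 := h2
  simpa [hp] using h3

/-- The point of spacetime with given parameters. -/
def spacetimePoint (p : ℝ × ℝ) (x : S2) : Fin 4 → ℝ := Fin.cons p.1 fun i => p.2⁻¹ * x.1 i

lemma spacePart_spacetimePoint (p : ℝ × ℝ) (x : S2) :
    spacePart (spacetimePoint p x) = p.2⁻¹ • x.1 := by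
  ext i
  simp [spacePart, spacetimePoint]

lemma norm_spacePart_spacetimePoint {p : ℝ × ℝ} (hp : 0 < p.2) (x : S2) :
    ‖spacePart (spacetimePoint p x)‖ = p.2⁻¹ := by
  rw [spacePart_spacetimePoint, norm_smul, Real.norm_of_nonneg (by positivity)]
  simp

lemma eq_zero_of_lift4 (hP : ∀ p ∈ interior P.carrier, 0 < p.2) {f : P.smooth}
    (h : ∀ z ∈ P.region, lift4 f z = 0) : f = 0 := by
  refine eq_zero_of_interior f fun p hp x => ?_
  have hp2 := hP _ hp
  have e1 := spacePart_spacetimePoint p.1 x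
  have e2 := norm_spacePart_spacetimePoint hp2 x
  have e0 : spacetimePoint p.1 x 0 = p.1.1 := rfl
  have hz : spacetimePoint p.1 x ∈ P.region := by
    refine ⟨?_, ?_⟩
    · rw [← norm_ne_zero_iff, e2]
      positivity
    · rw [e2, e0, inv_inv]
      exact hp
  have := h _ hz
  rw [lift4, e2, e0, inv_inv, ext_pair _ p.2, e1, toS2_smul (by positivity), toS2_self] at this
  exact this

/-- The leading coefficients of the vacuum equations. -/
lemma vacuum_coefficients (hP : ∀ p ∈ interior P.carrier, 0 < p.2) {B : P.scri.Bondi}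
    (E : B.Expansion) {g : (Fin 4 → ℝ) → Matrix (Fin 4) (Fin 4) ℝ}
    (hg : ∀ w ∈ P.region, ∀ μ ν, g w μ ν = lift4 (B.met μ ν) w)
    (hr : ∀ z ∈ P.region, ∀ μ ν, ricci g z μ ν = 0) {p : P.carrier} (hp : p.1.2 = 0) (x : S2) :
    (4 * ∑ k, P.scri.d k (P.scri.T (E.W1 k)) - 8 * P.scri.T E.m -
      ∑ j, ∑ k, P.scri.T (E.C k j) * P.scri.T (E.C k j)).1 (p, x) = 0 ∧
    ∀ i, (-2 * P.scri.d i (P.scri.T E.U2) - 6 * P.scri.T (E.w2 i) +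
      2 * ∑ j, E.C i j * P.scri.T (E.W1 j) + 4 * P.scri.d i E.m +
      2 * ∑ j, P.scri.T (E.C i j) * E.W1 j - ∑ j, ∑ k, P.scri.T (E.C k j) * P.scri.d i (E.C k j) +
      P.scri.x i * (8 * P.scri.T E.U2 + ∑ j, ∑ k, P.scri.T (E.C k j) * E.C k j) +
      2 * ∑ j, (P.scri.d j (E.H i j) - 2 * P.scri.x j * E.H i j)).1 (p, x) = 0 := by
  have h : ∀ μ ν, fourRicci P.scri.D B.met B.inv μ ν = 0 := fun μ ν =>
    eq_zero_of_lift4 hP fun z hz => by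
      rw [← four_mul_ricci hg B.inv_mul_met hz, hr z hz, mul_zero]
  have hP' : ∀ p ∈ interior P.carrier, p.2 ≠ 0 := fun p hp => (hP p hp).ne'
  refine ⟨?_, fun i => ?_⟩
  · have := E.dvd_fourRicci_zero_zero
    rw [h, mul_zero] at this
    exact eq_zero_of_dvd hP' this hp x
  · have := E.dvd_fourRicci_zero_succ i
    rw [h] at this
    exact eq_zero_of_dvd hP' this hp x

end ParamDomain

/-! ### Tensor calculus on the sphere in terms of fields -/

namespace SphereCalculus

variable {A B : Type*} [CommRing A] [Algebra ℝ A] [CommRing B] [Algebra ℝ B]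
  {S : SphereCalculus A} {S' : SphereCalculus B} {φ : A →ₐ[ℝ] B}

lemma map_eps (hx : ∀ a, φ (S.x a) = S'.x a) (a b : Fin 3) : φ (S.eps a b) = S'.eps a b := by
  fin_cases a <;> fin_cases b <;> simp [eps, hx]

lemma map_flux (hx : ∀ a, φ (S.x a) = S'.x a) (hd : ∀ a f, φ (S.d a f) = S'.d a (φ f)) (m : A)
    (C N : Fin 3 → Fin 3 → A) (i : Fin 3) : φ (S.flux m C N i) =
      S'.flux (φ m) (fun a b => φ (C a b)) (fun a b => φ (N a b)) i := by
  simp only [flux, evol, dot, curl, dv, map_sub, map_add, map_mul, map_sum, hx, hd, map_ofNat]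

lemma sum_mul_sig (v : Fin 3 → A) (b : Fin 3) :
    ∑ c, v c * ((if c = b then 1 else 0) - S.x c * S.x b) = v b - (∑ c, v c * S.x c) * S.x b := by
  simp only [mul_sub, Finset.sum_sub_distrib, mul_ite, mul_one, mul_zero, Finset.sum_ite_eq',
    Finset.mem_univ, if_true, Finset.sum_mul, mul_assoc]

lemma sum_d_mul_x {v : Fin 3 → A} (hv : ∑ c, v c * S.x c = 0) (a : Fin 3) :
    ∑ c, S.d a (v c) * S.x c = -v a := by
  have h1 : S.d a (∑ c, v c * S.x c) = 0 := by rw [hv, map_zero]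
  have h2 : ∑ c, v c * ((if a = c then 1 else 0) - S.x a * S.x c) = v a := by
    simp only [mul_sub, Finset.sum_sub_distrib, mul_ite, mul_one, mul_zero, Finset.sum_ite_eq,
      Finset.mem_univ, if_true, mul_left_comm _ (S.x a), ← Finset.mul_sum, hv, sub_zero]
  simp only [map_sum, Derivation.leibniz, smul_eq_mul, S.d_x, Finset.sum_add_distrib, h2] at h1
  simp only [mul_comm _ (S.x _)]
  exact eq_neg_of_add_eq_zero_right h1

/-- Relates the projected derivative `nabla1` to plain component derivatives: the projection only
adds `v a * x b`, because `x · d a v = -v a`. -/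
lemma sum_d_mul_sig {v : Fin 3 → A} (hv : ∑ c, v c * S.x c = 0) (a b : Fin 3) :
    ∑ c, S.d a (v c) * ((if c = b then 1 else 0) - S.x c * S.x b) = S.d a (v b) + v a * S.x b := by
  rw [sum_mul_sig, sum_d_mul_x hv, neg_mul, sub_neg_eq_add]

lemma sum_d_mul_x_comm (f : A) : ∑ c, S.d c f * S.x c = 0 := by
  simpa only [mul_comm] using S.radial f

/-- Identifies the projected divergence `div2` with `dv`. One projection is trivial on a tangential
derivative, and the other adds the trace of `C` times the normal, which is zero. -/
lemma IsSTT.sum_d_mul_sig_sig {C : Fin 3 → Fin 3 → A} (hC : S.IsSTT C) (a : Fin 3) :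
    ∑ b, ∑ c, ∑ e, S.d b (C c e) * ((if c = b then 1 else 0) - S.x c * S.x b) *
      ((if e = a then 1 else 0) - S.x e * S.x a) = S.dv C a := by
  have h1 : ∀ c e, ∑ b, S.d b (C c e) * ((if c = b then 1 else 0) - S.x c * S.x b) =
      S.d c (C c e) := fun c e => by
    have := sum_mul_sig (S := S) (fun b => S.d b (C c e)) c
    simp only [sum_d_mul_x_comm, zero_mul, sub_zero] at this
    rw [← this]
    refine Finset.sum_congr rfl fun b _ => ?_
    rw [mul_comm (S.x c)]
    simp only [eq_comm]
  have h2 : ∀ c, ∑ b, ∑ e, S.d b (C c e) * ((if c = b then 1 else 0) - S.x c * S.x b) *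
      ((if e = a then 1 else 0) - S.x e * S.x a) = S.d c (C c a) + C c c * S.x a := fun c => by
    rw [Finset.sum_comm, ← sum_d_mul_sig (hC.tangent c)]
    exact Finset.sum_congr rfl fun e _ => by rw [← h1 c e, Finset.sum_mul]
  rw [Finset.sum_comm, Finset.sum_congr rfl fun c _ => h2 c, Finset.sum_add_distrib,
    ← Finset.sum_mul, hC.trace, zero_mul, add_zero]
  rfl

/-- The dual of a traceless Hessian is already symmetric, so `pot` agrees with the symmetrized
formula in `tensorOfPotentials`; the trace terms cancel since `eps` is antisymmetric. -/
lemma two_mul_pot (f g : A) (a b : Fin 3) : 2 * S.pot f g a b =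
    2 * (2 * (S.d a (S.d b f) + S.x b * S.d a f) -
      ((if a = b then 1 else 0) - S.x a * S.x b) * S.lap f +
      (∑ e, S.eps a e * (S.d e (S.d b g) + S.x b * S.d e g) +
        ∑ e, S.eps b e * (S.d e (S.d a g) + S.x a * S.d e g))) := by
  have h : ∀ a b, S.star (S.hess0 g) a b =
      2 * ∑ e, S.eps a e * (S.d e (S.d b g) + S.x b * S.d e g) - S.eps a b * S.lap g := fun a b => by
    have h2 := S.eps_x a
    have h3 := sum_mul_sig (S := S) (S.eps a) b
    have h4 : ∑ e, S.eps a e * S.x e = 0 := by simpa only [Fin.sum_univ_three] using h2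
    rw [h4, zero_mul, sub_zero] at h3
    rw [← h3, Finset.mul_sum, Finset.sum_mul, ← Finset.sum_sub_distrib, star]
    exact Finset.sum_congr rfl fun e _ => by rw [hess0]; ring
  have h1 := (star_isSTT (hess0_isSTT (S := S) g)).symm a b
  have h2 := h b a
  have h3 := h a b
  have h4 := S.eps_swap a b
  rw [pot, hess0]
  linear_combination h1 + h2 + h3 - S.lap g * h4 

end SphereCalculus

namespace ParamDomain

variable {P : ParamDomain}

variable (P) in
/-- Tensor calculus on the sphere for fields depending on parameters. -/
def sphere : SphereCalculus P.smooth where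
  x := coord
  d := d
  sum_sq := sum_coord_sq
  d_x := d_coord
  comm := d_comm
  radial := sum_coord_d

/-- The field given by a function that is smooth on `I × S²`. -/
def field {I : Set ℝ} (hP : ∀ p ∈ P.carrier, p.1 ∈ I) {f : ℝ → S2 → ℝ} (hf : SmoothOnScri I f) :
    P.smooth :=
  ⟨fun q => f q.1.1.1 q.2, mem_smooth _
    ((contDiffOn_of_smoothOnScri hf).mono fun _ hq => ⟨hP _ hq.1, hq.2⟩) fun _ _ _ => rfl⟩

/-- The field given by a function that is smooth up to null infinity. -/
def fieldUpToScri {I : Set ℝ} {R : ℝ → ℝ}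
    (hP : ∀ p ∈ P.carrier, p.1 ∈ I ∧ 0 ≤ p.2 ∧ p.2 * R p.1 < 1) {f : ℝ → ℝ → S2 → ℝ}
    (hf : SmoothUpToScri I R f) : P.smooth :=
  ⟨fun q => f q.1.1.1 q.1.1.2 q.2, mem_smooth _
    ((contDiffOn_of_smoothUpToScri hf).mono fun _ hq => ⟨hP _ hq.1, hq.2⟩) fun _ _ _ => rfl⟩

/-- The field given by a smooth function on the sphere. -/
def constField {f : S2 → ℝ} (hf : ContMDiff (𝓡 2) 𝓘(ℝ, ℝ) ∞ f) : P.smooth :=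
  ⟨fun q => f q.2, mem_smooth _ ((contDiffOn_of_contMDiff hf).mono fun _ hq => hq.2)
    fun _ _ _ => rfl⟩

lemma exists_mul_eq_one (f : P.smooth) (h : ∀ p x, f.1 (p, x) ≠ 0) : ∃ g : P.smooth, f * g = 1 :=
  ⟨⟨fun q => (f.1 q)⁻¹, mem_smooth (fun q => (P.ext f q)⁻¹)
    ((contDiffOn_ext f).inv fun q hq => by rw [ext_apply _ hq.1]; exact h _ _)
    fun p y _ => by rw [ext_pair _ p.2]⟩, smooth_ext fun p x => mul_inv_cancel₀ (h p x)⟩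

variable {p : P.carrier}

lemma eps_eq (x : S2) (a b : Fin 3) : eps x a b = (P.sphere.eps a b).1 (p, x) := by
  fin_cases a <;> fin_cases b <;>
    simp [eps, SphereCalculus.eps, leviCivita, Fin.sum_univ_three, sphere] <;> norm_num

lemma grad_eq {f : S2 → ℝ} {F : P.smooth} (hf : ∀ x, f x = F.1 (p, x)) (x : S2) (a : Fin 3) :
    grad f x a = (P.sphere.d a F).1 (p, x) := by
  rw [show f = fun x => F.1 (p, x) from funext hf, grad_slice]
  rfl

lemma sum_apply {ι : Type*} (s : Finset ι) (F : ι → P.smooth) (q : P.carrier × S2) :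
    (∑ i ∈ s, F i).1 q = ∑ i ∈ s, (F i).1 q := map_sum (evalAt q) F s

lemma mul_apply (F G : P.smooth) (q : P.carrier × S2) : (F * G).1 q = F.1 q * G.1 q := rfl

lemma add_apply (F G : P.smooth) (q : P.carrier × S2) : (F + G).1 q = F.1 q + G.1 q := rfl

lemma sub_apply (F G : P.smooth) (q : P.carrier × S2) : (F - G).1 q = F.1 q - G.1 q := rfl

lemma sigma_eq (x : S2) (a b : Fin 3) :
    sigma x a b = ((if a = b then 1 else 0) - coord a * coord b : P.smooth).1 (p, x) := by
  rw [sigma, sub_apply, mul_apply, coord_apply, coord_apply]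
  split_ifs <;> rfl

lemma hess_eq {f : S2 → ℝ} {F : P.smooth} (hf : ∀ x, f x = F.1 (p, x)) (x : S2) (a b : Fin 3) :
    hess f x a b =
      (P.sphere.d a (P.sphere.d b F) + P.sphere.x b * P.sphere.d a F).1 (p, x) := by
  have h1 : ∀ c, grad (fun y => grad f y c) x a = (P.sphere.d a (P.sphere.d c F)).1 (p, x) :=
    fun c => grad_eq (fun y => grad_eq hf y c) x a
  rw [mul_comm, ← SphereCalculus.sum_d_mul_sig (SphereCalculus.sum_d_mul_x_comm F), sum_apply,
    hess, nabla1]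
  exact Finset.sum_congr rfl fun c _ => by rw [h1, sigma_eq (p := p), mul_apply]; rfl

lemma lap_eq {f : S2 → ℝ} {F : P.smooth} (hf : ∀ x, f x = F.1 (p, x)) (x : S2) :
    lap f x = (P.sphere.lap F).1 (p, x) := by
  have h := congrArg (fun G : P.smooth => G.1 (p, x)) (P.sphere.radial F)
  simp only [lap, hess_eq hf, SphereCalculus.lap, Fin.sum_univ_three, add_apply] at h ⊢
  have h0 : (0 : P.smooth).1 (p, x) = 0 := rfl
  rw [h0] at h
  linear_combination h

lemma lap2_eq {f : S2 → ℝ} {F : P.smooth} (hf : ∀ x, f x = F.1 (p, x)) (x : S2) :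
    lap2 f x = (P.sphere.lap F + 2 * F).1 (p, x) := by
  rw [lap2, lap_eq hf, hf]
  rfl

lemma bracket1_eq {f g : S2 → ℝ} {F G : P.smooth} (hf : ∀ x, f x = F.1 (p, x))
    (hg : ∀ x, g x = G.1 (p, x)) (x : S2) :
    bracket1 f g x = (P.sphere.poisson F G).1 (p, x) := by
  simp only [bracket1, grad_eq hf, grad_eq hg, eps_eq (p := p), SphereCalculus.poisson, sum_apply,
    mul_apply]

lemma normSq2_eq {t : S2 → Fin 3 → Fin 3 → ℝ} {C : Fin 3 → Fin 3 → P.smooth}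
    (h : ∀ x a b, t x a b = (C a b).1 (p, x)) (x : S2) :
    normSq2 t x = (SphereCalculus.dot C C).1 (p, x) := by
  simp only [normSq2, h, SphereCalculus.dot, sum_apply, mul_apply, sq]

lemma div2_eq {t : S2 → Fin 3 → Fin 3 → ℝ} {C : Fin 3 → Fin 3 → P.smooth}
    (h : ∀ x a b, t x a b = (C a b).1 (p, x)) (hC : P.sphere.IsSTT C) (x : S2) (a : Fin 3) :
    div2 t x a = (P.sphere.dv C a).1 (p, x) := by
  have h1 : ∀ d e b, grad (fun y => t y d e) x b = (P.sphere.d b (C d e)).1 (p, x) :=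
    fun d e b => grad_eq (fun y => h y d e) x b
  rw [← hC.sum_d_mul_sig_sig, div2]
  simp only [nabla2, h1, sum_apply, sigma_eq (p := p), mul_apply]
  rfl

lemma tensorOfPotentials_eq {f g : S2 → ℝ} {F G : P.smooth} (hf : ∀ x, f x = F.1 (p, x))
    (hg : ∀ x, g x = G.1 (p, x)) (x : S2) (a b : Fin 3) :
    2 * tensorOfPotentials f g x a b = (P.sphere.pot F G a b).1 (p, x) := by
  have h := congrArg (fun G : P.smooth => G.1 (p, x)) (SphereCalculus.two_mul_pot (S := P.sphere) F G a b)
  simp only [mul_apply, add_apply (2 * _ - _) _ (p, x), sub_apply,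
    ← hess_eq hf, ← lap_eq hf, add_apply (∑ e, _) _ (p, x), sum_apply, ← eps_eq, ← hess_eq hg] at h
  have h2 : sigma x a b = ((if a = b then 1 else 0) - P.sphere.x a * P.sphere.x b).1 (p, x) :=
    sigma_eq x a b
  simp only [sub_apply, mul_apply] at h2
  rw [← h2] at h
  have h3 : (2 : P.smooth).1 (p, x) = 2 := rfl
  rw [h3] at h
  rw [tensorOfPotentials]
  linarith

end ParamDomain

/-! ### Evolution of the angular momentum aspect -/

namespace SphereCalculus

variable {A : Type*} [CommRing A] [Algebra ℝ A] {S : SphereCalculus A}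

/-- A radial field `x j * y` has ambient divergence `2 * y`, which the second term subtracts. -/
lemma sum_d_x_mul (y : A) : ∑ j, (S.d j (S.x j * y) - 2 * S.x j * (S.x j * y)) = 0 := by
  have h := S.sq'
  have h1 := S.radial' y
  simp only [Fin.sum_univ_three, Derivation.leibniz, smul_eq_mul, S.d_x]
  simp only [if_true]
  linear_combination h1 - 3 * y * h

lemma sum_d_mul_metric (i : Fin 3) (v : A) :
    ∑ j, (S.d j (v * ((if i = j then 1 else 0) - S.x i * S.x j)) -
      2 * S.x j * (v * ((if i = j then 1 else 0) - S.x i * S.x j))) =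
      S.d i v - 2 * S.x i * v := by
  have h := S.sq'
  have h2 := S.radial' v
  have hd : ∀ a, S.d a (1 : A) = 0 := fun a => (S.d a).map_one_eq_zero
  simp only [Fin.sum_univ_three, Derivation.leibniz, smul_eq_mul, S.d_x, map_sub]
  obtain rfl | rfl | rfl : i = 0 ∨ i = 1 ∨ i = 2 := by fin_cases i <;> simp
  · simp [hd]
    linear_combination (-S.x 0) * h2 + 4 * S.x 0 * v * h
  · simp [hd]
    linear_combination (-S.x 1) * h2 + 4 * S.x 1 * v * h
  · simp [hd]
    linear_combination (-S.x 2) * h2 + 4 * S.x 2 * v * h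

lemma eight_mul_cancel {a b : A} (h : 8 * a = 8 * b) : a = b := by
  have h8 : algebraMap ℝ A (1 / 8) * 8 = 1 := by
    rw [← map_ofNat (algebraMap ℝ A) 8, ← map_mul]
    norm_num
  calc a = algebraMap ℝ A (1 / 8) * (8 * a) := by rw [← mul_assoc, h8, one_mul]
    _ = b := by rw [h, ← mul_assoc, h8, one_mul]

variable {T : Derivation ℝ A A} {m U2 s : A} {C H : Fin 3 → Fin 3 → A} {N W1 w2 : Fin 3 → A}

lemma derivation_ofNat_mul (D : Derivation ℝ A A) (n : ℕ) [n.AtLeastTwo] (a : A) :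
    D (OfNat.ofNat n * a) = OfNat.ofNat n * D a := by
  rw [Derivation.leibniz, show D (OfNat.ofNat n) = 0 by exact_mod_cast D.map_natCast n,
    smul_zero, add_zero, smul_eq_mul]

lemma map_dot (T : Derivation ℝ A A) (C : Fin 3 → Fin 3 → A) :
    T (dot C C) = 2 * dot C (fun a b => T (C a b)) := by
  simp only [dot, Fin.sum_univ_three, map_add, Derivation.leibniz, smul_eq_mul]
  ring

lemma sum_d_sub_two_mul (F G : Fin 3 → A) :
    ∑ j, (S.d j (F j + G j) - 2 * S.x j * (F j + G j)) =
      ∑ j, (S.d j (F j) - 2 * S.x j * F j) + ∑ j, (S.d j (G j) - 2 * S.x j * G j) := by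
  rw [← Finset.sum_add_distrib]
  exact Finset.sum_congr rfl fun j _ => by rw [map_add]; ring

/-- The coefficients of the expansion are inserted into the $uA$ equation, which is solved for
$\partial_uN$. The gradients of $C\cdot\partial_uC$ from `U2`, `w2` and `s` carry the weights 1/4,
3/4 and 1, which add up to the `2` in `evol`. Terms proportional to `x i` are normal and kept aside.
-/
lemma evolution (hC : S.IsSTT C) (hTd : ∀ a f, T (S.d a f) = S.d a (T f))
    (hU2 : 16 * U2 = -dot C C) (hs : 4 * s = dot C C) (hW1 : ∀ i, 2 * W1 i = S.dv C i)
    (hw2 : ∀ i, 48 * w2 i = 32 * N i - 3 * S.d i (dot C C))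
    (hH : ∀ i j, H i j = -2 * S.x j * (S.d i m - S.x i * m) +
      T s * ((if i = j then 1 else 0) - S.x i * S.x j) +
      (S.d i (W1 j) - S.x i * W1 j - (S.d j (W1 i) - S.x j * W1 i)) - ∑ l, C j l * T (C i l) +
      S.x j * ∑ l, W1 l * T (C i l))
    (h : ∀ i, -2 * S.d i (T U2) - 6 * T (w2 i) + 2 * ∑ j, C i j * T (W1 j) + 4 * S.d i m +
      2 * ∑ j, T (C i j) * W1 j - ∑ j, ∑ k, T (C k j) * S.d i (C k j) +
      S.x i * (8 * T U2 + ∑ j, ∑ k, T (C k j) * C k j) +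
      2 * ∑ j, (S.d j (H i j) - 2 * S.x j * H i j) = 0) (i : Fin 3) :
    4 * T (N i) = S.evol m C (fun a b => T (C a b)) i +
      S.x i * (8 * T U2 + ∑ j, ∑ k, T (C k j) * C k j - 4 * T s) := by
  have hn := @derivation_ofNat_mul A _ _
  have t1 : 16 * T U2 = -(2 * dot C (fun a b => T (C a b))) := by
    rw [← hn, hU2, map_neg, map_dot]
  have t2 : 4 * T s = 2 * dot C (fun a b => T (C a b)) := by
    rw [← hn, hs, map_dot]
  have t3 : ∀ j, 2 * T (W1 j) = S.dv (fun a b => T (C a b)) j := fun j => by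
    rw [← hn, hW1, dv, map_sum]
    simp only [hTd, dv]
  have t4 : 48 * T (w2 i) = 32 * T (N i) - 6 * S.d i (dot C (fun a b => T (C a b))) := by
    rw [← hn, hw2, map_sub, hn, hn, hTd, map_dot, hn]
    ring
  have t5 : 16 * S.d i (T U2) = -(2 * S.d i (dot C (fun a b => T (C a b)))) := by
    rw [← hn, t1, map_neg, hn]
  have t6 : 4 * S.d i (T s) = 2 * S.d i (dot C (fun a b => T (C a b))) := by
    rw [← hn, t2, hn]
  have hH' : ∀ j, 2 * H i j = 2 * (S.x j * (-2 * (S.d i m - S.x i * m) + ∑ l, W1 l * T (C i l))) +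
      (2 * (T s * ((if i = j then 1 else 0) - S.x i * S.x j)) +
      (S.curl (S.dv C) i j + -2 * ∑ l, C j l * T (C l i))) := fun j => by
    have e : ∑ l, C j l * T (C i l) = ∑ l, C j l * T (C l i) :=
      Finset.sum_congr rfl fun l _ => by rw [hC.symm i l]
    rw [hH, curl, ← hW1, ← hW1, hn, hn, e]
    ring
  have t7 : 2 * ∑ j, (S.d j (H i j) - 2 * S.x j * H i j) =
      2 * (S.d i (T s) - 2 * S.x i * T s) +
      ∑ j, (S.d j (S.curl (S.dv C) i j) - 2 * S.x j * S.curl (S.dv C) i j) -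
      2 * ∑ j, S.d j (∑ l, C j l * T (C l i)) := by
    have e1 : 2 * ∑ j, (S.d j (H i j) - 2 * S.x j * H i j) =
        ∑ j, (S.d j (2 * H i j) - 2 * S.x j * (2 * H i j)) := by
      rw [Finset.mul_sum]
      exact Finset.sum_congr rfl fun j _ => by rw [hn]; ring
    have e2 : ∀ F : Fin 3 → A, ∑ j, (S.d j (2 * F j) - 2 * S.x j * (2 * F j)) =
        2 * ∑ j, (S.d j (F j) - 2 * S.x j * F j) := fun F => by
      rw [Finset.mul_sum]
      exact Finset.sum_congr rfl fun j _ => by rw [hn]; ring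
    have e3 : ∑ j, S.x j * ∑ l, C j l * T (C l i) = 0 := by
      have h0 := hC.tangent' 0
      have h1 := hC.tangent' 1
      have h2 := hC.tangent' 2
      rw [hC.symm 1 2, hC.symm 0 2] at *
      simp only [Fin.sum_univ_three, hC.symm 1 0, hC.symm 2 0, hC.symm 2 1] at *
      linear_combination h0 * T (C 0 i) + h1 * T (C 1 i) + h2 * T (C 2 i)
    have e4 : ∑ j, (S.d j (-2 * ∑ l, C j l * T (C l i)) -
        2 * S.x j * (-2 * ∑ l, C j l * T (C l i))) =
        -2 * ∑ j, S.d j (∑ l, C j l * T (C l i)) +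
          4 * ∑ j, S.x j * ∑ l, C j l * T (C l i) := by
      rw [Finset.mul_sum, Finset.mul_sum, ← Finset.sum_add_distrib]
      refine Finset.sum_congr rfl fun j _ => ?_
      rw [neg_mul, map_neg, hn]
      ring
    rw [e1]
    simp only [hH']
    rw [sum_d_sub_two_mul, sum_d_sub_two_mul, sum_d_sub_two_mul, e2, e2, sum_d_x_mul,
      sum_d_mul_metric, e4, e3]
    ring
  have t8 : 2 * ∑ j, C i j * T (W1 j) = ∑ j, C i j * S.dv (fun a b => T (C a b)) j := by
    rw [Finset.mul_sum]
    exact Finset.sum_congr rfl fun j _ => by rw [← t3]; ring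
  have t9 : 2 * ∑ j, T (C i j) * W1 j = ∑ j, T (C i j) * S.dv C j := by
    rw [Finset.mul_sum]
    exact Finset.sum_congr rfl fun j _ => by rw [← hW1]; ring
  have t10 : ∑ j, ∑ k, T (C k j) * S.d i (C k j) = ∑ j, ∑ l, T (C j l) * S.d i (C j l) :=
    Finset.sum_comm
  -- Multiplication by `8` clears the denominators, so the identity becomes a combination with
  -- integer coefficients.
  refine eight_mul_cancel ?_
  have h' := h i
  rw [t7, t8, t9, t10] at h'
  rw [evol]
  linear_combination (-8) * h' - t4 - t5 + 4 * t6
 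
end SphereCalculus

/-! ### The vacuum equations at null infinity -/

namespace ParamDomain

variable {P Q : ParamDomain}

/-- Pullback of fields along an affine map of parameters, as a homomorphism. -/
def pullHom (L : ℝ × ℝ →L[ℝ] ℝ × ℝ) (b : ℝ × ℝ) (h : ∀ p ∈ Q.carrier, L p + b ∈ P.carrier) :
    P.smooth →ₐ[ℝ] Q.smooth where
  toFun := pull L b h
  map_one' := rfl
  map_mul' _ _ := rfl
  map_zero' := rfl
  map_add' _ _ := rfl
  commutes' _ := rfl

lemma d_pullHom (L : ℝ × ℝ →L[ℝ] ℝ × ℝ) (b : ℝ × ℝ) (h : ∀ p ∈ Q.carrier, L p + b ∈ P.carrier)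
    (a : Fin 3) (f : P.smooth) : d a (pullHom L b h f) = pullHom L b h (d a f) := by
  have := deriv_pull L b h f (0, EuclideanSpace.single a 1)
  rw [map_zero] at this
  exact this

/-- The domain `u ∈ I` of fields that do not depend on the second parameter. -/
def ofInterval (I : Set ℝ) (hI : I.OrdConnected) (hI' : I.Nontrivial) : ParamDomain where
  carrier := I ×ˢ Set.univ
  convex := hI.convex.prod convex_univ
  nonempty_interior := by
    rw [interior_prod_eq, interior_univ]
    obtain ⟨a, ha, b, hb, hab⟩ := hI'.exists_lt
    refine ⟨((a + b) / 2, 0), ?_, trivial⟩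
    exact interior_mono (Set.Ioo_subset_Icc_self.trans (hI.out ha hb))
      (by rw [isOpen_Ioo.interior_eq]; constructor <;> linarith)

/-- The domain `|u - u₀| < δ`, `0 ≤ rho < δ`. -/
def nearScri (u₀ : ℝ) {δ : ℝ} (hδ : 0 < δ) : ParamDomain where
  carrier := Set.Ioo (u₀ - δ) (u₀ + δ) ×ˢ Set.Ico 0 δ
  convex := (convex_Ioo _ _).prod (convex_Ico _ _)
  nonempty_interior := by
    rw [interior_prod_eq, interior_Ico, isOpen_Ioo.interior_eq]
    exact ⟨(u₀, δ / 2), ⟨by constructor <;> linarith, by constructor <;> linarith⟩⟩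

lemma pos_of_mem_interior_nearScri {u₀ δ : ℝ} (hδ : 0 < δ) {p : ℝ × ℝ}
    (hp : p ∈ interior (nearScri u₀ hδ).carrier) : 0 < p.2 := by
  have hp' : p ∈ interior (Set.Ioo (u₀ - δ) (u₀ + δ) ×ˢ Set.Ico 0 δ) := hp
  rw [interior_prod_eq, interior_Ico] at hp'
  exact hp'.2.1

/-- By continuity `R` stays below `R u₀ + 1` near `u₀`, so a full product neighbourhood of the point
of null infinity lies in the region where the expansions hold. -/
lemma exists_nearScri {I : Set ℝ} {R : ℝ → ℝ} (hR : ∀ u ∈ I, 0 < R u) (hc : ContinuousOn R I)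
    {u₀ : ℝ} (hu : u₀ ∈ interior I) : ∃ (δ : ℝ) (hδ : 0 < δ),
    ∀ p ∈ (nearScri u₀ hδ).carrier, p.1 ∈ interior I ∧ 0 ≤ p.2 ∧ p.2 * R p.1 < 1 := by
  have h1 : ContinuousAt R u₀ := hc.continuousAt (mem_interior_iff_mem_nhds.1 hu)
  have h2 : ∀ᶠ u in nhds u₀, u ∈ interior I ∧ R u < R u₀ + 1 :=
    Filter.Eventually.and (isOpen_interior.mem_nhds hu) (h1.eventually (gt_mem_nhds (lt_add_one _)))
  obtain ⟨ε, hε, hb⟩ := Metric.eventually_nhds_iff_ball.1 h2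
  have h0 : 0 < R u₀ := hR _ (interior_subset hu)
  have hδ : 0 < min ε (R u₀ + 1)⁻¹ := lt_min hε (by positivity)
  refine ⟨_, hδ, fun p hp => ?_⟩
  have hp1 : p.1 ∈ Metric.ball u₀ ε := by
    rw [Real.ball_eq_Ioo]
    have := min_le_left ε (R u₀ + 1)⁻¹
    exact ⟨by linarith [hp.1.1], by linarith [hp.1.2]⟩
  obtain ⟨h3, h4⟩ := hb _ hp1
  refine ⟨h3, hp.2.1, ?_⟩
  have h5 : p.2 < (R u₀ + 1)⁻¹ := hp.2.2.trans_le (min_le_right _ _)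
  have h6 := hR _ (interior_subset h3)
  calc p.2 * R p.1 ≤ p.2 * (R u₀ + 1) := by gcongr; exact hp.2.1
    _ < (R u₀ + 1)⁻¹ * (R u₀ + 1) := by gcongr
    _ = 1 := inv_mul_cancel₀ (by positivity)

section RestrictSnd

variable {I : Set ℝ} {hI : I.OrdConnected} {hI' : I.Nontrivial} (hP : ∀ p ∈ P.carrier, p.1 ∈ I)
  (v : ℝ)

include hP in
lemma fst_mem_ofInterval (p : ℝ × ℝ) (hp : p ∈ P.carrier) :
    (ContinuousLinearMap.fst ℝ ℝ ℝ).prod 0 p + (0, v) ∈ (ofInterval I hI hI').carrier := by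
  change (p.1 + 0, 0 + v) ∈ _
  rw [add_zero, zero_add]
  exact ⟨hP p hp, trivial⟩

/-- Restriction of fields to the value `v` of the second parameter. -/
def restrictSnd : (ofInterval I hI hI').smooth →ₐ[ℝ] P.smooth :=
  pullHom ((ContinuousLinearMap.fst ℝ ℝ ℝ).prod 0) (0, v) (fst_mem_ofInterval hP v)

lemma deriv_restrictSnd (f : (ofInterval I hI hI').smooth) (w : (ℝ × ℝ) × E3) :
    deriv w (restrictSnd hP v f) = restrictSnd hP v (deriv ((w.1.1, 0), w.2) f) :=
  deriv_pull _ _ (fst_mem_ofInterval hP v) _ _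

lemma restrictSnd_apply (f : (ofInterval I hI hI').smooth) (p : P.carrier) (x : S2) :
    (restrictSnd hP v f).1 (p, x) = f.1 (⟨(p.1.1, v), ⟨hP p.1 p.2, trivial⟩⟩, x) := by
  have h : ((p.1.1, (0 : ℝ)) : ℝ × ℝ) + (0, v) = (p.1.1, v) := by simp
  exact congrArg f.1 (Prod.ext (Subtype.ext h) rfl)

lemma scri_T_restrictSnd (f : (ofInterval I hI hI').smooth) :
    P.scri.T (restrictSnd hP v f) = restrictSnd hP v (dFst f) :=
  deriv_restrictSnd hP v f ((1, 0), 0)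

lemma scri_d_restrictSnd (a : Fin 3) (f : (ofInterval I hI hI').smooth) :
    P.scri.d a (restrictSnd hP v f) = restrictSnd hP v (d a f) := by
  have h : dSnd (restrictSnd hP v f) = 0 := by
    have h0 : deriv (((0 : ℝ), (0 : ℝ)), (0 : E3)) f = 0 := deriv_zero f
    rw [dSnd, deriv_restrictSnd, h0, map_zero]
  rw [scri_d, h, mul_zero, sub_zero]
  exact d_pullHom _ _ _ _ _

lemma scri_x_restrictSnd (a : Fin 3) : P.scri.x a = restrictSnd (hI := hI) (hI' := hI') hP v (coord a) := rfl

lemma radial_restrictSnd (f : (ofInterval I hI hI').smooth) :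
    ∑ a, P.scri.x a * P.scri.d a (restrictSnd hP v f) = 0 := by
  simp only [scri_x_restrictSnd (hI := hI) (hI' := hI') hP v, scri_d_restrictSnd, ← map_mul, ← map_sum,
    sum_coord_d, map_zero]

end RestrictSnd

end ParamDomain

/-! ### The vacuum metric as a Bondi metric over the ring of fields -/

namespace IsVacuumBondiSachs

open ParamDomain SphereCalculus

variable {I : Set ℝ} {R : ℝ → ℝ} {B : BondiSachs} {D : ScriData}
  (hB : IsVacuumBondiSachs I R B D) (hI : I.OrdConnected) (hI' : I.Nontrivial)

/-- The mass aspect. -/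
def mass : (ofInterval I hI hI').smooth := field (fun _ hp => hp.1) hB.smooth_m

/-- The angular momentum aspect. -/
def momentum (a : Fin 3) : (ofInterval I hI hI').smooth := field (fun _ hp => hp.1) (hB.smooth_N a)

/-- The shear. -/
def shear (a b : Fin 3) : (ofInterval I hI hI').smooth := field (fun _ hp => hp.1) (hB.smooth_C a b)

/-- The news. -/
def news (a b : Fin 3) : (ofInterval I hI hI').smooth := dFst (hB.shear hI hI' a b)

lemma shear_isSTT : (ofInterval I hI hI').sphere.IsSTT (hB.shear hI hI') where
  symm a b := smooth_ext fun p x => (hB.tangent_C _ p.2.1 x).1 a b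
  tangent a := smooth_ext fun p x => by
    rw [ParamDomain.sum_apply]
    exact (hB.tangent_C _ p.2.1 x).2 a
  trace := smooth_ext fun p x => by
    rw [ParamDomain.sum_apply]
    exact hB.traceless_C _ p.2.1 x

lemma news_isSTT : (ofInterval I hI hI').sphere.IsSTT (hB.news hI hI') where
  symm a b := by rw [news, (hB.shear_isSTT hI hI').symm a b]; rfl
  tangent a := by
    have h := congrArg dFst ((hB.shear_isSTT hI hI').tangent a)
    have h2 : ∀ b, dFst ((ofInterval I hI hI').sphere.x b) = 0 := dFst_coord
    simpa only [map_sum, Derivation.leibniz, h2, zero_add, smul_eq_mul, map_zero, mul_zero,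
      mul_comm, news] using h
  trace := by
    have h := congrArg dFst (hB.shear_isSTT hI hI').trace
    rwa [map_sum, map_zero] at h

lemma normal_momentum : ∑ i, coord i * hB.momentum hI hI' i = 0 := smooth_ext fun p x => by
  rw [ParamDomain.sum_apply]
  exact hB.tangent_N _ p.2.1 x


lemma shear_apply (p : (ofInterval I hI hI').carrier) (x : S2) (a b : Fin 3) :
    D.C p.1.1 x a b = (hB.shear hI hI' a b).1 (p, x) := rfl

lemma normSq2_shear (p : (ofInterval I hI hI').carrier) (x : S2) : normSq2 (D.C p.1.1) x =
    (dot (hB.shear hI hI') (hB.shear hI hI')).1 (p, x) :=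
  normSq2_eq (hB.shear_apply hI hI' p) x

lemma grad_normSq2_shear (p : (ofInterval I hI hI').carrier) (x : S2) (a : Fin 3) :
    grad (normSq2 (D.C p.1.1)) x a =
      (d a (dot (hB.shear hI hI') (hB.shear hI hI'))).1 (p, x) :=
  grad_eq (hB.normSq2_shear hI hI' p) x a

lemma div2_shear (p : (ofInterval I hI hI').carrier) (x : S2) (a : Fin 3) :
    div2 (D.C p.1.1) x a = ((ofInterval I hI hI').sphere.dv (hB.shear hI hI') a).1 (p, x) :=
  div2_eq (hB.shear_apply hI hI' p) (hB.shear_isSTT hI hI') x a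

/-- The coefficient of `rho ^ 2` in `U`. -/
def coeffU : (ofInterval I hI hI').smooth :=
  (-1 / 16 : ℝ) • dot (hB.shear hI hI') (hB.shear hI hI')

/-- The trace part of the coefficient of `rho ^ 2` in `h`. -/
def coeffTrace : (ofInterval I hI hI').smooth :=
  (1 / 4 : ℝ) • dot (hB.shear hI hI') (hB.shear hI hI')

/-- The leading coefficient of the shift. -/
def coeffShift (i : Fin 3) : (ofInterval I hI hI').smooth :=
  (1 / 2 : ℝ) • (ofInterval I hI hI').sphere.dv (hB.shear hI hI') i

/-- The next coefficient of the shift, with the index lowered. -/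
def coeffShift' (i : Fin 3) : (ofInterval I hI hI').smooth :=
  (2 / 3 : ℝ) • hB.momentum hI hI' i -
    (1 / 16 : ℝ) • d i (dot (hB.shear hI hI') (hB.shear hI hI'))

/-- The tensor whose divergence enters the evolution of the angular momentum aspect. -/
def coeffDiv (i j : Fin 3) : (ofInterval I hI hI').smooth :=
  -2 * coord j * (d i (hB.mass hI hI') - coord i * hB.mass hI hI') +
    dFst (hB.coeffTrace hI hI') * ((if i = j then 1 else 0) - coord i * coord j) +
    (d i (hB.coeffShift hI hI' j) - coord i * hB.coeffShift hI hI' j -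
      (d j (hB.coeffShift hI hI' i) - coord j * hB.coeffShift hI hI' i)) -
    ∑ l, hB.shear hI hI' j l * dFst (hB.shear hI hI' i l) +
    coord j * ∑ l, hB.coeffShift hI hI' l * dFst (hB.shear hI hI' i l)

/-- Near an interior retarded time the expansions define ring elements smooth up to `rho = 0`, to
which `vacuum_coefficients` applies. The algebraic constraints are known for `rho > 0` and extend to
`rho = 0` by density. -/
lemma vacuum_apply (p : (ofInterval I hI hI').carrier) (hp : p.1.1 ∈ interior I) (x : S2) :
    (4 * ∑ k, d k (dFst (hB.coeffShift hI hI' k)) - 8 * dFst (hB.mass hI hI') -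
      ∑ j, ∑ k, dFst (hB.shear hI hI' k j) * dFst (hB.shear hI hI' k j)).1 (p, x) = 0 ∧
    ∀ i, (-2 * d i (dFst (hB.coeffU hI hI')) - 6 * dFst (hB.coeffShift' hI hI' i) +
      2 * ∑ j, hB.shear hI hI' i j * dFst (hB.coeffShift hI hI' j) + 4 * d i (hB.mass hI hI') +
      2 * ∑ j, dFst (hB.shear hI hI' i j) * hB.coeffShift hI hI' j -
      ∑ j, ∑ k, dFst (hB.shear hI hI' k j) * d i (hB.shear hI hI' k j) +
      coord i * (8 * dFst (hB.coeffU hI hI') +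
        ∑ j, ∑ k, dFst (hB.shear hI hI' k j) * hB.shear hI hI' k j) +
      2 * ∑ j, (d j (hB.coeffDiv hI hI' i j) - 2 * coord j * hB.coeffDiv hI hI' i j)).1
        (p, x) = 0 := by
  obtain ⟨δ, hδ, hPR⟩ := exists_nearScri hB.R_pos hB.R_cont hp
  set P := nearScri p.1.1 hδ with hPdef
  have hPI : ∀ q ∈ P.carrier, q.1 ∈ I := fun q hq => interior_subset (hPR q hq).1
  have hPR' : ∀ q ∈ P.carrier, q.1 ∈ I ∧ 0 ≤ q.2 ∧ q.2 * R q.1 < 1 := fun q hq =>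
    ⟨hPI q hq, (hPR q hq).2⟩
  have hpos : ∀ q ∈ interior P.carrier, 0 < q.2 := fun q hq => pos_of_mem_interior_nearScri hδ hq
  have hr : ∀ (q : ℝ × ℝ), q ∈ P.carrier → 0 < q.2 → R q.1 < q.2⁻¹ := fun q hq h0 => by
    rw [← one_div, lt_div_iff₀ h0, mul_comm]
    exact (hPR q hq).2.2
  -- Elements of the ring over `I` formally have a second parameter. Freezing it at its value at `p`
  -- makes the final evaluation at `rho = 0` return values at `p`.
  let res : (ofInterval I hI hI').smooth →ₐ[ℝ] P.smooth := restrictSnd hPI p.1.2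
  have hres : ∀ f q x, (res f).1 (q, x) = f.1 (⟨(q.1.1, p.1.2), ⟨hPI q.1 q.2, trivial⟩⟩, x) :=
    restrictSnd_apply hPI p.1.2
  obtain ⟨fU, hfU, eU⟩ := hB.expansion_U
  obtain ⟨fV, hfV, eV⟩ := hB.expansion_V
  choose fW hfW eW using hB.expansion_W
  choose fh hfh eh using hB.expansion_h
  have hnorm : ∀ (q : P.carrier) x, normSq2 (D.C q.1.1) x =
      (res (dot (hB.shear hI hI') (hB.shear hI hI'))).1 (q, x) := fun q x => by
    rw [hres, ← normSq2_shear]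
  have hgrad : ∀ (q : P.carrier) x a, grad (normSq2 (D.C q.1.1)) x a =
      (res (d a (dot (hB.shear hI hI') (hB.shear hI hI')))).1 (q, x) := fun q x a => by
    rw [hres, ← grad_normSq2_shear]
  have hdiv : ∀ (q : P.carrier) x a, div2 (D.C q.1.1) x a =
      (res ((ofInterval I hI hI').sphere.dv (hB.shear hI hI') a)).1 (q, x) := fun q x a => by
    rw [hres, ← div2_shear]
  have hC : ∀ (q : P.carrier) x a b, D.C q.1.1 x a b = (res (hB.shear hI hI' a b)).1 (q, x) :=
    fun q x a b => by rw [hres]; rfl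
  have hm : ∀ (q : P.carrier) x, D.m q.1.1 x = (res (hB.mass hI hI')).1 (q, x) :=
    fun q x => by rw [hres]; rfl
  have hN : ∀ (q : P.carrier) x a, D.N q.1.1 x a = (res (hB.momentum hI hI' a)).1 (q, x) :=
    fun q x a => by rw [hres]; rfl
  let ρ : P.smooth := sndParam
  let W2 : Fin 3 → (ofInterval I hI hI').smooth := fun i => hB.coeffShift' hI hI' i -
    ∑ j, hB.shear hI hI' i j * hB.coeffShift hI hI' j
  let U : P.smooth := 1 + ρ ^ 2 * res (hB.coeffU hI hI') + ρ ^ 3 * fieldUpToScri hPR' hfU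
  let V : P.smooth := 1 - 2 * ρ * res (hB.mass hI hI') + ρ ^ 2 * fieldUpToScri hPR' hfV
  let W : Fin 3 → P.smooth := fun i => ρ * res (hB.coeffShift hI hI' i) +
    ρ ^ 2 * res (W2 i) + ρ ^ 3 * fieldUpToScri hPR' (hfW i)
  let h : Fin 3 → Fin 3 → P.smooth := fun i j => P.scri.sig i j +
    ρ * res (hB.shear hI hI' i j) + ρ ^ 2 * (res (hB.coeffTrace hI hI') * P.scri.sig i j) +
    ρ ^ 3 * fieldUpToScri hPR' (hfh i j)
  have hU : ∀ (q : P.carrier) x, 0 < q.1.2 → B.U q.1.1 q.1.2⁻¹ x = U.1 (q, x) := fun q x h0 => by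
    rw [eU _ (hPI _ q.2) _ (hr _ q.2 h0), inv_inv, hnorm]
    simp only [U, ρ, coeffU, map_smul]
    change _ = 1 + q.1.2 ^ 2 * (-1 / 16 * _) + q.1.2 ^ 3 * fU q.1.1 q.1.2 x
    field_simp
    ring
  have hV : ∀ (q : P.carrier) x, 0 < q.1.2 → B.V q.1.1 q.1.2⁻¹ x = V.1 (q, x) := fun q x h0 => by
    rw [eV _ (hPI _ q.2) _ (hr _ q.2 h0), inv_inv, hm]
    change _ = 1 - 2 * q.1.2 * _ + q.1.2 ^ 2 * fV q.1.1 q.1.2 x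
    field_simp
  have hW2 : ∀ (q : P.carrier) x i, (res (W2 i)).1 (q, x) = 2 / 3 * D.N q.1.1 x i -
      1 / 16 * grad (normSq2 (D.C q.1.1)) x i -
      1 / 2 * ∑ b, D.C q.1.1 x i b * div2 (D.C q.1.1) x b := fun q x i => by
    simp only [hN, hgrad, hC, hdiv, W2, coeffShift', coeffShift, map_sub, map_smul, map_sum,
      map_mul, mul_smul_comm, ← Finset.smul_sum]
    simp only [← ParamDomain.mul_apply, ← ParamDomain.sum_apply]
    rfl
  -- The algebraic `W` is `r` times the shift, so its expansion starts at first order in `rho`.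
  have hW : ∀ (q : P.carrier) x i, 0 < q.1.2 →
      q.1.2⁻¹ * B.W q.1.1 q.1.2⁻¹ x i = (W i).1 (q, x) := fun q x i h0 => by
    rw [eW i _ (hPI _ q.2) _ (hr _ q.2 h0), inv_inv, hdiv, ← hW2]
    simp only [W, ρ, coeffShift, map_smul]
    change _ = q.1.2 * (1 / 2 * _) + q.1.2 ^ 2 * _ + q.1.2 ^ 3 * fW i q.1.1 q.1.2 x
    field_simp
  have hh : ∀ (q : P.carrier) x i j, 0 < q.1.2 →
      B.h q.1.1 q.1.2⁻¹ x i j = (h i j).1 (q, x) := fun q x i j h0 => by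
    rw [eh i j _ (hPI _ q.2) _ (hr _ q.2 h0), inv_inv, hnorm, hC, sigma_eq (p := q)]
    simp only [h, ρ, coeffTrace, map_smul]
    change _ = _ + q.1.2 * _ + q.1.2 ^ 2 * (1 / 4 * _ * _) + q.1.2 ^ 3 * fh i j q.1.1 q.1.2 x
    have hs : (P.scri.sig i j).1 (q, x) =
        ((if i = j then 1 else 0) - coord i * coord j : P.smooth).1 (q, x) := rfl
    rw [hs]
    field_simp
  -- At `rho = 0` the expansion gives the value `1`; elsewhere positivity of `U` is a hypothesis.
  have hU0 : ∀ (q : P.carrier) x, U.1 (q, x) ≠ 0 := fun q x => by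
    rcases (hPR _ q.2).2.1.eq_or_lt with h0 | h0
    · have : U.1 (q, x) = 1 + q.1.2 ^ 2 * _ + q.1.2 ^ 3 * _ := rfl
      rw [this, ← h0]
      norm_num
    · rw [← hU q x h0]
      exact (hB.U_pos _ (hPI _ q.2) _ (hr _ q.2 h0) x).ne'
  obtain ⟨Pinv, hPinv⟩ := exists_mul_eq_one U hU0
  -- The constraints hold for `rho > 0`, and `eq_zero_of_interior` carries them to the boundary `rho
  -- = 0`.
  have x_W : ∑ i, P.scri.x i * W i = 0 := eq_zero_of_interior _ fun q hq x => by
    have h0 := hpos _ hq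
    have := hB.tangent_W _ (hPI _ q.2) _ (hr _ q.2 h0) x
    rw [ParamDomain.sum_apply]
    simp only [ParamDomain.mul_apply, ← hW q x _ h0]
    rw [IsTangent1] at this
    change ∑ i, x.1 i * _ = 0
    simp only [mul_left_comm _ q.1.2⁻¹, ← Finset.mul_sum, this, mul_zero]
  have h_symm : ∀ i j, h i j = h j i := fun i j => by
    refine sub_eq_zero.1 (eq_zero_of_interior _ fun q hq x => ?_)
    have h0 := hpos _ hq
    rw [ParamDomain.sub_apply, ← hh q x _ _ h0, ← hh q x _ _ h0,
      (hB.tangent_h _ (hPI _ q.2) _ (hr _ q.2 h0) x).1 i j, sub_self]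
  have x_h : ∀ j, ∑ i, P.scri.x i * h i j = 0 := fun j => eq_zero_of_interior _ fun q hq x => by
    have h0 := hpos _ hq
    have := (hB.tangent_h _ (hPI _ q.2) _ (hr _ q.2 h0) x).2 j
    rw [ParamDomain.sum_apply]
    simp only [h_symm _ j, ParamDomain.mul_apply, ← hh q x _ _ h0]
    rw [← this]
    exact Finset.sum_congr rfl fun i _ => mul_comm _ _
  have det_h : (Matrix.of fun i j => h i j + P.scri.x i * P.scri.x j).det = 1 := by
    refine sub_eq_zero.1 (eq_zero_of_interior _ fun q hq x => ?_)
    have h0 := hpos _ hq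
    have := hB.det_h _ (hPI _ q.2) _ (hr _ q.2 h0) x
    rw [ParamDomain.sub_apply, sub_eq_zero]
    change evalAt (q, x) (Matrix.of fun i j => h i j + P.scri.x i * P.scri.x j).det = 1
    rw [AlgHom.map_det, ← this]
    congr 1
    ext i j
    exact (congrArg (· + x.1 i * x.1 j) (hh q x i j h0)).symm
  have hx0 : ∀ v : Fin 3 → (ofInterval I hI hI').smooth, ∑ i, coord i * v i = 0 →
      ∑ i, P.scri.x i * res (v i) = 0 := fun v hv => by
    have := congrArg res hv
    rwa [map_sum, map_zero] at this
  have x1 : ∑ i, coord i * hB.coeffShift hI hI' i = 0 := by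
    have := (hB.shear_isSTT hI hI').dv_tangent
    simp only [coeffShift, mul_smul_comm, ← Finset.smul_sum]
    exact (congrArg _ this).trans (smul_zero _)
  have x2 : ∑ i, coord i * W2 i = 0 := by
    have e1 := hB.normal_momentum hI hI'
    have e2 := sum_coord_d (dot (hB.shear hI hI') (hB.shear hI hI'))
    have e3 : ∑ i, coord i * ∑ j, hB.shear hI hI' i j * hB.coeffShift hI hI' j = 0 := by
      simp only [Finset.mul_sum]
      rw [Finset.sum_comm]
      refine Finset.sum_eq_zero fun j _ => ?_
      rw [← zero_mul (hB.coeffShift hI hI' j), ← (hB.shear_isSTT hI hI').tangent j, Finset.sum_mul]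
      exact Finset.sum_congr rfl fun i _ => by
        rw [(hB.shear_isSTT hI hI').symm j, ← mul_assoc]
        exact congrArg (· * _) (mul_comm _ _)
    simp only [W2, coeffShift', mul_sub, mul_smul_comm, Finset.sum_sub_distrib, ← Finset.smul_sum,
      e1, e2, e3, smul_zero, sub_zero]
  have hd : ∀ a f, P.scri.d a (res f) = res (d a f) := scri_d_restrictSnd hPI p.1.2
  have hT : ∀ f, P.scri.T (res f) = res (dFst f) := scri_T_restrictSnd hPI p.1.2
  have hx : ∀ a, P.scri.x a = res (coord a) := scri_x_restrictSnd hPI p.1.2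
  have two_W1 : ∀ i, 2 * res (hB.coeffShift hI hI' i) =
      ∑ j, P.scri.d j (res (hB.shear hI hI' j i)) := fun i => by
    simp only [hd, ← map_sum, coeffShift, map_smul]
    rw [mul_smul_comm, two_mul, ← two_smul ℝ, smul_smul]
    norm_num
    rfl
  let Bd : P.scri.Bondi := .ofDet U Pinv V W h hPinv x_W h_symm x_h det_h
  let E : Bd.Expansion :=
    { m := res (hB.mass hI hI')
      U2 := res (hB.coeffU hI hI')
      U3 := fieldUpToScri hPR' hfU
      V2 := fieldUpToScri hPR' hfV
      s := res (hB.coeffTrace hI hI')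
      C := fun i j => res (hB.shear hI hI' i j)
      h3 := fun i j => fieldUpToScri hPR' (hfh i j)
      W1 := fun i => res (hB.coeffShift hI hI' i)
      W2 := fun i => res (W2 i)
      W3 := fun i => fieldUpToScri hPR' (hfW i)
      U_eq := rfl
      V_eq := rfl
      W_eq := fun _ => rfl
      h_eq := fun _ _ => rfl
      C_symm := fun i j => by rw [(hB.shear_isSTT hI hI').symm]
      x_C := fun j => hx0 (fun i => hB.shear hI hI' i j) (by
        rw [← (hB.shear_isSTT hI hI').tangent j]
        exact Finset.sum_congr rfl fun i _ => by
          rw [(hB.shear_isSTT hI hI').symm j]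
          exact mul_comm _ _)
      x_W1 := hx0 (hB.coeffShift hI hI') x1
      x_W2 := hx0 W2 x2
      radial_m := radial_restrictSnd _ _ _
      radial_U2 := radial_restrictSnd _ _ _
      radial_C := fun _ _ => radial_restrictSnd _ _ _
      radial_W1 := fun _ => radial_restrictSnd _ _ _
      radial_W2 := fun _ => radial_restrictSnd _ _ _
      two_W1 := fun i => two_W1 i }
  have hg : ∀ w ∈ P.region, ∀ μ ν, B.metric w μ ν = lift4 (Bd.met μ ν) w := fun w hw μ ν => by
    have hq := interior_subset hw.2
    have h0 : 0 < ‖spacePart w‖⁻¹ := hpos _ hw.2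
    have hn : ‖spacePart w‖ * ‖spacePart w‖⁻¹ = 1 := mul_inv_cancel₀ (inv_pos.1 h0).ne'
    have aU := hU ⟨_, hq⟩ (toS2 (spacePart w)) h0
    have aV := hV ⟨_, hq⟩ (toS2 (spacePart w)) h0
    have aW := fun i => hW ⟨_, hq⟩ (toS2 (spacePart w)) i h0
    have ah := fun i j => hh ⟨_, hq⟩ (toS2 (spacePart w)) i j h0
    simp only [inv_inv] at aU aV aW ah
    have ab : ∀ i, -(B.U (w 0) ‖spacePart w‖ (toS2 (spacePart w))) * (toS2 (spacePart w)).1 i +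
        ‖spacePart w‖ * ∑ j, B.h (w 0) ‖spacePart w‖ (toS2 (spacePart w)) i j *
          B.W (w 0) ‖spacePart w‖ (toS2 (spacePart w)) j =
        (Bd.b i).1 (⟨_, hq⟩, toS2 (spacePart w)) := fun i => by
      change _ = -(U.1 _) * _ + (∑ j, h i j * W j).1 _
      rw [← aU, ParamDomain.sum_apply, Finset.mul_sum]
      simp only [ParamDomain.mul_apply, ← aW, ← ah]
      congr 1
      exact Finset.sum_congr rfl fun j _ => by ring
    rw [lift4_eq _ hw]
    refine Fin.cases (Fin.cases ?_ (fun j => ?_) ν) (fun i => Fin.cases ?_ (fun j => ?_) ν) μ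
    · change -(_ * _) + _ = -(U.1 _ * V.1 _) + (∑ i, (∑ j, h i j * W j) * W i).1 _
      rw [← aU, ← aV, ParamDomain.sum_apply, Finset.mul_sum]
      congr 1
      refine Finset.sum_congr rfl fun i _ => ?_
      rw [ParamDomain.mul_apply, ParamDomain.sum_apply, ← aW, Finset.sum_mul, Finset.mul_sum,
        Finset.sum_mul]
      refine Finset.sum_congr rfl fun j _ => ?_
      rw [ParamDomain.mul_apply, ← aW, ← ah]
      ring
    · exact ab j
    · exact ab i
    · exact ah i j
  have hric : ∀ z ∈ P.region, ∀ μ ν, ricci B.metric z μ ν = 0 := fun z hz μ ν => by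
    have h1 := interior_subset hz.2
    refine hB.vacuum z (hPR _ h1).1 ?_ μ ν
    have h2 := hr _ h1 (hpos _ hz.2)
    rwa [inv_inv] at h2
  -- The coefficients are read off on null infinity itself.
  have hp0 : (p.1.1, (0 : ℝ)) ∈ P.carrier := ⟨⟨by linarith, by linarith⟩, le_rfl, hδ⟩
  have key := vacuum_coefficients hpos E hg hric (p := ⟨_, hp0⟩) rfl x
  -- Lowering the index of the shift adds $\frac12C_{AB}\nabla_DC^{BD}$ and so cancels the last term
  -- of its $r^{-3}$ coefficient.
  have hw2 : ∀ i, E.w2 i = res (hB.coeffShift' hI hI' i) := fun i => by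
    change res (W2 i) + ∑ j, res (hB.shear hI hI' i j) * res (hB.coeffShift hI hI' j) = _
    simp only [← map_mul, ← map_sum, ← map_add, W2, sub_add_cancel]
  have hH : ∀ i j, E.H i j = res (hB.coeffDiv hI hI' i j) := fun i j => by
    simp only [ScriCalculus.Bondi.Expansion.H, ScriCalculus.Bondi.Expansion.F, ScriCalculus.sig,
      coeffDiv, E, map_add, map_sub, map_mul, map_sum, map_neg, map_ofNat, apply_ite res, map_one,
      map_zero, hd, hT, hx]
  simp only [hw2, hH] at key
  simp only [E, hd, hT, hx, ← map_mul, ← map_sum] at key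
  have h2 : (2 : P.smooth) = res 2 := (map_ofNat res 2).symm
  have h4 : (4 : P.smooth) = res 4 := (map_ofNat res 4).symm
  have h6 : (6 : P.smooth) = res 6 := (map_ofNat res 6).symm
  have h8 : (8 : P.smooth) = res 8 := (map_ofNat res 8).symm
  simp only [h2, h4, h6, h8, ← map_neg, ← map_mul, ← map_sub, ← map_add, ← map_sum] at key
  simp only [hres] at key
  exact key
end IsVacuumBondiSachs

/-! ### Evolution equations of the mass and angular momentum aspects -/

namespace IsVacuumBondiSachs

open ParamDomain SphereCalculus

variable {I : Set ℝ} {R : ℝ → ℝ} {B : BondiSachs} {D : ScriData}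
  (hB : IsVacuumBondiSachs I R B D) (hI : I.OrdConnected) (hI' : I.Nontrivial)

lemma eq_zero_of_interval {f : (ofInterval I hI hI').smooth}
    (h : ∀ p : (ofInterval I hI hI').carrier, p.1.1 ∈ interior I → ∀ x, f.1 (p, x) = 0) : f = 0 :=
  eq_zero_of_interior f fun p hp x => h p (by
    have hp' : p.1 ∈ interior (I ×ˢ Set.univ) := hp
    rw [interior_prod_eq] at hp'
    exact hp'.1) x

lemma two_mul_half_smul {A : Type*} [CommRing A] [Algebra ℝ A] (a : A) : 2 * (1 / 2 : ℝ) • a = a := by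
  rw [mul_smul_comm, two_mul, ← two_smul ℝ, smul_smul]
  norm_num

/-- The evolution equation of the mass aspect. -/
lemma dFst_mass : 8 * dFst (hB.mass hI hI') =
    2 * ∑ b, (ofInterval I hI hI').sphere.d b
      ((ofInterval I hI hI').sphere.dv (hB.news hI hI') b) -
    dot (hB.news hI hI') (hB.news hI hI') := by
  have h := eq_zero_of_interval hI hI' fun p hp x => (hB.vacuum_apply hI hI' p hp x).1
  have h1 : 4 * ∑ k, d k (dFst (hB.coeffShift hI hI' k)) =
      2 * ∑ b, (ofInterval I hI hI').sphere.d b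
        ((ofInterval I hI hI').sphere.dv (hB.news hI hI') b) := by
    rw [Finset.mul_sum, Finset.mul_sum]
    refine Finset.sum_congr rfl fun k _ => ?_
    have h2 : dFst (hB.coeffShift hI hI' k) =
        (1 / 2 : ℝ) • (ofInterval I hI hI').sphere.dv (hB.news hI hI') k := by
      simp only [coeffShift, Derivation.map_smul, dv, map_sum]
      congr 1
      exact Finset.sum_congr rfl fun a _ => dFst_d _ _
    rw [h2, Derivation.map_smul, show (4 : (ofInterval I hI hI').smooth) = 2 * 2 by norm_num,
      mul_assoc, two_mul_half_smul]
    rfl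
  have h3 : ∑ j, ∑ k, dFst (hB.shear hI hI' k j) * dFst (hB.shear hI hI' k j) =
      dot (hB.news hI hI') (hB.news hI hI') := Finset.sum_comm
  rw [h1, h3] at h
  linear_combination -h

/-- The evolution equation of the angular momentum aspect, up to normal components. -/
lemma dFst_momentum : ∃ Z, ∀ i, 4 * dFst (hB.momentum hI hI' i) =
    (ofInterval I hI hI').sphere.evol (hB.mass hI hI') (hB.shear hI hI') (hB.news hI hI') i +
      (ofInterval I hI hI').sphere.x i * Z := by
  have hk : ∀ (n : ℕ) [n.AtLeastTwo] (r : ℝ) (a : (ofInterval I hI hI').smooth),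
      OfNat.ofNat n * r • a = ((OfNat.ofNat n : ℝ) * r) • a := fun n _ r a => by
    rw [Algebra.smul_def, Algebra.smul_def, map_mul, map_ofNat, mul_assoc]
  refine ⟨_, evolution (S := (ofInterval I hI hI').sphere) (T := dFst)
    (U2 := hB.coeffU hI hI') (s := hB.coeffTrace hI hI') (W1 := hB.coeffShift hI hI')
    (w2 := hB.coeffShift' hI hI') (H := hB.coeffDiv hI hI')
    (hB.shear_isSTT hI hI') dFst_d ?_ ?_ ?_ ?_ (fun i j => rfl) fun i =>
      eq_zero_of_interval hI hI' fun p hp x => (hB.vacuum_apply hI hI' p hp x).2 i⟩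
  · rw [coeffU, hk]
    norm_num
  · rw [coeffTrace, hk]
    norm_num
  · intro i
    rw [coeffShift, hk]
    norm_num
  · intro i
    rw [coeffShift', mul_sub, hk, hk, ← one_smul ℝ (hB.momentum hI hI' i), smul_smul,
      ← one_smul ℝ (ParamDomain.d i _), smul_smul, hk, show (ofInterval I hI hI').sphere.d i = d i from rfl,
      ← one_smul ℝ (ParamDomain.d i (dot _ _)), hk]
    norm_num

end IsVacuumBondiSachs

/-! ### Time derivatives of the integrands of the charges -/

namespace SphereCalculus

variable {A : Type*} [CommRing A] [Algebra ℝ A] {S : SphereCalculus A} {T : Derivation ℝ A A}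
  {m Z u : A} {C : Fin 3 → Fin 3 → A} {N : Fin 3 → A}

lemma sum_eps_mul_d_x (a k : Fin 3) : ∑ b, S.eps a b * S.d b (S.x k) = S.eps a k := by
  have h := S.eps_x a
  have h2 := sum_mul_sig (S := S) (S.eps a) k
  have h3 : ∑ e, S.eps a e * S.x e = 0 := by simpa only [Fin.sum_univ_three] using h
  rw [h3, zero_mul, sub_zero] at h2
  simp only [S.d_x, h2]

lemma map_sum_mul_dv (hTd : ∀ a f, T (S.d a f) = S.d a (T f)) (i : Fin 3) :
    T (∑ j, C i j * S.dv C j) = ∑ j, C i j * S.dv (fun a b => T (C a b)) j +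
      ∑ j, T (C i j) * S.dv C j := by
  rw [map_sum, ← Finset.sum_add_distrib]
  refine Finset.sum_congr rfl fun j _ => ?_
  simp only [Derivation.leibniz, smul_eq_mul, dv, map_sum, hTd]
  ring

lemma map_eps_eq_zero (hTx : ∀ a, T (S.x a) = 0) (a b : Fin 3) : T (S.eps a b) = 0 := by
  fin_cases a <;> fin_cases b <;> simp [eps, hTx]

/-- The time derivative of the quadratic correction turns `evol` into `flux`, and the undetermined
normal component `Z` drops because the rotation field is tangential. -/
lemma map_sum_eps (hTx : ∀ a, T (S.x a) = 0) (hTd : ∀ a f, T (S.d a f) = S.d a (T f))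
    (h : ∀ i, 4 * T (N i) = S.evol m C (fun a b => T (C a b)) i + S.x i * Z) (k : Fin 3) :
    T (∑ i, S.eps i k * (4 * N i - ∑ j, C i j * S.dv C j)) =
      ∑ i, S.eps i k * S.flux m C (fun a b => T (C a b)) i := by
  have h1 : ∀ i, T (S.eps i k * (4 * N i - ∑ j, C i j * S.dv C j)) =
      S.eps i k * S.flux m C (fun a b => T (C a b)) i + S.eps i k * S.x i * Z := fun i => by
    rw [Derivation.leibniz, map_eps_eq_zero hTx, smul_zero, add_zero, smul_eq_mul, map_sub,
      derivation_ofNat_mul, h, map_sum_mul_dv hTd, flux]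
    ring
  have h2 : ∑ i, S.eps i k * S.x i = 0 := by simpa only [Fin.sum_univ_three] using S.x_eps k
  rw [map_sum, Finset.sum_congr rfl fun i _ => h1 i, Finset.sum_add_distrib, ← Finset.sum_mul, h2,
    zero_mul, add_zero]

/-- Differentiating `u` in the mass term produces the `8 * d i m` inside the bracket;
differentiating the mass produces the term with factor `u`. The normal component `Z` drops by the
radial identity. -/
lemma map_sum_grad (hTx : ∀ a, T (S.x a) = 0) (hTd : ∀ a f, T (S.d a f) = S.d a (T f))
    (hu : T u = 1) (h : ∀ i, 4 * T (N i) = S.evol m C (fun a b => T (C a b)) i + S.x i * Z)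
    {M : A} (hm : 8 * T m = M) (k : Fin 3) :
    T (∑ i, S.d i (S.x k) * (16 * N i - 16 * (u * S.d i m) - 4 * ∑ j, C i j * S.dv C j -
      S.d i (dot C C))) = 2 * ∑ i, S.d i (S.x k) * (2 * S.flux m C (fun a b => T (C a b)) i -
        8 * S.d i m - S.d i (dot C (fun a b => T (C a b)))) -
        2 * (u * ∑ i, S.d i (S.x k) * S.d i M) := by
  have h1 : ∀ i, T (S.d i (S.x k) * (16 * N i - 16 * (u * S.d i m) - 4 * ∑ j, C i j * S.dv C j -
      S.d i (dot C C))) = 2 * (S.d i (S.x k) * (2 * S.flux m C (fun a b => T (C a b)) i -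
        8 * S.d i m - S.d i (dot C (fun a b => T (C a b))))) -
        2 * (u * (S.d i (S.x k) * S.d i M)) + 4 * Z * (S.x i * S.d i (S.x k)) := fun i => by
    rw [Derivation.leibniz, hTd, hTx, map_zero, smul_zero, add_zero, smul_eq_mul, ← hm]
    rw [map_sub, map_sub, map_sub, derivation_ofNat_mul, derivation_ofNat_mul,
      derivation_ofNat_mul, derivation_ofNat_mul, hTd i (dot C C), map_dot, derivation_ofNat_mul,
      map_sum_mul_dv hTd, Derivation.leibniz, hTd, hu, flux, smul_eq_mul, smul_eq_mul]
    linear_combination 4 * S.d i (S.x k) * h i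
  rw [map_sum, Finset.sum_congr rfl fun i _ => h1 i, Finset.sum_add_distrib, Finset.sum_sub_distrib,
    ← Finset.mul_sum, ← Finset.mul_sum, ← Finset.mul_sum, ← Finset.mul_sum, S.radial, mul_zero,
    add_zero]

end SphereCalculus

/-! ### Slices of constant retarded time and their integrals -/

namespace ParamDomain

/-- The domain of fields on the sphere. -/
def static : ParamDomain where
  carrier := Set.univ
  convex := convex_univ
  nonempty_interior := by simp

variable {I : Set ℝ} {hI : I.OrdConnected} {hI' : I.Nontrivial} {u : ℝ} (hu : u ∈ I)

include hu in
lemma slice_mem (p : ℝ × ℝ) (_ : p ∈ static.carrier) :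
    (0 : ℝ × ℝ →L[ℝ] ℝ × ℝ) p + (u, 0) ∈ (ofInterval I hI hI').carrier := by
  rw [zero_apply, zero_add]
  exact ⟨hu, trivial⟩

/-- Restriction of fields to fixed retarded time. -/
def slice : (ofInterval I hI hI').smooth →ₐ[ℝ] static.smooth := pullHom 0 (u, 0) (slice_mem hu)

lemma slice_apply (f : (ofInterval I hI hI').smooth) (p : static.carrier) (x : S2) :
    (slice hu f).1 (p, x) = f.1 (⟨(u, 0), hu, trivial⟩, x) :=
  congrArg f.1 (Prod.ext (Subtype.ext (zero_add _)) rfl)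

lemma d_slice (a : Fin 3) (f : (ofInterval I hI hI').smooth) :
    slice hu (d a f) = d a (slice hu f) :=
  (d_pullHom _ _ (slice_mem hu) _ _).symm

/-- Integration over the sphere. -/
def staticIntegral : static.smooth →ₗ[ℝ] ℝ := sphereIntegral ⟨0, trivial⟩

lemma staticIntegral_eq {f : S2 → ℝ} {F : static.smooth} (h : ∀ p x, f x = F.1 (p, x)) :
    ∫ x, f x ∂area = staticIntegral F :=
  integral_congr_ae (.of_forall fun x => h _ x)

lemma staticIntegral_d (a : Fin 3) (f : static.smooth) :
    staticIntegral (static.sphere.d a f) = 2 * staticIntegral (static.sphere.x a * f) :=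
  sphereIntegral_d _ _ _

/-- Integrals over the sphere may be differentiated with respect to the retarded time. -/
lemma hasDerivWithinAt_integral_slice {F : ℝ → ℝ} {r : ℝ} {f : (ofInterval I hI hI').smooth}
    (hF : ∀ s (hs : s ∈ I), F s = r * staticIntegral (slice hs f)) :
    HasDerivWithinAt F (r * staticIntegral (slice hu (dFst f))) I u := by
  have h := (hasDerivWithinAt_integral (P := ofInterval I hI hI') f hI.convex
    (γ := fun s => (s, 0)) (γ' := (1, 0)) (fun s hs => ⟨hs, trivial⟩)
    (fun s => (hasDerivAt_id s).prodMk (hasDerivAt_const s 0)) hu).const_mul r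
  have e : ∀ s (hs : s ∈ I), ∫ x, (ofInterval I hI hI').ext f ((s, 0), x.1) ∂area =
      staticIntegral (slice hs f) := fun s hs => staticIntegral_eq fun p x => by
    rw [slice_apply]
    exact ext_coe f.1 ⟨(s, 0), hs, trivial⟩ x
  have e2 : ∫ x, (dFst f).1 (⟨(u, 0), hu, trivial⟩, x) ∂area = staticIntegral (slice hu (dFst f)) :=
    staticIntegral_eq fun p x => (slice_apply hu _ p x).symm
  rw [← e2]
  refine h.congr (fun s hs => ?_) ?_
  · rw [hF s hs, e s hs]
  · rw [hF u hu, e u hu]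

end ParamDomain

/-! ### The charges and the news as quantities on a slice -/

namespace IsVacuumBondiSachs

open ParamDomain SphereCalculus

variable {I : Set ℝ} {R : ℝ → ℝ} {B : BondiSachs} {D : ScriData}
  (hB : IsVacuumBondiSachs I R B D) (hI : I.OrdConnected) (hI' : I.Nontrivial)

lemma grad_coordX {p : static.carrier} (k : Fin 3) (x : S2) (a : Fin 3) :
    grad (coordX k) x a = (static.sphere.d a (static.sphere.x k)).1 (p, x) :=
  grad_eq (F := static.sphere.x k) (fun _ => rfl) x a

lemma slice_shear {u : ℝ} (hu : u ∈ I) {p : static.carrier} (x : S2) (a b : Fin 3) :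
    D.C u x a b = (slice hu (hB.shear hI hI' a b)).1 (p, x) := by
  rw [slice_apply]
  rfl

lemma slice_momentum {u : ℝ} (hu : u ∈ I) {p : static.carrier} (x : S2) (a : Fin 3) :
    D.N u x a = (slice hu (hB.momentum hI hI' a)).1 (p, x) := by
  rw [slice_apply]
  rfl

lemma slice_mass {u : ℝ} (hu : u ∈ I) {p : static.carrier} (x : S2) :
    D.m u x = (slice hu (hB.mass hI hI')).1 (p, x) := by
  rw [slice_apply]
  rfl

lemma map_isSTT {u : ℝ} (hu : u ∈ I) {C : Fin 3 → Fin 3 → (ofInterval I hI hI').smooth}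
    (hC : (ofInterval I hI hI').sphere.IsSTT C) :
    static.sphere.IsSTT fun a b => slice hu (C a b) where
  symm a b := by rw [hC.symm]
  tangent a := by
    have := congrArg (slice hu) (hC.tangent a)
    rwa [map_sum, map_zero] at this
  trace := by
    have := congrArg (slice hu) hC.trace
    rwa [map_sum, map_zero] at this

/-- Derivatives within an interval with interior points are unique, so the news agrees with the
field derivative at endpoints as well. -/
lemma slice_news {u : ℝ} (hu : u ∈ I) {p : static.carrier} (x : S2) (a b : Fin 3) :
    D.news I u x a b = (slice hu (hB.news hI hI' a b)).1 (p, x) := by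
  have h := hasDerivWithinAt_param (hB.shear hI hI' a b) x (I := I) (γ := fun s => (s, 0))
    (γ' := (1, 0)) (fun s hs => ⟨hs, trivial⟩) hu
    ((hasDerivAt_id u).prodMk (hasDerivAt_const u (0 : ℝ))).hasDerivWithinAt
  have e : ∀ s ∈ I, D.C s x a b = (ofInterval I hI hI').ext (hB.shear hI hI' a b) ((s, 0), x.1) :=
    fun s hs => by
      rw [ext_pair _ (show (s, (0 : ℝ)) ∈ (ofInterval I hI hI').carrier from ⟨hs, trivial⟩),
        toS2_self]
      rfl
  have hint : (interior I).Nonempty := by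
    have := (ofInterval I hI hI').nonempty_interior
    obtain ⟨q, hq⟩ := this
    have hq' : q ∈ interior (I ×ˢ Set.univ) := hq
    rw [interior_prod_eq] at hq'
    exact ⟨_, hq'.1⟩
  rw [slice_apply, ScriData.news,
    (h.congr e (e u hu)).derivWithin (uniqueDiffOn_convex hI.convex hint u hu)]
  rfl

lemma slice_dv {u : ℝ} (hu : u ∈ I) (a : Fin 3) :
    static.sphere.dv (fun a b => slice hu (hB.shear hI hI' a b)) a =
      slice hu ((ofInterval I hI hI').sphere.dv (hB.shear hI hI') a) := by
  rw [dv, dv, map_sum]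
  exact Finset.sum_congr rfl fun b _ => (d_slice hu _ _).symm

lemma classicalJ_eq (k : Fin 3) {u : ℝ} (hu : u ∈ I) : classicalJ D k u =
    1 / 4 * staticIntegral (slice hu (∑ a, (ofInterval I hI hI').sphere.eps a k *
      (4 * hB.momentum hI hI' a - ∑ b, hB.shear hI hI' a b *
        (ofInterval I hI hI').sphere.dv (hB.shear hI hI') b))) := by
  have hC := map_isSTT hI hI' hu (hB.shear_isSTT hI hI')
  rw [← smul_eq_mul (1 / 4 : ℝ), ← map_smul, classicalJ]
  refine staticIntegral_eq fun p x => ?_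
  have e : ∀ a, slice hu ((ofInterval I hI hI').sphere.eps a k) =
      ∑ b, static.sphere.eps a b * static.sphere.d b (static.sphere.x k) := fun a => by
    rw [sum_eps_mul_d_x]
    exact map_eps (fun _ => rfl) a k
  simp only [map_sum, map_mul, map_sub, e, ← slice_dv, map_ofNat]
  simp only [ParamDomain.eps_eq (p := p), grad_coordX (p := p), hB.slice_momentum hI hI' hu (p := p),
    hB.slice_shear hI hI' hu (p := p), div2_eq (hB.slice_shear hI hI' hu (p := p)) hC]
  change _ = 1 / 4 * (∑ a, _ : static.smooth).1 (p, x)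
  simp only [ParamDomain.sum_apply, ParamDomain.mul_apply, ParamDomain.sub_apply, Finset.mul_sum]
  refine Finset.sum_congr rfl fun a _ => ?_
  rw [Finset.sum_mul, Finset.mul_sum]
  refine Finset.sum_congr rfl fun b _ => ?_
  have h4 : (4 : static.smooth).1 (p, x) = 4 := rfl
  rw [h4]
  simp only [← Finset.mul_sum]
  ring

lemma classicalC_eq (k : Fin 3) {u : ℝ} (hu : u ∈ I) : classicalC D k u =
    1 / 16 * staticIntegral (slice hu (∑ a, (ofInterval I hI hI').sphere.d a ((ofInterval I hI hI').sphere.x k) *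
      (16 * hB.momentum hI hI' a -
        16 * (fstParam * (ofInterval I hI hI').sphere.d a (hB.mass hI hI')) -
        4 * ∑ b, hB.shear hI hI' a b *
        (ofInterval I hI hI').sphere.dv (hB.shear hI hI') b -
        (ofInterval I hI hI').sphere.d a (dot (hB.shear hI hI') (hB.shear hI hI'))))) := by
  have hC := map_isSTT hI hI' hu (hB.shear_isSTT hI hI')
  rw [← smul_eq_mul (1 / 16 : ℝ), ← map_smul, classicalC]
  refine staticIntegral_eq fun p x => ?_
  have e1 : ∀ f a, slice hu ((ofInterval I hI hI').sphere.d a f) =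
      static.sphere.d a (slice hu f) := fun f a => d_slice hu a f
  have e2 : slice hu ((ofInterval I hI hI').sphere.x k) = static.sphere.x k := rfl
  have e3 : slice hu (dot (hB.shear hI hI') (hB.shear hI hI')) =
    dot (fun a b => slice hu (hB.shear hI hI' a b)) (fun a b => slice hu (hB.shear hI hI' a b)) := by
    simp only [dot, map_sum, map_mul]
  have e4 : (slice hu (fstParam : (ofInterval I hI hI').smooth)).1 (p, x) = u := slice_apply hu _ _ _
  simp only [map_sum, map_mul, map_sub, e1, e2, e3, ← slice_dv, map_ofNat]
  simp only [grad_coordX (p := p), hB.slice_momentum hI hI' hu (p := p),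
    hB.slice_shear hI hI' hu (p := p), div2_eq (hB.slice_shear hI hI' hu (p := p)) hC,
    grad_eq (hB.slice_mass hI hI' hu (p := p)),
    grad_eq (normSq2_eq (hB.slice_shear hI hI' hu (p := p)))]
  change _ = 1 / 16 * (∑ a, _ : static.smooth).1 (p, x)
  have h4 : (4 : static.smooth).1 (p, x) = 4 := rfl
  have h16 : (16 : static.smooth).1 (p, x) = 16 := rfl
  simp only [ParamDomain.sum_apply, ParamDomain.mul_apply, ParamDomain.sub_apply, Finset.mul_sum]
  refine Finset.sum_congr rfl fun a _ => ?_
  simp only [← Finset.mul_sum]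
  rw [h4, h16, e4]
  ring

end IsVacuumBondiSachs

/-! ### Derivatives of the charges in terms of the potentials -/

namespace IsVacuumBondiSachs

open ParamDomain SphereCalculus

variable {I : Set ℝ} {R : ℝ → ℝ} {B : BondiSachs} {D : ScriData}
  (hB : IsVacuumBondiSachs I R B D) (hI : I.OrdConnected) (hI' : I.Nontrivial)
  {u : ℝ} (hu : u ∈ I) {c c' n n' : S2 → ℝ}
  (hc : ContMDiff (𝓡 2) 𝓘(ℝ, ℝ) ∞ c) (hc' : ContMDiff (𝓡 2) 𝓘(ℝ, ℝ) ∞ c')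
  (hn : ContMDiff (𝓡 2) 𝓘(ℝ, ℝ) ∞ n) (hn' : ContMDiff (𝓡 2) 𝓘(ℝ, ℝ) ∞ n')
  (hC : ∀ x a b, D.C u x a b = tensorOfPotentials c c' x a b)
  (hN : ∀ x a b, D.news I u x a b = tensorOfPotentials n n' x a b)

include hC in
lemma two_mul_slice_shear (a b : Fin 3) : 2 * slice hu (hB.shear hI hI' a b) =
    static.sphere.pot (constField hc) (constField hc') a b := smooth_ext fun p x => by
  rw [← tensorOfPotentials_eq (f := c) (g := c') (fun _ => rfl) (fun _ => rfl), ← hC,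
    hB.slice_shear hI hI' hu (p := p)]
  rfl

include hN in
lemma two_mul_slice_news (a b : Fin 3) : 2 * slice hu (hB.news hI hI' a b) =
    static.sphere.pot (constField hn) (constField hn') a b := smooth_ext fun p x => by
  rw [← tensorOfPotentials_eq (f := n) (g := n') (fun _ => rfl) (fun _ => rfl), ← hN,
    hB.slice_news hI hI' hu (p := p)]
  rfl

lemma slice_flux (a : Fin 3) : slice hu ((ofInterval I hI hI').sphere.flux (hB.mass hI hI')
    (hB.shear hI hI') (hB.news hI hI') a) =
    static.sphere.flux (slice hu (hB.mass hI hI')) (fun a b => slice hu (hB.shear hI hI' a b))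
      (fun a b => slice hu (hB.news hI hI' a b)) a :=
  map_flux (φ := slice hu) (S := (ofInterval I hI hI').sphere) (S' := static.sphere) (fun _ => rfl)
    (fun a f => d_slice hu a f) _ _ _ _

include hB hI hI' hu hc hc' hn hn' hC hN

/-- The coefficient 1/8 is the 1/4 of `classicalJ_eq` times the 1/2 from `integral_eps_flux`. -/
lemma hasDerivWithinAt_classicalJ (k : Fin 3) : HasDerivWithinAt (classicalJ D k)
    (1 / 8 * ∫ x, coordX k x * (bracket1 c (lap (lap2 n)) x + bracket1 c' (lap (lap2 n')) x) ∂area)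
    I u := by
  obtain ⟨Z, hZ⟩ := hB.dFst_momentum hI hI'
  have h := hasDerivWithinAt_integral_slice hu (fun s hs => hB.classicalJ_eq hI hI' k hs)
  refine h.congr_deriv ?_
  have e1 := map_sum_eps (T := dFst) (S := (ofInterval I hI hI').sphere) dFst_coord dFst_d hZ k
  have e2 := integral_eps_flux staticIntegral_d k (slice hu (hB.mass hI hI'))
    (map_isSTT hI hI' hu (hB.shear_isSTT hI hI')) (map_isSTT hI hI' hu (hB.news_isSTT hI hI'))
    (hB.two_mul_slice_shear hI hI' hu hc hc' hC) (hB.two_mul_slice_news hI hI' hu hn hn' hN)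
  have e3 : slice hu (∑ i, (ofInterval I hI hI').sphere.eps i k *
      (ofInterval I hI hI').sphere.flux (hB.mass hI hI') (hB.shear hI hI') (hB.news hI hI') i) =
      ∑ i, static.sphere.eps i k * static.sphere.flux (slice hu (hB.mass hI hI'))
        (fun a b => slice hu (hB.shear hI hI' a b)) (fun a b => slice hu (hB.news hI hI' a b)) i := by
    rw [map_sum]
    exact Finset.sum_congr rfl fun i _ => by
      rw [map_mul, slice_flux, map_eps (S' := static.sphere) fun _ => rfl]
  have e4 : ∫ x, coordX k x * (bracket1 c (lap (lap2 n)) x + bracket1 c' (lap (lap2 n')) x) ∂area =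
      staticIntegral (static.sphere.x k * (static.sphere.poisson (constField hc)
        (static.sphere.lap (static.sphere.lap (constField hn) + 2 * constField hn)) +
        static.sphere.poisson (constField hc')
        (static.sphere.lap (static.sphere.lap (constField hn') + 2 * constField hn')))) :=
    staticIntegral_eq fun p x => by
      rw [bracket1_eq (f := c) (F := constField hc) (p := p) (fun _ => rfl)
          (lap_eq (lap2_eq (f := n) (F := constField hn) fun _ => rfl)),
        bracket1_eq (f := c') (F := constField hc') (p := p) (fun _ => rfl)
          (lap_eq (lap2_eq (f := n') (F := constField hn') fun _ => rfl))]
      rfl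
  have e5 : dFst (∑ a, (ofInterval I hI hI').sphere.eps a k *
      (4 * hB.momentum hI hI' a - ∑ b, hB.shear hI hI' a b *
        (ofInterval I hI hI').sphere.dv (hB.shear hI hI') b)) =
      ∑ i, (ofInterval I hI hI').sphere.eps i k * (ofInterval I hI hI').sphere.flux
        (hB.mass hI hI') (hB.shear hI hI') (hB.news hI hI') i := e1
  rw [e4, mul_add, map_add, ← e2, e5, e3]
  ring

lemma hasDerivWithinAt_classicalC (k : Fin 3) : HasDerivWithinAt (classicalC D k)
    (1 / 8 * ∫ x, coordX k x *
      (u * (lap2 n x ^ 2 + lap2 n' x ^ 2 - 4 * bracket1 n (lap2 n') x) +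
        bracket2 (lap2 c) (lap2 n) x + bracket2 (lap2 c') (lap2 n') x) ∂area) I u := by
  obtain ⟨Z, hZ⟩ := hB.dFst_momentum hI hI'
  have h := hasDerivWithinAt_integral_slice hu (fun s hs => hB.classicalC_eq hI hI' k hs)
  refine h.congr_deriv ?_
  set c₁ : static.smooth := constField hc
  set c₂ : static.smooth := constField hc'
  set n₁ : static.smooth := constField hn
  set n₂ : static.smooth := constField hn'
  have hN' := map_isSTT hI hI' hu (hB.news_isSTT hI hI')
  have hn2 := hB.two_mul_slice_news hI hI' hu hn hn' hN
  have e2 := integral_grad_flux staticIntegral_d k (slice hu (hB.mass hI hI'))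
    (map_isSTT hI hI' hu (hB.shear_isSTT hI hI')) hN'
    (hB.two_mul_slice_shear hI hI' hu hc hc' hC) hn2
  have e3 := integral_grad_mass staticIntegral_d k hN' hn2
  have hd : ∀ a f, slice hu ((ofInterval I hI hI').sphere.d a f) =
      static.sphere.d a (slice hu f) := fun a f => d_slice hu a f
  have hx : slice hu ((ofInterval I hI hI').sphere.x k) = static.sphere.x k := rfl
  have hfst : slice hu (fstParam : (ofInterval I hI hI').smooth) = algebraMap ℝ _ u :=
    smooth_ext fun p x => slice_apply hu _ _ _
  have e5 : dFst (∑ a, (ofInterval I hI hI').sphere.d a ((ofInterval I hI hI').sphere.x k) *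
      (16 * hB.momentum hI hI' a -
        16 * (fstParam * (ofInterval I hI hI').sphere.d a (hB.mass hI hI')) -
        4 * ∑ b, hB.shear hI hI' a b *
        (ofInterval I hI hI').sphere.dv (hB.shear hI hI') b -
        (ofInterval I hI hI').sphere.d a (dot (hB.shear hI hI') (hB.shear hI hI')))) = _ :=
    map_sum_grad (T := dFst) (S := (ofInterval I hI hI').sphere) dFst_coord dFst_d dFst_fstParam hZ
      (hB.dFst_mass hI hI') k
  have e6 : slice hu (2 * ∑ i, (ofInterval I hI hI').sphere.d i ((ofInterval I hI hI').sphere.x k) *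
      (2 * (ofInterval I hI hI').sphere.flux (hB.mass hI hI') (hB.shear hI hI') (hB.news hI hI') i -
        8 * (ofInterval I hI hI').sphere.d i (hB.mass hI hI') -
        (ofInterval I hI hI').sphere.d i (dot (hB.shear hI hI') (hB.news hI hI'))) -
        2 * (fstParam * ∑ i, (ofInterval I hI hI').sphere.d i ((ofInterval I hI hI').sphere.x k) *
          (ofInterval I hI hI').sphere.d i (2 * ∑ b, (ofInterval I hI hI').sphere.d b
      ((ofInterval I hI hI').sphere.dv (hB.news hI hI') b) -
    dot (hB.news hI hI') (hB.news hI hI')))) =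
      (2 : ℝ) • (∑ i, static.sphere.d i (static.sphere.x k) *
        (2 * static.sphere.flux (slice hu (hB.mass hI hI'))
        (fun a b => slice hu (hB.shear hI hI' a b)) (fun a b => slice hu (hB.news hI hI' a b)) i -
        8 * static.sphere.d i (slice hu (hB.mass hI hI')) -
        static.sphere.d i (dot (fun a b => slice hu (hB.shear hI hI' a b))
          (fun a b => slice hu (hB.news hI hI' a b))))) -
      (2 * u) • ∑ i, static.sphere.d i (static.sphere.x k) *
        static.sphere.d i (2 * ∑ b, static.sphere.d b
          (static.sphere.dv (fun a b => slice hu (hB.news hI hI' a b)) b) -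
        dot (fun a b => slice hu (hB.news hI hI' a b))
          (fun a b => slice hu (hB.news hI hI' a b))) := by
    simp only [dot, dv, map_sub, map_mul, map_sum, map_ofNat, hd, hx, slice_flux, hfst,
      Algebra.smul_def]
    ring
  have e4 : ∫ x, coordX k x * (u * (lap2 n x ^ 2 + lap2 n' x ^ 2 - 4 * bracket1 n (lap2 n') x) +
        bracket2 (lap2 c) (lap2 n) x + bracket2 (lap2 c') (lap2 n') x) ∂area = 
      staticIntegral (u • (static.sphere.x k *
          ((static.sphere.lap n₁ + 2 * n₁) * (static.sphere.lap n₁ + 2 * n₁)) +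
        static.sphere.x k * ((static.sphere.lap n₂ + 2 * n₂) * (static.sphere.lap n₂ + 2 * n₂)) -
        (4 : ℝ) • (static.sphere.x k * static.sphere.poisson n₁ (static.sphere.lap n₂ + 2 * n₂))) +
      (1 / 2 : ℝ) • (static.sphere.x k *
          ((static.sphere.lap n₁ + 2 * n₁) * static.sphere.lap (static.sphere.lap c₁ + 2 * c₁)) -
        static.sphere.x k *
          ((static.sphere.lap c₁ + 2 * c₁) * static.sphere.lap (static.sphere.lap n₁ + 2 * n₁)) +
        static.sphere.x k *
          ((static.sphere.lap n₂ + 2 * n₂) * static.sphere.lap (static.sphere.lap c₂ + 2 * c₂)) -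
        static.sphere.x k *
          ((static.sphere.lap c₂ + 2 * c₂) * static.sphere.lap (static.sphere.lap n₂ + 2 * n₂)))) :=
    staticIntegral_eq fun p x => by
      have a1 := lap2_eq (f := c) (F := c₁) (p := p) fun _ => rfl
      have a2 := lap2_eq (f := c') (F := c₂) (p := p) fun _ => rfl
      have a3 := lap2_eq (f := n) (F := n₁) (p := p) fun _ => rfl
      have a4 := lap2_eq (f := n') (F := n₂) (p := p) fun _ => rfl
      rw [bracket1_eq (f := n) (F := n₁) (p := p) (fun _ => rfl) a4, bracket2, bracket2, lap_eq a1, lap_eq a2,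
        lap_eq a3, lap_eq a4, a1, a2, a3, a4]
      change x.1 k * (u * (_ + _ - _) + _ + _) = u * (x.1 k * (_ * _) + x.1 k * (_ * _) -
        4 * (x.1 k * _)) + 1 / 2 * (x.1 k * (_ * _) - x.1 k * (_ * _) + x.1 k * (_ * _) -
        x.1 k * (_ * _))
      ring
  have e5' := (congrArg (slice hu) e5).trans e6
  rw [e5', e4]
  simp only [map_add, map_sub, map_smul, smul_eq_mul] at e2 e3 ⊢
  -- The factor 1/16 is the normalization of `classicalC_eq`, and it matches 1/8 times the 1/2 in
  -- `bracket2`. The mass term enters with `-2 * u`, hence with weight `u / 8`.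
  linear_combination (1 / 16) * e2 - 1 / 8 * u * e3

end IsVacuumBondiSachs

end

theorem theorem2 (I : Set ℝ) (hI : I.OrdConnected) (hI' : I.Nontrivial) (R : ℝ → ℝ)
    (B : BondiSachs) (D : ScriData) (hB : IsVacuumBondiSachs I R B D)
    (c c' n n' : ℝ → S2 → ℝ)
    (hc : ∀ u ∈ I, ContMDiff (𝓡 2) 𝓘(ℝ, ℝ) ∞ (c u))
    (hc' : ∀ u ∈ I, ContMDiff (𝓡 2) 𝓘(ℝ, ℝ) ∞ (c' u))
    (hn : ∀ u ∈ I, ContMDiff (𝓡 2) 𝓘(ℝ, ℝ) ∞ (n u))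
    (hn' : ∀ u ∈ I, ContMDiff (𝓡 2) 𝓘(ℝ, ℝ) ∞ (n' u))
    (hC : ∀ u ∈ I, ∀ x a b, D.C u x a b = tensorOfPotentials (c u) (c' u) x a b)
    (hN : ∀ u ∈ I, ∀ x a b, D.news I u x a b = tensorOfPotentials (n u) (n' u) x a b)
    (k : Fin 3) (u : ℝ) (hu : u ∈ I) :
    HasDerivWithinAt (classicalJ D k)
      (1 / 8 * ∫ x, coordX k x *
        (bracket1 (c u) (lap (lap2 (n u))) x + bracket1 (c' u) (lap (lap2 (n' u))) x) ∂area) I u ∧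
    HasDerivWithinAt (classicalC D k)
      (1 / 8 * ∫ x, coordX k x *
        (u * (lap2 (n u) x ^ 2 + lap2 (n' u) x ^ 2 - 4 * bracket1 (n u) (lap2 (n' u)) x) +
          bracket2 (lap2 (c u)) (lap2 (n u)) x + bracket2 (lap2 (c' u)) (lap2 (n' u)) x) ∂area)
      I u :=
  ⟨hB.hasDerivWithinAt_classicalJ hI hI' hu (hc u hu) (hc' u hu) (hn u hu) (hn' u hu) (hC u hu)
      (hN u hu) k,
    hB.hasDerivWithinAt_classicalC hI hI' hu (hc u hu) (hc' u hu) (hn u hu) (hn' u hu) (hC u hu)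
      (hN u hu) k⟩
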